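/- **Barycentric Deformation Theorem.** All coefficients are in $\mathbb{F}_2$. *Setting.* For $n\ge 0$ let $X_n$ be a (Hausdorff) regular CW complex with face poset $\mathcal P_n$ (its closed cells ordered by inclusion), and let $\mathcal P_\bullet$ be equipped with a semicosimplicial structure, i.e. a functor $[n]\mapsto\mathcal P_n$ from the category of the sets $[n]=\{0,\dots,n\}$ and injective monotone maps to the category of posets and monotone maps; $d_a:[n]\to[n+1]$ is the coface that skips $a$. Let $C_n(\bullet)=C^{CW}_\bullet(X_n;\mathbb F_2)$ be the cellular chain complex, with basis $\mathcal P_n$ and $\partial\sigma=\sum\tau$ over the codimension-one faces $\tau$ of $\sigma$, and let $K_n(\bullet)$ be the complex of normalized simplicial chains of the nerve of $\mathcal P_n$, with basis the chains $\sigma_0<\dots<\sigma_d$ of $\mathcal P_n$. Put $C_n(d)$ and $K_n(d)$ in bidegree $(p,q)=(-n,d)$. Then $K$ is a bicomplex, with vertical differential $\partial$ and horizontal differential $\sum_{a}(-1)^a d_a$. For a multiset $I=\{i_1\le\dots\le i_m\}$ with elements in $[n+1]$ put $d_I=d_{i_1}\circ\cdots\circ d_{i_m}:[n]\to[n+m]$;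 for multisets $J\subset[n+1]$ and $I\subset[n+|J|+1]$ let $I\vee J$ be the multiset $L\subset[n+1]$ with $d_I\circ d_J=d_L$. Let $\mu_I(\sigma)$ be the span of all cells $\tau\le d_I\sigma$. A *truncated $r$-multicomplex* is a $(\mathbb Z,\mathbb Z)$-graded module $C_{**}$ with maps $D_i$, $0\le i\le r$, of bidegree $(-i,i-1)$ such that $\sum_{i+j=k}D_iD_j=0$ for $0\le k\le r$. A morphism from $(C,D)$ to $(C',D')$ consists of maps $f_i$, $0\le i\le r$, of bidegree $(-i,i)$ with $\sum_{i+j=k}f_iD_j=\sum_{i+j=k}D'_if_j$ for $0\le k\le r$. Put $E^s_{pq}=Z^s_{pq}/B^s_{pq}$, where $Z^s_{pq}$ is the set of $x\in C_{pq}$ with $D_0x=0$ for which there are $z_{p-j}\in C_{p-j,q+j}$ $(1\le j\le s-1)$ with $D_kx=\sum_{i=0}^{k-1}D_iz_{p-k+i}$ for $1\le k\le s-1$, and $B^s_{pq}$ is the set of all $x=\sum_{k=0}^{s-1}D_kc_{p+k}$ with $c_{p+k}\in C_{p+k,q-k+1}$ and $\sum_{k=\ell}^{s-1}D_{k-\ell}c_{p+k}=0$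 for $1\le\ell\le s-1$. *Theorem.* Let $r\ge 0$, and let linear maps $D_I:C_n(d)\to C_{n+i}(d+i-1)$ be given for all $n,d\ge 0$ and all multisets $I\subset[n+1]$ with $|I|=i\le r$. Suppose that 0. $D_\emptyset$ is the cellular differential $\partial$, and (if $r\ge1$) every $D_{\{a\}}$ preserves the augmentation, i.e. for every vertex $v$ the vertex sum $D_{\{a\}}(v)$ has an odd number of terms; 1. $\sum_{I\vee J=K}D_ID_J=0$ for every multiset $K\subset[n+1]$ with $|K|\le r$ (as maps on $C_n$, for all $n$); 2. $D_I(\sigma)\in\mu_I(\sigma)$ for every cell $\sigma\in\mathcal P_n$ and every $I\subset[n+1]$ with $|I|\le r$. Then $D_i=\sum_{|I|=i}D_I$ $(0\le i\le r)$ makes $C$ a truncated $r$-multicomplex, and there is a morphism of truncated $r$-multicomplexes $\mathrm{sd}_\bullet:C\to\tau_rK$ (with $\tau_rK$ the bicomplex $K$ regarded as a truncated $r$-multicomplex, with $D_i=0$ for $i\ge2$) whose component $\mathrm{sd}_0$ is the subdivision map $\sigma\mapsto\sum(\tau_0<\dots<\tau_d=\sigma)$, summed over the chains of faces of $\sigma$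 with $\dim\tau_j=j$, $d=\dim\sigma$. Moreover, for all $1\le s\le r$ and all $p,q\in\mathbb Z$, one has $B^s_{pq}\subseteq Z^s_{pq}$ in both $C$ and $K$, and $\mathrm{sd}_0$ induces an isomorphism $E^s_{pq}(C)\cong E^s_{pq}(K)$. -/

import Mathlib

/-! ## Truncated multicomplexes and the pages of their spectral sequences -/

namespace BarycentricDeformation

section Multicomplex

variable {k M M' : Type*} [CommRing k] [AddCommGroup M] [Module k M] [AddCommGroup M'] [Module k M']

/-- A truncated `r`-multicomplex: a `(ℤ, ℤ)`-graded `k`-module `M = ⨁ gr p q` with maps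
`D i`, `0 ≤ i ≤ r`, of bidegree `(-i, i - 1)` such that `∑_{i + j = l} D i ∘ D j = 0` for
`0 ≤ l ≤ r`. The values `D i` for `i > r` are irrelevant. -/
structure IsTruncatedMulticomplex (r : ℕ) (gr : ℤ → ℤ → Submodule k M)
    (D : ℕ → M →ₗ[k] M) : Prop where
  internal : DirectSum.IsInternal (fun pq : ℤ × ℤ => gr pq.1 pq.2)
  bidegree : ∀ i ≤ r, ∀ p q : ℤ, ∀ x ∈ gr p q, D i x ∈ gr (p - i) (q + i - 1)
  equation : ∀ l ≤ r, ∑ ij ∈ Finset.HasAntidiagonal.antidiagonal l, D ij.1 ∘ₗ D ij.2 = 0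

/-- A morphism of truncated `r`-multicomplexes: maps `f i`, `0 ≤ i ≤ r`, of bidegree `(-i, i)` such
that `∑_{i + j = l} f i ∘ D j = ∑_{i + j = l} D' i ∘ f j` for `0 ≤ l ≤ r`. -/
structure IsTruncatedMorphism (r : ℕ) (gr : ℤ → ℤ → Submodule k M) (D : ℕ → M →ₗ[k] M)
    (gr' : ℤ → ℤ → Submodule k M') (D' : ℕ → M' →ₗ[k] M') (f : ℕ → M →ₗ[k] M') : Prop where
  bidegree : ∀ i ≤ r, ∀ p q : ℤ, ∀ x ∈ gr p q, f i x ∈ gr' (p - i) (q + i)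
  equation : ∀ l ≤ r, ∑ ij ∈ Finset.HasAntidiagonal.antidiagonal l, f ij.1 ∘ₗ D ij.2 =
    ∑ ij ∈ Finset.HasAntidiagonal.antidiagonal l, D' ij.1 ∘ₗ f ij.2

/-- The `s`-cycles `Z^s_{p,q}`. The witness `z_{p-j}` is `z j`, in bidegree `(p - j, q + j)`. -/
def cycles (gr : ℤ → ℤ → Submodule k M) (D : ℕ → M →ₗ[k] M) (s : ℕ) (p q : ℤ) :
    Submodule k M where
  carrier := {x | x ∈ gr p q ∧ D 0 x = 0 ∧ ∃ z : ℕ → M,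
    (∀ j : ℕ, 1 ≤ j → j < s → z j ∈ gr (p - j) (q + j)) ∧
    ∀ m : ℕ, 1 ≤ m → m < s → D m x = ∑ i ∈ Finset.range m, D i (z (m - i))}
  zero_mem' := ⟨Submodule.zero_mem _, map_zero _, fun _ => 0,
    fun _ _ _ => Submodule.zero_mem _, fun _ _ _ => by simp⟩
  add_mem' := by
    rintro a b ⟨ha, ha0, z, hz, hz'⟩ ⟨hb, hb0, w, hw, hw'⟩
    refine ⟨Submodule.add_mem _ ha hb, by simp [ha0, hb0], fun j => z j + w j,
      fun j h1 h2 => Submodule.add_mem _ (hz j h1 h2) (hw j h1 h2), fun m h1 h2 => ?_⟩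
    simp [hz' m h1 h2, hw' m h1 h2, Finset.sum_add_distrib]
  smul_mem' := by
    rintro c a ⟨ha, ha0, z, hz, hz'⟩
    refine ⟨Submodule.smul_mem _ c ha, by simp [ha0], fun j => c • z j,
      fun j h1 h2 => Submodule.smul_mem _ c (hz j h1 h2), fun m h1 h2 => ?_⟩
    simp [hz' m h1 h2, Finset.smul_sum]

/-- The `s`-boundaries `B^s_{p,q}`. The witness `c_{p+l}` is `c l`, in bidegree
`(p + l, q - l + 1)`. -/
def boundaries (gr : ℤ → ℤ → Submodule k M) (D : ℕ → M →ₗ[k] M) (s : ℕ) (p q : ℤ) :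
    Submodule k M where
  carrier := {x | ∃ c : ℕ → M,
    (∀ l : ℕ, l < s → c l ∈ gr (p + l) (q - l + 1)) ∧
    x = ∑ l ∈ Finset.range s, D l (c l) ∧
    ∀ m : ℕ, 1 ≤ m → m < s → ∑ l ∈ Finset.Ico m s, D (l - m) (c l) = 0}
  zero_mem' := ⟨fun _ => 0, fun _ _ => Submodule.zero_mem _, by simp, fun _ _ _ => by simp⟩
  add_mem' := by
    rintro a b ⟨c, hc, rfl, hc'⟩ ⟨d, hd, rfl, hd'⟩
    refine ⟨fun j => c j + d j, fun j h => Submodule.add_mem _ (hc j h) (hd j h),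
      by simp [Finset.sum_add_distrib], fun m h1 h2 => ?_⟩
    simp [hc' m h1 h2, hd' m h1 h2, Finset.sum_add_distrib]
  smul_mem' := by
    rintro t a ⟨c, hc, rfl, hc'⟩
    refine ⟨fun j => t • c j, fun j h => Submodule.smul_mem _ t (hc j h),
      by simp [Finset.smul_sum], fun m h1 h2 => ?_⟩
    simp [← Finset.smul_sum, hc' m h1 h2]

/-- The term `E^s_{p,q} = Z^s_{p,q} / B^s_{p,q}`. -/
abbrev Page (gr : ℤ → ℤ → Submodule k M) (D : ℕ → M →ₗ[k] M) (s : ℕ) (p q : ℤ) : Type _ :=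
  (cycles gr D s p q) ⧸ (boundaries gr D s p q).submoduleOf (cycles gr D s p q)

end Multicomplex

/-! ## Free modules over `𝔽₂` on families of sets -/

section Total

variable {A B : ℕ → Type*}

/-- The inclusion of the free module on `A n` into the free module on all the `A m`. -/
noncomputable def incl (n : ℕ) : (A n →₀ ZMod 2) →ₗ[ZMod 2] ((Σ m, A m) →₀ ZMod 2) :=
  Finsupp.lmapDomain (ZMod 2) (ZMod 2) (fun a => (⟨n, a⟩ : Σ m, A m))

/-- A family of maps `𝔽₂⟨A n⟩ → 𝔽₂⟨B (n + i)⟩`, `n ≥ 0`, seen as one map on the sum over `n`. -/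
noncomputable def total (i : ℕ)
    (f : ∀ n, (A n →₀ ZMod 2) →ₗ[ZMod 2] (B (n + i) →₀ ZMod 2)) :
    ((Σ n, A n) →₀ ZMod 2) →ₗ[ZMod 2] ((Σ n, B n) →₀ ZMod 2) :=
  Finsupp.linearCombination (ZMod 2)
    (fun x : Σ n, A n => incl (x.1 + i) (f x.1 (Finsupp.single x.2 1)))

/-- The bigrading in which a basis element of cosimplicial degree `n` and dimension `d` has bidegree
`(p, q) = (-n, d)`. -/
noncomputable def bigrading (dim : ∀ n, A n → ℕ) (p q : ℤ) :
    Submodule (ZMod 2) ((Σ n, A n) →₀ ZMod 2) :=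
  Finsupp.supported (ZMod 2) (ZMod 2)
    {x : Σ n, A n | -(x.1 : ℤ) = p ∧ (dim x.1 x.2 : ℤ) = q}

end Total

/-! ## Regular CW complexes, face posets and cellular chains -/

section Cells

variable (X : Type*) [TopologicalSpace X] [Topology.CWComplex (Set.univ : Set X)]

/-- A CW complex is regular if every characteristic map is injective on the whole closed ball
(in a Hausdorff space it is then a homeomorphism from the closed ball onto the closed cell). -/
def IsRegularCW : Prop :=
  ∀ (d : ℕ) (e : Topology.RelCWComplex.cell (Set.univ : Set X) d),
    Set.InjOn (Topology.RelCWComplex.map d e) (Metric.closedBall 0 1)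

/-- The set of all cells of `X`. -/
structure Face where
  dim : ℕ
  cell : Topology.RelCWComplex.cell (Set.univ : Set X) dim

variable {X}

/-- The closed cell in `X`. -/
def Face.closed (σ : Face X) : Set X := Topology.RelCWComplex.closedCell σ.dim σ.cell

theorem Face.eq_of_mem {σ τ : Face X} {x : X}
    (h1 : x ∈ Topology.RelCWComplex.openCell σ.dim σ.cell)
    (h2 : x ∈ Topology.RelCWComplex.openCell τ.dim τ.cell) : σ = τ := by
  have h := Topology.RelCWComplex.eq_of_not_disjoint_openCell
    (Set.not_disjoint_iff.mpr ⟨x, h1, h2⟩)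
  cases σ; cases τ
  cases h
  rfl

theorem Face.finite_aux (σ : Face X) : ∃ S : Set (Face X), S.Finite ∧
    (∀ τ ∈ S, τ.dim < σ.dim) ∧ ∀ τ : Face X, τ.closed ⊆ σ.closed → τ = σ ∨ τ ∈ S := by
  obtain ⟨I, hI⟩ := Topology.CWComplex.cellFrontier_subset_finite_openCell σ.dim σ.cell
  refine ⟨⋃ m ∈ Finset.range σ.dim, (fun j => (⟨m, j⟩ : Face X)) '' (I m : Set _), ?_, ?_, ?_⟩
  · exact Set.Finite.biUnion (Finset.finite_toSet _) fun m _ => (Finset.finite_toSet _).image _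
  · intro τ hτ
    simp only [Set.mem_iUnion, Finset.mem_range, Set.mem_image] at hτ
    obtain ⟨m, hm, j, _, rfl⟩ := hτ
    exact hm
  · intro τ hτ
    have h0 := Topology.RelCWComplex.map_zero_mem_openCell τ.dim τ.cell
    have h1 := hτ (Topology.RelCWComplex.openCell_subset_closedCell _ _ h0)
    rw [Face.closed, ← Topology.RelCWComplex.cellFrontier_union_openCell_eq_closedCell] at h1
    rcases h1 with h1 | h1
    · right
      have h2 := hI h1
      simp only [Set.mem_iUnion] at h2
      obtain ⟨m, hm, j, hj, hx⟩ := h2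
      have : τ = ⟨m, j⟩ := Face.eq_of_mem h0 hx
      subst this
      simp only [Set.mem_iUnion, Finset.mem_range, Set.mem_image]
      exact ⟨m, hm, j, hj, rfl⟩
    · exact Or.inl (Face.eq_of_mem h0 h1)

/-- The face poset: closed cells ordered by inclusion. -/
instance : PartialOrder (Face X) where
  le σ τ := σ.closed ⊆ τ.closed
  le_refl _ := subset_rfl
  le_trans _ _ _ := Set.Subset.trans
  le_antisymm σ τ h1 h2 := by
    obtain ⟨S, -, hS, hS'⟩ := Face.finite_aux σ
    obtain ⟨T, -, hT, hT'⟩ := Face.finite_aux τ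
    rcases hT' σ h1 with h | h
    · exact h
    rcases hS' τ h2 with h' | h'
    · exact h'.symm
    exact absurd (hT _ h) (not_lt.mpr (hS _ h').le)

theorem Face.finite_le (σ : Face X) : {τ : Face X | τ ≤ σ}.Finite := by
  obtain ⟨S, hS, -, h⟩ := Face.finite_aux σ
  exact (hS.insert σ).subset fun τ hτ => h τ hτ

/-- The finite set `P(≤ σ)` of faces of `σ`. -/
noncomputable def Face.below (σ : Face X) : Finset (Face X) := σ.finite_le.toFinset

variable (X)

/-- The differential of the cellular chain complex over `𝔽₂` of a regular CW complex, in the basis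
of cells: all incidence numbers are `±1`, so `∂ σ` is the sum of the faces of codimension one. -/
noncomputable def cellularBoundary : (Face X →₀ ZMod 2) →ₗ[ZMod 2] (Face X →₀ ZMod 2) :=
  Finsupp.linearCombination (ZMod 2) fun σ =>
    ∑ τ ∈ σ.below, if τ.dim + 1 = σ.dim then Finsupp.single τ 1 else 0

/-- The augmentation of the cellular chain complex: every vertex goes to `1`. -/
noncomputable def augmentation : (Face X →₀ ZMod 2) →ₗ[ZMod 2] ZMod 2 :=
  Finsupp.linearCombination (ZMod 2) fun σ => if σ.dim = 0 then 1 else 0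

end Cells

/-! ## The nerve of a poset and the subdivision map -/

section Nerve

/-- The nondegenerate simplices `x₀ < ⋯ < x_d` of the nerve of a poset, i.e. its nonempty finite
chains. They form the basis of the normalized simplicial chains of the nerve. -/
structure NerveSimplex (P : Type*) [PartialOrder P] where
  verts : Finset P
  nonempty : verts.Nonempty
  chain : IsChain (· ≤ ·) (verts : Set P)

variable {P Q : Type*} [PartialOrder P] [PartialOrder Q]

/-- The dimension `d` of `x₀ < ⋯ < x_d`. -/
def NerveSimplex.dim (s : NerveSimplex P) : ℕ := s.verts.card - 1

variable (P) in
open Classical in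
/-- `∂ (x₀ < ⋯ < x_d) = ∑ j, (x₀ < ⋯ < x̂_j < ⋯ < x_d)`, and `∂ (x₀) = 0`, over `𝔽₂`. -/
noncomputable def nerveBoundary :
    (NerveSimplex P →₀ ZMod 2) →ₗ[ZMod 2] (NerveSimplex P →₀ ZMod 2) :=
  Finsupp.linearCombination (ZMod 2) fun s =>
    ∑ x ∈ s.verts, if h : (s.verts.erase x).Nonempty then
      Finsupp.single
        (⟨s.verts.erase x, h, s.chain.mono (by exact_mod_cast Finset.erase_subset x s.verts)⟩ :
          NerveSimplex P) 1
      else 0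

open Classical in
/-- The map of normalized chains induced by a monotone map: `(x₀ < ⋯ < x_d)` goes to
`(f x₀ < ⋯ < f x_d)`, or to `0` if the image is degenerate. -/
noncomputable def nerveMap (f : P →o Q) :
    (NerveSimplex P →₀ ZMod 2) →ₗ[ZMod 2] (NerveSimplex Q →₀ ZMod 2) :=
  Finsupp.linearCombination (ZMod 2) fun s =>
    if (s.verts.image f).card = s.verts.card then
      Finsupp.single
        (⟨s.verts.image f, s.nonempty.image f, by
          rw [Finset.coe_image]
          rintro _ ⟨a, ha, rfl⟩ _ ⟨b, hb, rfl⟩ _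
          rcases s.chain.total ha hb with h | h
          · exact Or.inl (f.monotone h)
          · exact Or.inr (f.monotone h)⟩ : NerveSimplex Q) 1
      else 0

open Classical in
/-- The subdivision map from cellular chains to normalized chains of the nerve of the face poset:
`σ` of dimension `d` goes to the sum of the chains `τ₀ < ⋯ < τ_d` in `P(≤ σ)` with `d + 1` members.
As dimensions increase strictly along a chain, these are the flags `τ₀ ◁ ⋯ ◁ τ_d = σ` with
`dim τ_j = j`. -/
noncomputable def subdivision (X : Type*) [TopologicalSpace X]
    [Topology.CWComplex (Set.univ : Set X)] :
    (Face X →₀ ZMod 2) →ₗ[ZMod 2] (NerveSimplex (Face X) →₀ ZMod 2) :=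
  Finsupp.linearCombination (ZMod 2) fun σ =>
    ∑ s ∈ σ.below.powerset,
      if h : s.card = σ.dim + 1 ∧ IsChain (· ≤ ·) (s : Set (Face X)) then
        Finsupp.single
          (⟨s, Finset.card_pos.mp (by rw [h.1]; exact Nat.succ_pos _), h.2⟩ :
            NerveSimplex (Face X)) 1
        else 0

end Nerve

/-! ## Multisets of cofaces -/

section Cofaces

/-- The coface `d_i`: the increasing map that skips the value `i`. -/
def delta (i x : ℕ) : ℕ := if x < i then x else x + 1

theorem delta_strictMono (i : ℕ) : StrictMono (delta i) := by
  intro a b h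
  unfold delta
  split_ifs <;> omega

theorem delta_le (i x : ℕ) : delta i x ≤ x + 1 := by
  unfold delta
  split_ifs <;> omega

/-- The composite `d_{i₁} ∘ ⋯ ∘ d_{i_p}` for a list `i₁, …, i_p`. -/
def deltaList (l : List ℕ) (x : ℕ) : ℕ := l.foldr delta x

theorem deltaList_strictMono (l : List ℕ) : StrictMono (deltaList l) := by
  induction l with
  | nil => exact strictMono_id
  | cons a l ih => exact (delta_strictMono a).comp ih

theorem deltaList_le (l : List ℕ) (x : ℕ) : deltaList l x ≤ x + l.length := by
  induction l with
  | nil => exact le_rfl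
  | cons a l ih =>
    refine (delta_le a (deltaList l x)).trans ?_
    simp only [List.length_cons]
    omega

/-- The map `d_I = d_{i₁} ∘ ⋯ ∘ d_{i_p} : [n] → [n + p]` for a multiset `I = {i₁ ≤ ⋯ ≤ i_p}`
of size `p` with elements in `[n + 1] = {0, …, n + 1}`. -/
def dMulti {n p : ℕ} (I : Sym (Fin (n + 2)) p) : Fin (n + 1) ↪o Fin (n + p + 1) :=
  OrderEmbedding.ofStrictMono
    (fun x => ⟨deltaList (((I : Multiset (Fin (n + 2))).sort).map Fin.val) x, by
      have h := deltaList_le (((I : Multiset (Fin (n + 2))).sort).map Fin.val) x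
      have h2 : (((I : Multiset (Fin (n + 2))).sort).map Fin.val).length = p := by simp
      omega⟩)
    (fun _ _ h => deltaList_strictMono _ h)

/-- `I ∨ J = K` (union with shift), i.e. `d_I ∘ d_J = d_K` as maps `[n] → [n + i + j]`. -/
def IsShiftUnion {n i j l : ℕ} (I : Sym (Fin (n + j + 2)) i) (J : Sym (Fin (n + 2)) j)
    (K : Sym (Fin (n + 2)) l) : Prop :=
  i + j = l ∧ ∀ x : Fin (n + 1), (dMulti I (dMulti J x) : ℕ) = (dMulti K x : ℕ)

end Cofaces

/-! ## The setting -/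

section Setting

variable {X : ℕ → Type*} [∀ n, TopologicalSpace (X n)]
  [∀ n, Topology.CWComplex (Set.univ : Set (X n))]

variable (X) in
/-- A semicosimplicial structure on the face posets of the `X n`: a functor to posets from the
category with objects `[n]` and with the injective monotone maps `[n] → [m]` as morphisms. -/
structure SemicosimplicialFaces where
  map : ∀ {n m : ℕ}, (Fin (n + 1) ↪o Fin (m + 1)) → (Face (X n) →o Face (X m))
  map_id : ∀ n : ℕ, map (RelEmbedding.refl (· ≤ · : Fin (n + 1) → Fin (n + 1) → Prop)) =
    OrderHom.id
  map_comp : ∀ {n m l : ℕ} (φ : Fin (n + 1) ↪o Fin (m + 1)) (ψ : Fin (m + 1) ↪o Fin (l + 1)),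
    map (φ.trans ψ) = (map ψ).comp (map φ)

/-- Maps `D_I : C_n → C_{n+i}` on cellular chains, for all `n` and all multisets `I ⊂ [n + 1]`
of size `i`. Only those with `i ≤ r` will matter. -/
abbrev MultisetMaps (X : ℕ → Type*) [∀ n, TopologicalSpace (X n)]
    [∀ n, Topology.CWComplex (Set.univ : Set (X n))] :=
  ∀ n i : ℕ, Sym (Fin (n + 2)) i → (Face (X n) →₀ ZMod 2) →ₗ[ZMod 2] (Face (X (n + i)) →₀ ZMod 2)

open Classical in
/-- `∑_{I ∨ J = K} D_I (D_J x)`, for `x ∈ C_n` and `K ⊂ [n + 1]` of size `l`. -/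
noncomputable def slicedSum (D : MultisetMaps X) {n l : ℕ} (K : Sym (Fin (n + 2)) l)
    (x : Face (X n) →₀ ZMod 2) : (Σ m, Face (X m)) →₀ ZMod 2 :=
  ∑ ij ∈ Finset.HasAntidiagonal.antidiagonal l, ∑ J : Sym (Fin (n + 2)) ij.2,
    ∑ I : Sym (Fin (n + ij.2 + 2)) ij.1,
      if IsShiftUnion I J K then incl (n + ij.2 + ij.1) (D (n + ij.2) ij.1 I (D n ij.2 J x)) else 0

/-- `D_i = ∑_{|I| = i} D_I` on the sum of all the `C_n`. -/
noncomputable def sumDiff (D : MultisetMaps X) (i : ℕ) :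
    ((Σ n, Face (X n)) →₀ ZMod 2) →ₗ[ZMod 2] ((Σ n, Face (X n)) →₀ ZMod 2) :=
  total i fun n => ∑ I : Sym (Fin (n + 2)) i, D n i I

variable (X) in
/-- The bigrading of the cellular chains: `C_n(d)` sits in bidegree `(-n, d)`. -/
noncomputable def cellGrading (p q : ℤ) : Submodule (ZMod 2) ((Σ n, Face (X n)) →₀ ZMod 2) :=
  bigrading (fun _ σ => σ.dim) p q

variable (X) in
/-- The bigrading of the normalized chains of the nerves: `K_n(d)` sits in bidegree `(-n, d)`. -/
noncomputable def nerveGrading (p q : ℤ) :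
    Submodule (ZMod 2) ((Σ n, NerveSimplex (Face (X n))) →₀ ZMod 2) :=
  bigrading (fun _ s => s.dim) p q

/-- The bicomplex `K`, as a multicomplex: vertical differential `∂`, horizontal differential
`∑ (-1)^a d_a = ∑ d_a` over `a = 0, …, n + 1` (signs are irrelevant over `𝔽₂`), no higher ones. -/
noncomputable def nerveDiff (P : SemicosimplicialFaces X) : ℕ →
    (((Σ n, NerveSimplex (Face (X n))) →₀ ZMod 2) →ₗ[ZMod 2]
      ((Σ n, NerveSimplex (Face (X n))) →₀ ZMod 2))
  | 0 => total 0 fun n => nerveBoundary (Face (X n))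
  | 1 => total 1 fun n => ∑ a : Fin (n + 2), nerveMap (P.map (Fin.succAboveOrderEmb a))
  | _ + 2 => 0

end Setting

end BarycentricDeformation

open BarycentricDeformation

/-! Keep the injection `d_I` as a formal label on every term of `D_I σ`. The sliced equations then
say that the labelled operators form a multicomplex (`conv_labDiff_eq_zero`), the bicomplex `K`
lifts in the same way, and a labelled morphism can be built by acyclic carriers. The part of the
value on `σ` with label `e` has to lie in the nerve of the cells below the image of `σ` under `e`,
which is a cone with that image as apex. By induction on the order, and then on the dimension of
`σ`, the obstruction to the next component is a cycle in these cones (`exists_sliced_step`,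
`obstruction_mem`), so it can be filled as soon as its augmentation vanishes (`exists_fill`).
Augmentations matter only for the component of order one on a vertex, and there they cancel label by
label because every `D_{a}` preserves them. Forgetting the labels gives the morphism.

The statement about pages is formal. Elements of `Z^s` and `B^s` are described by windows of `s`
entries on which `D` acts by convolution. If `f 0` is a quasi-isomorphism for the leading
differentials, the mapping cone has an exact leading term, and exactness of the leading term
propagates to the whole truncated sequence (`exists_conv_eq`). Hence `f 0` reflects cycles and
boundaries and induces isomorphisms of pages (`IsLeadingQuasiIso.page_equiv`). The inclusion of
boundaries in cycles is checked by hand in the bicomplex and reflected back to `C`.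

It remains to see that subdivision is a vertical quasi-isomorphism. An inverse and the two
homotopies come from acyclic carriers again: on the side of the nerve the carriers are cones, on the
side of the cells they are the augmented cellular complexes of closed cells. Their acyclicity
(`isAcyclicFace`) is where topology enters, since the cellular differential is defined
combinatorially. The tool is the complex of ordered simplices of small diameter. If a compact space
carries two finite closed covers modelled on cell complexes with acyclic cells, comparison through
small simplices yields a chain map that is injective on homology
(`CellStructure.IsCover.exists_map`). The boundary sphere of a cell `σ` has two such covers, by the
preimages of the proper faces and by hemispheres; the cycles of the second are explicit. By
induction on dimension, the complex of proper faces has no homology below the top and at most one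
nonzero top cycle, which must be the boundary of `σ`.

For this the proper faces have to cover the sphere and meet in unions of faces. Both facts
(`Face.exists_codim_one`, `Face.le_of_mem_opn`) follow from invariance of domain, which is deduced
from the no-retraction theorem, and that in turn comes from small simplices and the hemispheres. -/

namespace BarycentricDeformation

/-! ### Convolution of sequences of maps, and exactness from the leading term. -/

section Pages

variable {k M M' M'' : Type*} [CommRing k] [AddCommGroup M] [Module k M] [AddCommGroup M']
  [Module k M'] [AddCommGroup M''] [Module k M'']

/-- The action of a sequence of maps on a sequence of elements, as for power series. -/
def conv (D : ℕ → M →ₗ[k] M') (x : ℕ → M) (m : ℕ) : M' :=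
  ∑ ij ∈ Finset.HasAntidiagonal.antidiagonal m, D ij.1 (x ij.2)

theorem sum_antidiagonal_assoc {N : Type*} [AddCommMonoid N] (f : ℕ → ℕ → ℕ → N) (m : ℕ) :
    ∑ ij ∈ Finset.HasAntidiagonal.antidiagonal m,
      ∑ ab ∈ Finset.HasAntidiagonal.antidiagonal ij.2, f ij.1 ab.1 ab.2 =
    ∑ ij ∈ Finset.HasAntidiagonal.antidiagonal m,
      ∑ ab ∈ Finset.HasAntidiagonal.antidiagonal ij.1, f ab.1 ab.2 ij.2 := by
  rw [Finset.sum_sigma', Finset.sum_sigma']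
  refine Finset.sum_nbij' (fun x => ⟨(x.1.1 + x.2.1, x.2.2), (x.1.1, x.2.1)⟩)
    (fun x => ⟨(x.2.1, x.2.2 + x.1.2), (x.2.2, x.1.2)⟩) ?_ ?_ ?_ ?_ ?_
  · rintro ⟨⟨a, b⟩, c, d⟩ h
    simp only [Finset.mem_sigma, Finset.HasAntidiagonal.mem_antidiagonal, and_true] at h ⊢
    obtain ⟨h1, h2⟩ := h
    omega
  · rintro ⟨⟨a, b⟩, c, d⟩ h
    simp only [Finset.mem_sigma, Finset.HasAntidiagonal.mem_antidiagonal, and_true] at h ⊢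
    obtain ⟨h1, h2⟩ := h
    omega
  · rintro ⟨⟨a, b⟩, c, d⟩ h
    simp only [Finset.mem_sigma, Finset.HasAntidiagonal.mem_antidiagonal] at h
    obtain ⟨h1, h2⟩ := h
    subst h2
    rfl
  · rintro ⟨⟨a, b⟩, c, d⟩ h
    simp only [Finset.mem_sigma, Finset.HasAntidiagonal.mem_antidiagonal] at h
    obtain ⟨h1, h2⟩ := h
    subst h2
    rfl
  · rintro ⟨⟨a, b⟩, c, d⟩ h
    rfl

/-- Associativity of convolution: quadratic relations between operators become statements about
iterated convolution. -/
theorem conv_conv (D : ℕ → M' →ₗ[k] M'') (E : ℕ → M →ₗ[k] M') (x : ℕ → M) (m : ℕ) :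
    conv D (conv E x) m = ∑ ij ∈ Finset.HasAntidiagonal.antidiagonal m,
      (∑ ab ∈ Finset.HasAntidiagonal.antidiagonal ij.1, D ab.1 ∘ₗ E ab.2) (x ij.2) := by
  simp only [conv, map_sum, LinearMap.sum_apply, LinearMap.comp_apply]
  exact sum_antidiagonal_assoc (fun a b c => D a (E b (x c))) m

theorem conv_congr (D : ℕ → M →ₗ[k] M') {x y : ℕ → M} {m : ℕ} (h : ∀ j ≤ m, x j = y j) :
    conv D x m = conv D y m :=
  Finset.sum_congr rfl fun ij hij => by
    rw [h _ (by rw [Finset.HasAntidiagonal.mem_antidiagonal] at hij; omega)]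

theorem conv_eq_add_range (D : ℕ → M →ₗ[k] M') (x : ℕ → M) (m : ℕ) :
    conv D x m = D m (x 0) + ∑ i ∈ Finset.range m, D i (x (m - i)) := by
  rw [conv, Finset.Nat.sum_antidiagonal_eq_sum_range_succ (fun i j => D i (x j)),
    Finset.sum_range_succ, Nat.sub_self, add_comm]

/-- Isolates the term with `D 0`, the only one in which the last entry `x m` occurs; recursive
solutions adjust this entry. -/
theorem conv_eq_head_add (D : ℕ → M →ₗ[k] M') (x : ℕ → M) (m : ℕ) :
    conv D x m = D 0 (x m) + ∑ i ∈ Finset.range m, D (i + 1) (x (m - (i + 1))) := by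
  rw [conv, Finset.Nat.sum_antidiagonal_eq_sum_range_succ (fun i j => D i (x j)),
    Finset.sum_range_succ', Nat.sub_zero, add_comm]

/-- If the leading coefficient `D 0` of a square-zero sequence is exact, so is the whole sequence,
up to any order. -/
theorem exists_conv_eq {gr : ℤ → ℤ → Submodule k M} {D : ℕ → M →ₗ[k] M} {s : ℕ}
    (bideg : ∀ i < s, ∀ p q : ℤ, ∀ x ∈ gr p q, D i x ∈ gr (p - i) (q + i - 1))
    (sq : ∀ l < s, ∑ ij ∈ Finset.HasAntidiagonal.antidiagonal l, D ij.1 ∘ₗ D ij.2 = 0)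
    (exact0 : ∀ p q : ℤ, ∀ x ∈ gr p q, D 0 x = 0 → ∃ y ∈ gr p (q + 1), D 0 y = x)
    (p q : ℤ) (x : ℕ → M) (hx : ∀ j < s, x j ∈ gr (p - j) (q + j))
    (hx0 : ∀ m < s, conv D x m = 0) :
    ∃ w : ℕ → M, (∀ j < s, w j ∈ gr (p - j) (q + j + 1)) ∧ ∀ m < s, conv D w m = x m := by
  suffices H : ∀ t ≤ s, ∃ w : ℕ → M, (∀ j < t, w j ∈ gr (p - j) (q + j + 1)) ∧
      ∀ m < t, conv D w m = x m from H s le_rfl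
  intro t
  induction t with
  | zero => exact fun _ => ⟨0, by simp, by simp⟩
  | succ t ih =>
    intro ht
    obtain ⟨w, hw, hwx⟩ := ih (by omega)
    -- A provisional zero as the next entry; the error at order `t` is then corrected through `D 0`
    -- alone.
    set w0 : ℕ → M := Function.update w t 0 with hw0
    have hw0' : ∀ j < t, w0 j = w j := fun j hj => by
      rw [hw0, Function.update_of_ne (by omega)]
    have hlow : ∀ m < t, conv D w0 m = x m := fun m hm => by
      rw [conv_congr D (fun j hj => hw0' j (by omega)), hwx m hm]
    have hgr : conv D w0 t ∈ gr (p - t) (q + t) := by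
      refine Submodule.sum_mem _ fun ij hij => ?_
      rw [Finset.HasAntidiagonal.mem_antidiagonal] at hij
      rcases eq_or_ne ij.2 t with h | h
      · rw [h, hw0, Function.update_self, map_zero]
        exact Submodule.zero_mem _
      · rw [hw0' _ (by omega)]
        have := bideg ij.1 (by omega) _ _ _ (hw ij.2 (by omega))
        convert this using 1
        · have : (t : ℤ) = ij.1 + ij.2 := by exact_mod_cast hij.symm
          congr 1 <;> omega
    -- `conv D (conv D w0)` and `conv D x` both vanish at order `t`, and the inner sequences agree
    -- below `t`, so the two leading terms agree.
    have hcyc : D 0 (x t - conv D w0 t) = 0 := by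
      have h1 := conv_conv D D w0 t
      rw [Finset.sum_eq_zero] at h1
      · have h2 := hx0 t (by omega)
        rw [conv_eq_head_add] at h1 h2
        rw [Finset.sum_congr rfl (g := fun i => D (i + 1) (x (t - (i + 1))))
          (fun i hi => by rw [hlow _ (by rw [Finset.mem_range] at hi; omega)]), ← h2] at h1
        rw [map_sub, sub_eq_zero]
        exact (add_right_cancel h1).symm
      · intro ij hij
        rw [Finset.HasAntidiagonal.mem_antidiagonal] at hij
        rw [sq _ (by omega), LinearMap.zero_apply]
    obtain ⟨y, hy, hyx⟩ := exact0 _ _ _ (Submodule.sub_mem _ (hx t (by omega)) hgr) hcyc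
    refine ⟨Function.update w t y, fun j hj => ?_, fun m hm => ?_⟩
    · rcases eq_or_ne j t with rfl | h
      · rwa [Function.update_self]
      · rw [Function.update_of_ne h]
        exact hw j (by omega)
    · rcases eq_or_ne m t with rfl | h
      · rw [conv_eq_head_add, Function.update_self, hyx, conv_eq_head_add, hw0, Function.update_self,
          map_zero, zero_add]
        rw [Finset.sum_congr rfl fun i hi => show D (i + 1) (Function.update w m y (m - (i + 1))) =
            D (i + 1) (Function.update w m 0 (m - (i + 1))) by
          rw [Finset.mem_range] at hi
          rw [Function.update_of_ne (by omega), Function.update_of_ne (by omega)]]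
        exact sub_add_cancel _ _
      · rw [← hwx m (by omega)]
        exact conv_congr D fun j hj => by rw [Function.update_of_ne (by omega)]

end Pages

/-! ### Pages as windows, and their invariance under leading quasi-isomorphisms. -/

section PageIso

variable {k M M' M'' : Type*} [CommRing k] [AddCommGroup M] [Module k M] [AddCommGroup M']
  [Module k M'] [AddCommGroup M''] [Module k M'']

theorem conv_succ (D : ℕ → M →ₗ[k] M') (z : ℕ → M) (m : ℕ) :
    conv D z (m + 1) = D (m + 1) (z 0) + conv D (fun j => z (j + 1)) m := by
  rw [conv, Finset.Nat.sum_antidiagonal_succ' (f := fun ij : ℕ × ℕ => D ij.1 (z ij.2))]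
  rfl

theorem conv_zero (D : ℕ → M →ₗ[k] M') (z : ℕ → M) : conv D z 0 = D 0 (z 0) := by
  simp [conv]

theorem conv_eq_zero (D : ℕ → M →ₗ[k] M') {z : ℕ → M} {m : ℕ} (h : ∀ j ≤ m, z j = 0) :
    conv D z m = 0 := by
  rw [conv_congr D (y := 0) h]
  simp [conv]

theorem conv_last (D : ℕ → M →ₗ[k] M') {z : ℕ → M} {m : ℕ} (h : ∀ j < m, z j = 0) :
    conv D z m = D 0 (z m) := by
  rw [conv_eq_head_add, Finset.sum_eq_zero, add_zero]
  intro i hi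
  rw [Finset.mem_range] at hi
  rw [h _ (by omega), map_zero]

theorem conv_mem {gr : ℤ → ℤ → Submodule k M} {gr' : ℤ → ℤ → Submodule k M'}
    {D : ℕ → M →ₗ[k] M'} {s : ℕ} {a : ℤ}
    (bideg : ∀ i < s, ∀ p q : ℤ, ∀ x ∈ gr p q, D i x ∈ gr' (p - i) (q + i + a)) {p q : ℤ}
    {z : ℕ → M} (hz : ∀ j < s, z j ∈ gr (p - j) (q + j)) {m : ℕ} (hm : m < s) :
    conv D z m ∈ gr' (p - m) (q + m + a) := by
  refine Submodule.sum_mem _ fun ij hij => ?_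
  rw [Finset.HasAntidiagonal.mem_antidiagonal] at hij
  have := bideg ij.1 (by omega) _ _ _ (hz ij.2 (by omega))
  have h : (m : ℤ) = ij.1 + ij.2 := by exact_mod_cast hij.symm
  rwa [show p - (ij.2 : ℤ) - ij.1 = p - m by omega,
    show q + (ij.2 : ℤ) + ij.1 + a = q + m + a by omega] at this

/-- With `x` itself at index 0 and the other witnesses negated, the cycle conditions become the
vanishing of the first `s` convolution terms. -/
theorem mem_cycles_iff {gr : ℤ → ℤ → Submodule k M} {D : ℕ → M →ₗ[k] M} {s : ℕ} (hs : 1 ≤ s)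
    {p q : ℤ} {x : M} : x ∈ cycles gr D s p q ↔ ∃ z : ℕ → M, z 0 = x ∧
      (∀ j < s, z j ∈ gr (p - j) (q + j)) ∧ ∀ m < s, conv D z m = 0 := by
  constructor
  · rintro ⟨hx, hx0, z, hz, hz'⟩
    refine ⟨fun j => if j = 0 then x else -z j, if_pos rfl, fun j hj => ?_, fun m hm => ?_⟩
    · rcases Nat.eq_zero_or_pos j with rfl | h
      · simpa using hx
      · dsimp only
        rw [if_neg (by omega)]
        exact Submodule.neg_mem _ (hz j h hj)
    · rcases Nat.eq_zero_or_pos m with rfl | h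
      · simpa [conv_zero] using hx0
      · rw [conv_eq_add_range, if_pos rfl, hz' m h hm, ← Finset.sum_add_distrib]
        refine Finset.sum_eq_zero fun i hi => ?_
        rw [Finset.mem_range] at hi
        rw [if_neg (by omega), map_neg, add_neg_cancel]
  · rintro ⟨z, rfl, hz, hz'⟩
    refine ⟨by simpa using hz 0 hs, by simpa [conv_zero] using hz' 0 hs, fun j => -z j,
      fun j _ hj => Submodule.neg_mem _ (hz j hj), fun m h1 h2 => ?_⟩
    have := hz' m h2
    rw [conv_eq_add_range] at this
    simp only [map_neg, Finset.sum_neg_distrib]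
    exact eq_neg_of_add_eq_zero_left this

/-- Reversing the order of the witnesses, `l ↦ s - 1 - l`, turns the sums defining `B^s` into
convolutions. The window then starts in column `p + s - 1`, and its convolution is concentrated in
the last place. -/
theorem mem_boundaries_iff {gr : ℤ → ℤ → Submodule k M} {D : ℕ → M →ₗ[k] M} {s : ℕ} (hs : 1 ≤ s)
    {p q : ℤ} {x : M} : x ∈ boundaries gr D s p q ↔ ∃ c : ℕ → M,
      (∀ j < s, c j ∈ gr (p + s - 1 - j) (q - s + 1 + j + 1)) ∧
      ∀ m < s, conv D c m = if m = s - 1 then x else 0 := by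
  have key : ∀ (c : ℕ → M) (m : ℕ), m < s → conv D (fun j => c (s - 1 - j)) m =
      ∑ l ∈ Finset.Ico (s - 1 - m) s, D (l - (s - 1 - m)) (c l) := by
    intro c m hm
    rw [conv, Finset.Nat.sum_antidiagonal_eq_sum_range_succ (fun i j => D i (c (s - 1 - j))),
      Finset.sum_Ico_eq_sum_range]
    refine Finset.sum_congr (by congr 1; omega) fun i hi => ?_
    rw [Finset.mem_range] at hi
    congr 2 <;> omega
  constructor
  · rintro ⟨c, hc, hx, hc'⟩
    refine ⟨fun j => c (s - 1 - j), fun j hj => ?_, fun m hm => ?_⟩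
    · have := hc (s - 1 - j) (by omega)
      rwa [show p + ((s - 1 - j : ℕ) : ℤ) = p + s - 1 - j by omega,
        show q - ((s - 1 - j : ℕ) : ℤ) + 1 = q - s + 1 + j + 1 by omega] at this
    · rw [key c m hm]
      split_ifs with h
      · rw [h, Nat.sub_self, ← Finset.range_eq_Ico, hx]
        rfl
      · exact hc' _ (by omega) (by omega)
  · rintro ⟨c, hc, hc'⟩
    have h2 : ∀ m < s, conv D c m = ∑ l ∈ Finset.Ico (s - 1 - m) s,
        D (l - (s - 1 - m)) (c (s - 1 - l)) := fun m hm => by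
      rw [← key (fun l => c (s - 1 - l)) m hm]
      exact conv_congr D fun j hj => by congr 1; omega
    refine ⟨fun l => c (s - 1 - l), fun l hl => ?_, ?_, fun m h1 hm => ?_⟩
    · have := hc (s - 1 - l) (by omega)
      rwa [show p + s - 1 - ((s - 1 - l : ℕ) : ℤ) = p + l by omega,
        show q - s + 1 + ((s - 1 - l : ℕ) : ℤ) + 1 = q - l + 1 by omega] at this
    · have := h2 (s - 1) (by omega)
      rw [hc' _ (by omega), if_pos rfl, Nat.sub_self, ← Finset.range_eq_Ico] at this
      exact this
    · have := h2 (s - 1 - m) (by omega)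
      rw [hc' _ (by omega), if_neg (by omega), show s - 1 - (s - 1 - m) = m by omega] at this
      exact this.symm

/-- A morphism that is a quasi-isomorphism with respect to the leading differentials reflects
boundaries of windows of any length. -/
theorem exists_conv_eq_of_map {gr : ℤ → ℤ → Submodule k M} {D : ℕ → M →ₗ[k] M}
    {gr' : ℤ → ℤ → Submodule k M'} {D' : ℕ → M' →ₗ[k] M'} {f : ℕ → M →ₗ[k] M'} {r : ℕ}
    (hM : IsTruncatedMulticomplex r gr D) (hM' : IsTruncatedMulticomplex r gr' D')
    (hf : IsTruncatedMorphism r gr D gr' D' f)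
    (inj0 : ∀ p q : ℤ, ∀ x ∈ gr p q, D 0 x = 0 → ∀ w' ∈ gr' p (q + 1), f 0 x = D' 0 w' →
      ∃ w ∈ gr p (q + 1), D 0 w = x)
    (surj0 : ∀ p q : ℤ, ∀ x' ∈ gr' p q, D' 0 x' = 0 → ∃ x ∈ gr p q, D 0 x = 0 ∧
      ∃ w' ∈ gr' p (q + 1), x' = f 0 x + D' 0 w')
    {s : ℕ} (hs : s ≤ r + 1) {p q : ℤ} {x : ℕ → M} {x' : ℕ → M'}
    (hx : ∀ j < s, x j ∈ gr (p - j) (q + j)) (hx0 : ∀ m < s, conv D x m = 0)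
    (hx' : ∀ j < s, x' j ∈ gr' (p - j) (q + j + 1)) (hxx' : ∀ m < s, conv f x m = conv D' x' m) :
    ∃ w : ℕ → M, (∀ j < s, w j ∈ gr (p - j) (q + j + 1)) ∧ ∀ m < s, conv D w m = x m := by
  -- The mapping cone, with the first summand shifted by one in `q`. Its quadratic relations combine
  -- those of both multicomplexes with the morphism equations.
  let Dc : ℕ → (M × M') →ₗ[k] (M × M') := fun i =>
    LinearMap.prod (D i ∘ₗ LinearMap.fst k M M')
      (f i ∘ₗ LinearMap.fst k M M' - D' i ∘ₗ LinearMap.snd k M M')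
  let grc : ℤ → ℤ → Submodule k (M × M') := fun p q => (gr p (q - 1)).prod (gr' p q)
  have hDc : ∀ i y, Dc i y = (D i y.1, f i y.1 - D' i y.2) := fun i y => rfl
  have hconv : ∀ (y : ℕ → M × M') m, conv Dc y m =
      (conv D (fun j => (y j).1) m,
        conv f (fun j => (y j).1) m - conv D' (fun j => (y j).2) m) := by
    intro y m
    simp only [conv, hDc, ← Finset.sum_sub_distrib]
    exact Prod.ext Prod.fst_sum Prod.snd_sum
  have hzero0 := hM.equation 0 (Nat.zero_le _)
  have hmor0 := hf.equation 0 (Nat.zero_le _)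
  simp only [Finset.Nat.antidiagonal_zero, Finset.sum_singleton] at hzero0 hmor0
  obtain ⟨w, hw, hw'⟩ : ∃ w : ℕ → M × M', (∀ j < s, w j ∈ grc (p - j) (q + 1 + j + 1)) ∧
      ∀ m < s, conv Dc w m = (x m, x' m) := by
    refine exists_conv_eq (gr := grc) (D := Dc) (s := s) ?_ ?_ ?_ p (q + 1)
      (fun j => (x j, x' j)) ?_ ?_
    · rintro i hi p q ⟨y, y'⟩ ⟨hy, hy'⟩
      refine ⟨?_, Submodule.sub_mem _ ?_ (hM'.bidegree i (by omega) _ _ _ hy')⟩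
      · have := hM.bidegree i (by omega) _ _ _ hy
        rwa [show q - 1 + (i : ℤ) - 1 = q + i - 1 - 1 by ring] at this
      · have := hf.bidegree i (by omega) _ _ _ hy
        rwa [show q - 1 + (i : ℤ) = q + i - 1 by ring] at this
    · intro l hl
      have h1 := hM.equation l (by omega)
      have h2 := hM'.equation l (by omega)
      have h3 := hf.equation l (by omega)
      refine LinearMap.ext fun y => ?_
      have h1' := LinearMap.congr_fun h1 y.1
      have h2' := LinearMap.congr_fun h2 y.2
      have h3' := LinearMap.congr_fun h3 y.1
      simp only [LinearMap.sum_apply, LinearMap.comp_apply, LinearMap.zero_apply] at h1' h2' h3' ⊢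
      simp only [hDc, map_sub]
      refine Prod.ext ?_ ?_
      · rw [Prod.fst_sum]
        exact h1'
      · rw [Prod.snd_sum]
        simp only [Finset.sum_sub_distrib, h2', h3', sub_self, Prod.snd_zero, sub_zero]
    -- Leading exactness of the cone uses both halves of the quasi-isomorphism: `inj0` gives `u`
    -- with `D 0 u = y`, and `surj0` absorbs the cycle `f 0 u - y'`.
    · rintro p q ⟨y, y'⟩ ⟨hy, hy'⟩ h0
      rw [hDc] at h0
      have h1 : D 0 y = 0 := congrArg Prod.fst h0
      have h2 : f 0 y = D' 0 y' := sub_eq_zero.mp (congrArg Prod.snd h0)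
      obtain ⟨u, hu, hu'⟩ := inj0 p (q - 1) y hy h1 y' (by rwa [sub_add_cancel]) h2
      rw [sub_add_cancel] at hu
      have hfu : f 0 u ∈ gr' p q := by simpa using hf.bidegree 0 (Nat.zero_le _) _ _ _ hu
      obtain ⟨v, hv, hv0, v', hv', hvv'⟩ := surj0 p q (f 0 u - y') (Submodule.sub_mem _ hfu hy') (by
        rw [map_sub, ← h2, ← hu', sub_eq_zero]
        exact (LinearMap.congr_fun hmor0 u).symm)
      refine ⟨(u - v, v'), ⟨?_, hv'⟩, ?_⟩
      · simpa using Submodule.sub_mem _ hu hv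
      · rw [hDc]
        refine Prod.ext ?_ ?_
        · simp [hu', hv0]
        · rw [← sub_sub_self (f 0 u) y', hvv']
          simp only [map_sub]
          abel
    · intro j hj
      refine ⟨?_, ?_⟩
      · have := hx j hj
        simpa [add_sub_right_comm] using this
      · have := hx' j hj
        simpa [add_right_comm] using this
    · intro m hm
      rw [hconv]
      exact Prod.ext (hx0 m hm) (sub_eq_zero.mpr (hxx' m hm))
  refine ⟨fun j => (w j).1, fun j hj => ?_, fun m hm => ?_⟩
  · have := (hw j hj).1
    rwa [show q + 1 + (j : ℤ) + 1 - 1 = q + j + 1 by ring] at this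
  · have := hw' m hm
    rw [hconv] at this
    exact congrArg Prod.fst this

variable {gr : ℤ → ℤ → Submodule k M} {D : ℕ → M →ₗ[k] M} {gr' : ℤ → ℤ → Submodule k M'}
  {D' : ℕ → M' →ₗ[k] M'} {f : ℕ → M →ₗ[k] M'} {r : ℕ}

theorem IsTruncatedMulticomplex.conv_conv_eq_zero (hM : IsTruncatedMulticomplex r gr D)
    (z : ℕ → M) {m : ℕ} (hm : m ≤ r) : conv D (conv D z) m = 0 := by
  rw [conv_conv]
  refine Finset.sum_eq_zero fun ij hij => ?_
  rw [Finset.HasAntidiagonal.mem_antidiagonal] at hij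
  rw [hM.equation _ (by omega), LinearMap.zero_apply]

theorem IsTruncatedMorphism.conv_comm (hf : IsTruncatedMorphism r gr D gr' D' f)
    (z : ℕ → M) {m : ℕ} (hm : m ≤ r) : conv D' (conv f z) m = conv f (conv D z) m := by
  rw [conv_conv, conv_conv]
  refine Finset.sum_congr rfl fun ij hij => ?_
  rw [Finset.HasAntidiagonal.mem_antidiagonal] at hij
  rw [hf.equation _ (by omega)]

/-- A morphism acts on whole windows by `conv f`, which commutes with the differentials; the entry
at index 0 is sent to its image under `f 0`. -/
theorem IsTruncatedMorphism.map_cycles (hf : IsTruncatedMorphism r gr D gr' D' f) {s : ℕ}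
    (hs : 1 ≤ s) (hsr : s ≤ r) {p q : ℤ} {x : M} (hx : x ∈ cycles gr D s p q) :
    f 0 x ∈ cycles gr' D' s p q := by
  rw [mem_cycles_iff hs] at hx ⊢
  obtain ⟨z, rfl, hz, hz'⟩ := hx
  refine ⟨conv f z, conv_zero f z, fun j hj => ?_, fun m hm => ?_⟩
  · simpa using conv_mem (a := 0) (D := f) (gr' := gr') (s := s)
      (fun i hi p q x hx => by simpa using hf.bidegree i (by omega) p q x hx) hz hj
  · rw [hf.conv_comm z (by omega)]
    exact conv_eq_zero f fun j hj => hz' j (by omega)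

theorem IsTruncatedMorphism.map_boundaries (hf : IsTruncatedMorphism r gr D gr' D' f) {s : ℕ}
    (hs : 1 ≤ s) (hsr : s ≤ r) {p q : ℤ} {x : M} (hx : x ∈ boundaries gr D s p q) :
    f 0 x ∈ boundaries gr' D' s p q := by
  rw [mem_boundaries_iff hs] at hx ⊢
  obtain ⟨c, hc, hc'⟩ := hx
  refine ⟨conv f c, fun j hj => ?_, fun m hm => ?_⟩
  · have := conv_mem (a := 0) (D := f) (gr := gr) (gr' := gr') (s := s) (p := p + s - 1)
      (q := q - s + 1 + 1) (z := c)
      (fun i hi p q x hx => by simpa using hf.bidegree i (by omega) p q x hx)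
      (fun i hi => by simpa [add_right_comm] using hc i hi) hj
    simpa [add_right_comm] using this
  · rw [hf.conv_comm c (by omega)]
    split_ifs with h
    · rw [conv_last f fun j hj => by rw [hc' j (by omega), if_neg (by omega)], hc' m hm, if_pos h]
    · exact conv_eq_zero f fun j hj => by rw [hc' j (by omega), if_neg (by omega)]

/-- Convolving the window of a boundary twice with `D` gives zero, and at order `s - 1` only `D 0 x`
is left. The higher cycle conditions are not reached this way: they would involve orders up to `2s -
2`, possibly beyond `r`. -/
theorem IsTruncatedMulticomplex.of_mem_boundaries (hM : IsTruncatedMulticomplex r gr D) {s : ℕ}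
    (hs : 1 ≤ s) (hsr : s ≤ r) {p q : ℤ} {x : M} (hx : x ∈ boundaries gr D s p q) :
    x ∈ gr p q ∧ D 0 x = 0 := by
  rw [mem_boundaries_iff hs] at hx
  obtain ⟨c, hc, hc'⟩ := hx
  have hlast := hc' (s - 1) (by omega)
  rw [if_pos rfl] at hlast
  constructor
  · rw [← hlast]
    have := conv_mem (a := -1) (D := D) (gr := gr) (gr' := gr) (s := s) (p := p + s - 1)
      (q := q - s + 1 + 1) (z := c)
      (fun i hi p q x hx => by simpa [sub_eq_add_neg] using hM.bidegree i (by omega) p q x hx)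
      (fun i hi => by simpa [add_right_comm] using hc i hi) (m := s - 1) (by omega)
    rwa [show p + s - 1 - ((s - 1 : ℕ) : ℤ) = p by omega,
      show q - s + 1 + 1 + ((s - 1 : ℕ) : ℤ) + -1 = q by omega] at this
  · have := hM.conv_conv_eq_zero c (m := s - 1) (by omega)
    rwa [conv_last D fun j hj => by rw [hc' j (by omega), if_neg (by omega)], hlast] at this

/-- The data making the leading component of a morphism a quasi-isomorphism in each bidegree. -/
structure IsLeadingQuasiIso (gr : ℤ → ℤ → Submodule k M) (D : M →ₗ[k] M)
    (gr' : ℤ → ℤ → Submodule k M') (D' : M' →ₗ[k] M') (f : M →ₗ[k] M') : Prop where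
  inj : ∀ p q : ℤ, ∀ x ∈ gr p q, D x = 0 → ∀ w' ∈ gr' p (q + 1), f x = D' w' →
      ∃ w ∈ gr p (q + 1), D w = x
  surj : ∀ p q : ℤ, ∀ x' ∈ gr' p q, D' x' = 0 → ∃ x ∈ gr p q, D x = 0 ∧
      ∃ w' ∈ gr' p (q + 1), x' = f x + D' w'

/-- Being a boundary is solvability of `conv D w = (0, …, 0, x)`, and solvability on windows is
reflected by `exists_conv_eq_of_map`. -/
theorem IsLeadingQuasiIso.mem_boundaries (h0 : IsLeadingQuasiIso gr (D 0) gr' (D' 0) (f 0))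
    (hM : IsTruncatedMulticomplex r gr D) (hM' : IsTruncatedMulticomplex r gr' D')
    (hf : IsTruncatedMorphism r gr D gr' D' f) {s : ℕ} (hs : 1 ≤ s) (hsr : s ≤ r) {p q : ℤ} {x : M}
    (hx : x ∈ gr p q) (hx0 : D 0 x = 0) (hfx : f 0 x ∈ boundaries gr' D' s p q) :
    x ∈ boundaries gr D s p q := by
  rw [mem_boundaries_iff hs] at hfx ⊢
  obtain ⟨c, hc, hc'⟩ := hfx
  let xs : ℕ → M := fun j => if j = s - 1 then x else 0
  have hxs : ∀ j < s - 1, xs j = 0 := fun j hj => if_neg (by omega)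
  have hlast : xs (s - 1) = x := if_pos rfl
  refine exists_conv_eq_of_map hM hM' hf h0.inj h0.surj (by omega) (x := xs) (x' := c) (fun j hj => ?_)
    (fun m hm => ?_) hc (fun m hm => ?_)
  · rcases eq_or_ne j (s - 1) with rfl | h
    · rw [hlast, show p + s - 1 - ((s - 1 : ℕ) : ℤ) = p by omega,
        show q - s + 1 + ((s - 1 : ℕ) : ℤ) = q by omega]
      exact hx
    · rw [hxs _ (by omega)]
      exact Submodule.zero_mem _
  · rw [conv_last D fun j hj => hxs j (by omega)]
    rcases eq_or_ne m (s - 1) with rfl | h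
    · rw [hlast, hx0]
    · rw [hxs _ (by omega), map_zero]
  · rw [conv_last f fun j hj => hxs j (by omega), hc' m hm]
    split_ifs with h
    · rw [h, hlast]
    · rw [hxs _ (by omega), map_zero]

/-- Completing `x` to a window means solving for the sequence `D (m + 1) x`, of length `s - 1`. In
the target a solution is supplied by `f (j + 1) x - z (j + 1)`, where `z` is a window of `f 0 x`;
solvability is then reflected. -/
theorem IsLeadingQuasiIso.mem_cycles (h0 : IsLeadingQuasiIso gr (D 0) gr' (D' 0) (f 0))
    (hM : IsTruncatedMulticomplex r gr D) (hM' : IsTruncatedMulticomplex r gr' D')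
    (hf : IsTruncatedMorphism r gr D gr' D' f) {s : ℕ} (hs : 1 ≤ s) (hsr : s ≤ r) {p q : ℤ} {x : M}
    (hx : x ∈ gr p q) (hx0 : D 0 x = 0) (hfx : f 0 x ∈ cycles gr' D' s p q) :
    x ∈ cycles gr D s p q := by
  rw [mem_cycles_iff hs] at hfx ⊢
  obtain ⟨z, hz0, hz, hz'⟩ := hfx
  let X : ℕ → M := fun j => if j = 0 then x else 0
  have hX0 : X 0 = x := if_pos rfl
  have hXs : ∀ j, X (j + 1) = 0 := fun j => if_neg (by omega)
  have hDX : ∀ m, conv D X m = D m x := fun m => by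
    rw [conv_eq_add_range, hX0, Finset.sum_eq_zero, add_zero]
    intro i hi
    rw [Finset.mem_range] at hi
    rw [show m - i = m - i - 1 + 1 by omega, hXs, map_zero]
  have hfX : ∀ m, conv f X m = f m x := fun m => by
    rw [conv_eq_add_range, hX0, Finset.sum_eq_zero, add_zero]
    intro i hi
    rw [Finset.mem_range] at hi
    rw [show m - i = m - i - 1 + 1 by omega, hXs, map_zero]
  obtain ⟨w, hw, hw'⟩ : ∃ w : ℕ → M, (∀ j < s - 1, w j ∈ gr (p - 1 - j) (q + j + 1)) ∧
      ∀ m < s - 1, conv D w m = D (m + 1) x := by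
    refine exists_conv_eq_of_map hM hM' hf h0.inj h0.surj (s := s - 1) (by omega)
      (x := fun j => D (j + 1) x) (x' := fun j => f (j + 1) x - z (j + 1))
      (fun j hj => ?_) (fun m hm => ?_) (fun j hj => ?_) (fun m hm => ?_)
    · have := hM.bidegree (j + 1) (by omega) _ _ _ hx
      rwa [show p - ((j + 1 : ℕ) : ℤ) = p - 1 - j by push_cast; ring,
        show q + ((j + 1 : ℕ) : ℤ) - 1 = q + j by push_cast; ring] at this
    · have := hM.conv_conv_eq_zero X (m := m + 1) (by omega)
      rw [conv_succ, hDX, hx0, map_zero, zero_add] at this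
      simpa only [hDX] using this
    · have h1 := hf.bidegree (j + 1) (by omega) _ _ _ hx
      have h2 := hz (j + 1) (by omega)
      rw [show p - ((j + 1 : ℕ) : ℤ) = p - 1 - j by push_cast; ring,
        show q + ((j + 1 : ℕ) : ℤ) = q + j + 1 by push_cast; ring] at h1 h2
      exact Submodule.sub_mem _ h1 h2
    · have h1 := hf.conv_comm X (m := m + 1) (by omega)
      have h2 := hz' (m + 1) (by omega)
      rw [conv_succ, hfX, conv_succ, hDX, hx0, map_zero, zero_add] at h1
      rw [conv_succ, hz0] at h2
      simp only [hfX, hDX] at h1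
      rw [← h1, ← sub_zero (_ + _), ← h2]
      simp only [conv, map_sub, Finset.sum_sub_distrib]
      abel
  refine ⟨fun j => if j = 0 then x else -w (j - 1), if_pos rfl, fun j hj => ?_, fun m hm => ?_⟩
  · rcases j with _ | j
    · simpa using hx
    · have := hw j (by omega)
      rw [show p - 1 - (j : ℤ) = p - (j + 1 : ℕ) by push_cast; ring,
        show q + (j : ℤ) + 1 = q + (j + 1 : ℕ) by push_cast; ring] at this
      simpa using this
  · rcases m with _ | m
    · simpa [conv_zero] using hx0
    · rw [conv_succ, if_pos rfl, ← hw' m (by omega)]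
      simp [conv]

/-- A morphism of truncated multicomplexes whose leading component is a quasi-isomorphism induces
isomorphisms on all the terms `E^s`, `1 ≤ s ≤ r`. -/
theorem IsLeadingQuasiIso.page_equiv (h0 : IsLeadingQuasiIso gr (D 0) gr' (D' 0) (f 0))
    (hM : IsTruncatedMulticomplex r gr D) (hM' : IsTruncatedMulticomplex r gr' D')
    (hf : IsTruncatedMorphism r gr D gr' D' f) {s : ℕ} (hs : 1 ≤ s) (hsr : s ≤ r) {p q : ℤ}
    (hBZ : boundaries gr' D' s p q ≤ cycles gr' D' s p q) :
    boundaries gr D s p q ≤ cycles gr D s p q ∧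
    ∃ e : Page gr D s p q ≃ₗ[k] Page gr' D' s p q, ∀ x : cycles gr D s p q,
      ∃ h : f 0 x ∈ cycles gr' D' s p q,
        e (Submodule.Quotient.mk x) = Submodule.Quotient.mk ⟨f 0 x, h⟩ := by
  have hmap : ∀ x ∈ cycles gr D s p q, f 0 x ∈ cycles gr' D' s p q :=
    fun x hx => hf.map_cycles hs hsr hx
  let F : cycles gr D s p q →ₗ[k] cycles gr' D' s p q := (f 0).restrict hmap
  let G : Page gr D s p q →ₗ[k] Page gr' D' s p q := Submodule.mapQ _ _ F (by
    intro x hx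
    exact hf.map_boundaries hs hsr hx)
  have hG : ∀ x, G (Submodule.Quotient.mk x) = Submodule.Quotient.mk (F x) := fun x => rfl
  refine ⟨fun x hx => ?_, LinearEquiv.ofBijective G ⟨?_, ?_⟩, fun x => ⟨hmap x x.2, rfl⟩⟩
  -- A boundary in the source is a leading cycle whose image is a boundary, hence a cycle of the
  -- target; cycles are reflected.
  · obtain ⟨h1, h2⟩ := hM.of_mem_boundaries hs hsr hx
    exact h0.mem_cycles hM hM' hf hs hsr h1 h2 (hBZ (hf.map_boundaries hs hsr hx))
  · rw [injective_iff_map_eq_zero]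
    intro y hy
    obtain ⟨x, rfl⟩ := Submodule.Quotient.mk_surjective _ y
    rw [hG, Submodule.Quotient.mk_eq_zero] at hy
    rw [Submodule.Quotient.mk_eq_zero]
    exact h0.mem_boundaries hM hM' hf hs hsr x.2.1 x.2.2.1 hy
  · intro y
    obtain ⟨⟨x', hx'⟩, rfl⟩ := Submodule.Quotient.mk_surjective _ y
    obtain ⟨x, hx, hx0, w', hw', hxw⟩ := h0.surj p q x' hx'.1 hx'.2.1
    have hw'B : D' 0 w' ∈ boundaries gr' D' s p q := by
      refine ⟨fun l => if l = 0 then w' else 0, fun l _ => ?_, ?_, fun m h1 h2 => ?_⟩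
      · dsimp only
        split_ifs with h
        · subst h
          simpa using hw'
        · exact Submodule.zero_mem _
      · rw [Finset.sum_eq_single_of_mem 0 (Finset.mem_range.mpr hs) (fun l _ hl => by simp [hl])]
        simp
      · refine Finset.sum_eq_zero fun l hl => ?_
        rw [Finset.mem_Ico] at hl
        dsimp only
        rw [if_neg (by omega), map_zero]
    have hfx : f 0 x ∈ cycles gr' D' s p q := by
      rw [eq_sub_of_add_eq hxw.symm]
      exact Submodule.sub_mem _ hx' (hBZ hw'B)
    have hxZ := h0.mem_cycles hM hM' hf hs hsr hx hx0 hfx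
    refine ⟨Submodule.Quotient.mk ⟨x, hxZ⟩, ?_⟩
    rw [hG, Submodule.Quotient.eq]
    have : ((F ⟨x, hxZ⟩ - ⟨x', hx'⟩ : cycles gr' D' s p q) : M') = -D' 0 w' := by
      change f 0 x - x' = _
      rw [hxw]
      abel
    change ((F ⟨x, hxZ⟩ - ⟨x', hx'⟩ : cycles gr' D' s p q) : M') ∈ boundaries gr' D' s p q
    rw [this]
    exact Submodule.neg_mem _ hw'B

/-- In a bicomplex the boundaries are cycles. -/
theorem boundaries_le_cycles_of_bicomplex (hM : IsTruncatedMulticomplex r gr D)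
    (hD : ∀ i, 2 ≤ i → D i = 0) {s : ℕ} (hs : 1 ≤ s) (hsr : s ≤ r) {p q : ℤ} :
    boundaries gr D s p q ≤ cycles gr D s p q := by
  intro x hx
  obtain ⟨h1, h2⟩ := hM.of_mem_boundaries hs hsr hx
  obtain ⟨c, hc, hx', hc'⟩ := hx
  -- As the operators of order at least two vanish, only `c 0` and `c 1` contribute to `x`.
  obtain ⟨c1, hx⟩ : ∃ c1, x = D 0 (c 0) + D 1 c1 ∧ (s = 1 → c1 = 0) := by
    obtain ⟨t, rfl⟩ : ∃ t, s = t + 1 := ⟨s - 1, by omega⟩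
    rw [hx', Finset.sum_range_succ']
    rcases t with _ | t
    · exact ⟨0, by simp, fun _ => rfl⟩
    · refine ⟨c 1, ?_, by omega⟩
      rw [Finset.sum_range_succ', Finset.sum_eq_zero, zero_add, add_comm]
      intro i _
      rw [hD _ (by omega), LinearMap.zero_apply]
  have eq1 : ∀ y, D 1 (D 0 y) = - D 0 (D 1 y) := fun y => by
    have := LinearMap.congr_fun (hM.equation 1 (by omega)) y
    simp only [Finset.Nat.antidiagonal_succ, Finset.Nat.antidiagonal_zero] at this
    simp at this
    exact eq_neg_of_add_eq_zero_right this
  have eq2 : 2 ≤ s → ∀ y, D 1 (D 1 y) = 0 := fun h y => by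
    have := LinearMap.congr_fun (hM.equation 2 (by omega)) y
    simp only [Finset.Nat.antidiagonal_succ, Finset.Nat.antidiagonal_zero] at this
    simpa [hD 2 le_rfl] using this
  -- Since `D 1 x = D 1 (D 0 (c 0)) = -D 0 (D 1 (c 0))`, the single witness `-D 1 (c 0)` suffices;
  -- it is killed by `D 1`.
  refine ⟨h1, h2, fun j => if j = 1 then - D 1 (c 0) else 0, fun j hj hjs => ?_, fun m hm hms => ?_⟩
  · dsimp only
    split_ifs with h
    · subst h
      have := hM.bidegree 1 (by omega) _ _ _ (hc 0 (by omega))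
      exact Submodule.neg_mem _ (by simpa using this)
    · exact Submodule.zero_mem _
  · obtain ⟨t, rfl⟩ : ∃ t, m = t + 1 := ⟨m - 1, by omega⟩
    rcases t with _ | t
    · simp [hx.1, eq1, eq2 (by omega)]
    · rw [hD _ (by omega), LinearMap.zero_apply, Finset.sum_eq_zero]
      intro i hi
      rw [Finset.mem_range] at hi
      rcases Nat.lt_or_ge i 2 with h | h
      · dsimp only
        split_ifs with h3
        · rw [show i = 1 by omega, map_neg, eq2 (by omega), neg_zero]
        · exact map_zero _
      · rw [hD _ h, LinearMap.zero_apply]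

end PageIso

/-! ### Free modules over the field with two elements, and recursive construction of homotopies. -/

section FreeModules

/-- The free `𝔽₂`-module on `B`. -/
abbrev Chain (B : Type*) := B →₀ ZMod 2

/-- The basis element of `b`. -/
noncomputable abbrev gen {B : Type*} (b : B) : Chain B := Finsupp.single b 1

/-- The submodule spanned by the basis elements in `s`. -/
noncomputable abbrev spanOn {B : Type*} (s : Set B) : Submodule (ZMod 2) (Chain B) :=
  Finsupp.supported (ZMod 2) (ZMod 2) s

variable {B M' : Type*} [AddCommGroup M'] [Module (ZMod 2) M']

theorem gen_mem_spanOn {s : Set B} {b : B} (h : b ∈ s) : gen b ∈ spanOn s :=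
  Finsupp.single_mem_supported _ _ h

theorem map_mem_of_mem_spanOn {s : Set B} {x : Chain B} (hx : x ∈ spanOn s)
    (f : Chain B →ₗ[ZMod 2] M') {N : Submodule (ZMod 2) M'} (h : ∀ b ∈ s, f (gen b) ∈ N) :
    f x ∈ N := by
  rw [spanOn, Finsupp.supported_eq_span_single] at hx
  have : Submodule.span (ZMod 2) ((fun i => Finsupp.single i (1 : ZMod 2)) '' s) ≤ N.comap f := by
    rw [Submodule.span_le]
    rintro _ ⟨b, hb, rfl⟩
    exact h b hb
  exact this hx

theorem eqOn_of_mem_spanOn {s : Set B} {x : Chain B} (hx : x ∈ spanOn s)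
    {f g : Chain B →ₗ[ZMod 2] M'} (h : ∀ b ∈ s, f (gen b) = g (gen b)) : f x = g x := by
  have := map_mem_of_mem_spanOn hx (f - g) (N := ⊥) fun b hb => by
    rw [Submodule.mem_bot, LinearMap.sub_apply, h b hb, sub_self]
  rwa [Submodule.mem_bot, LinearMap.sub_apply, sub_eq_zero] at this

theorem chain_hom_ext {f g : Chain B →ₗ[ZMod 2] M'} (h : ∀ b, f (gen b) = g (gen b)) : f = g :=
  LinearMap.ext fun x => eqOn_of_mem_spanOn (s := Set.univ) (x := x) (by simp) fun b _ => h b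

theorem spanOn_mono {s t : Set B} (h : s ⊆ t) {x : Chain B} (hx : x ∈ spanOn s) : x ∈ spanOn t :=
  Finsupp.supported_mono h hx

theorem mem_spanOn_support (x : Chain B) : x ∈ spanOn {b | b ∈ x.support} :=
  (Finsupp.mem_supported _ _).mpr fun _ h => h

theorem add_eq_zero_iff_eq_mod_two {x y : M'} : x + y = 0 ↔ x = y := by
  rw [← ZModModule.sub_eq_add, sub_eq_zero]

theorem eq_add_of_add_eq_mod_two {x y z : M'} (h : x + y = z) : x = z + y := by
  rw [← h, add_assoc, ZModModule.add_self, add_zero]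

/-- Solving `∂' ∘ h + h ∘ ∂ = φ` by recursion over a rank function on the basis, subject to a
condition on the values of `h`. -/
theorem exists_homotopy (rk : B → ℕ) (bd : Chain B →ₗ[ZMod 2] Chain B)
    (bd' : M' →ₗ[ZMod 2] M') (G : Set B) (φ : Chain B →ₗ[ZMod 2] M') (Φ : B → M' → Prop)
    (hrk : ∀ b ∈ G, bd (gen b) ∈ spanOn {b' | b' ∈ G ∧ rk b' < rk b})
    (hbd : ∀ b ∈ G, bd (bd (gen b)) = 0)
    (hφ : ∀ b ∈ G, bd' (φ (gen b)) = φ (bd (gen b)))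
    (step : ∀ b ∈ G, ∀ h : Chain B →ₗ[ZMod 2] M', (∀ b' ∈ G, rk b' < rk b →
      Φ b' (h (gen b')) ∧ bd' (h (gen b')) + h (bd (gen b')) = φ (gen b')) →
      bd' (φ (gen b) + h (bd (gen b))) = 0 → ∃ y, Φ b y ∧ bd' y = φ (gen b) + h (bd (gen b))) :
    ∃ h : Chain B →ₗ[ZMod 2] M', ∀ b ∈ G,
      Φ b (h (gen b)) ∧ bd' (h (gen b)) + h (bd (gen b)) = φ (gen b) := by
  classical
  -- The prospective value of `h` on `bd (gen b)`. Discarding terms of rank not below that of `b`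
  -- makes the recursion well founded; for `b ∈ G` nothing is discarded.
  let lc : ∀ b : B, (∀ b', rk b' < rk b → M') → M' := fun b rec =>
    (bd (gen b)).sum fun b' c => c • (if h : rk b' < rk b then rec b' h else 0)
  -- The default 0 is never taken for `b ∈ G`: the induction below shows that a solution exists
  -- there.
  let F : ∀ b : B, (∀ b', rk b' < rk b → M') → M' := fun b rec =>
    if hb : ∃ y, Φ b y ∧ bd' y = φ (gen b) + lc b rec then hb.choose else 0
  let H : B → M' := (measure rk).wf.fix F
  have hH : ∀ b, H b = F b fun b' _ => H b' := fun b => (measure rk).wf.fix_eq F b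
  let h : Chain B →ₗ[ZMod 2] M' := Finsupp.linearCombination (ZMod 2) H
  have hgen : ∀ b, h (gen b) = H b := fun b => by
    simp [h, gen]
  have hlc : ∀ b ∈ G, lc b (fun b' _ => H b') = h (bd (gen b)) := fun b hb => by
    rw [Finsupp.linearCombination_apply]
    refine Finsupp.sum_congr fun b' hb' => ?_
    rw [dif_pos]
    exact ((Finsupp.mem_supported _ _).mp (hrk b hb) hb').2
  refine ⟨h, ?_⟩
  suffices ∀ n, ∀ b ∈ G, rk b < n →
      Φ b (h (gen b)) ∧ bd' (h (gen b)) + h (bd (gen b)) = φ (gen b) from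
    fun b hb => this _ b hb (Nat.lt_succ_self _)
  intro n
  induction n with
  | zero => exact fun b _ hb => absurd hb (Nat.not_lt_zero _)
  | succ n ih =>
    intro b hb hbn
    have hcyc : bd' (φ (gen b) + h (bd (gen b))) = 0 := by
      have h1 : bd' (h (bd (gen b))) + h (bd (bd (gen b))) = φ (bd (gen b)) :=
        eqOn_of_mem_spanOn (f := bd' ∘ₗ h + h ∘ₗ bd) (hrk b hb) fun b' hb' =>
          (ih b' hb'.1 (by have := hb'.2; omega)).2
      rw [hbd b hb, map_zero, add_zero] at h1
      rw [map_add, hφ b hb, h1, ZModModule.add_self]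
    have hex : ∃ y, Φ b y ∧ bd' y = φ (gen b) + lc b (fun b' _ => H b') := by
      rw [hlc b hb]
      exact step b hb h (fun b' hb' hlt => ih b' hb' (by omega)) hcyc
    have hval : h (gen b) = hex.choose := by
      rw [hgen, hH]
      exact dif_pos hex
    rw [hval]
    refine ⟨hex.choose_spec.1, ?_⟩
    rw [hex.choose_spec.2, hlc b hb, add_assoc, ZModModule.add_self, add_zero]

end FreeModules

/-! ### The augmented complex of ordered simplices, and the prism operator. -/

section ListChains

variable {S T : Type*}

/-- Prepending a point to ordered simplices. -/
noncomputable def consL (v : S) : Chain (List S) →ₗ[ZMod 2] Chain (List S) :=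
  Finsupp.lmapDomain _ _ (List.cons v)

@[simp] theorem consL_gen (v : S) (l : List S) : consL v (gen l) = gen (v :: l) := by
  simp [consL, gen]

/-- The boundary of an ordered simplex, with augmentation in length zero. -/
noncomputable def bdList : List S → Chain (List S)
  | [] => 0
  | v :: l => gen l + consL v (bdList l)

/-- The boundary of the augmented complex of ordered simplices. -/
noncomputable def bdL : Chain (List S) →ₗ[ZMod 2] Chain (List S) :=
  Finsupp.linearCombination (ZMod 2) bdList

theorem bdL_gen (l : List S) : bdL (gen l) = bdList l := by
  simp [bdL, gen]

/-- The cone formula: prepending a fixed vertex is a contracting homotopy. No correction term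
appears, because the empty list is part of the complex. -/
theorem bdL_consL (v : S) (x : Chain (List S)) : bdL (consL v x) = x + consL v (bdL x) := by
  have : bdL ∘ₗ consL v = LinearMap.id + consL v ∘ₗ bdL := by
    refine chain_hom_ext fun l => ?_
    simp only [LinearMap.comp_apply, LinearMap.add_apply, LinearMap.id_apply, consL_gen, bdL_gen]
    rfl
  exact LinearMap.congr_fun this x

theorem bdL_bdList (l : List S) : bdL (bdList l) = 0 := by
  induction l with
  | nil => exact map_zero _
  | cons v l ih =>
    rw [bdList, map_add, bdL_gen, bdL_consL, ih, map_zero, add_zero, ZModModule.add_self]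

theorem bdL_bdL (x : Chain (List S)) : bdL (bdL x) = 0 := by
  have : bdL ∘ₗ bdL = (0 : Chain (List S) →ₗ[ZMod 2] _) :=
    chain_hom_ext fun l => by
      rw [LinearMap.comp_apply, bdL_gen, bdL_bdList, LinearMap.zero_apply]
  exact LinearMap.congr_fun this x

/-- The map of ordered simplices induced by a map of points. -/
noncomputable def mapL (f : S → T) : Chain (List S) →ₗ[ZMod 2] Chain (List T) :=
  Finsupp.lmapDomain _ _ (List.map f)

@[simp] theorem mapL_gen (f : S → T) (l : List S) : mapL f (gen l) = gen (l.map f) := by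
  simp [mapL, gen]

theorem mapL_id (x : Chain (List S)) : mapL id x = x := by
  rw [mapL, List.map_id_fun]
  exact LinearMap.congr_fun (Finsupp.lmapDomain_id _ _) x

theorem mapL_consL (f : S → T) (v : S) (x : Chain (List S)) :
    mapL f (consL v x) = consL (f v) (mapL f x) := by
  have : mapL f ∘ₗ consL v = consL (f v) ∘ₗ mapL f :=
    chain_hom_ext fun l => by simp only [LinearMap.comp_apply, consL_gen, mapL_gen, List.map_cons]
  exact LinearMap.congr_fun this x

theorem bdL_mapL (f : S → T) (x : Chain (List S)) : bdL (mapL f x) = mapL f (bdL x) := by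
  have : bdL ∘ₗ mapL f = mapL f ∘ₗ bdL := by
    refine chain_hom_ext fun l => ?_
    simp only [LinearMap.comp_apply, mapL_gen, bdL_gen]
    induction l with
    | nil => simp [bdList]
    | cons v l ih => simp only [List.map_cons, bdList, map_add, mapL_gen, mapL_consL, ih]
  exact LinearMap.congr_fun this x

/-- The prism on an ordered simplex, between its images under `f` and `g`. -/
noncomputable def prismList (f g : S → T) : List S → Chain (List T)
  | [] => 0
  | v :: l => gen (f v :: g v :: l.map g) + consL (f v) (prismList f g l)

/-- The prism operator, a chain homotopy between the maps induced by `f` and `g`. -/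
noncomputable def prism (f g : S → T) : Chain (List S) →ₗ[ZMod 2] Chain (List T) :=
  Finsupp.linearCombination (ZMod 2) (prismList f g)

theorem prism_gen (f g : S → T) (l : List S) : prism f g (gen l) = prismList f g l := by
  simp [prism, gen]

theorem prism_consL (f g : S → T) (v : S) (x : Chain (List S)) : prism f g (consL v x) =
    consL (f v) (consL (g v) (mapL g x)) + consL (f v) (prism f g x) := by
  have : prism f g ∘ₗ consL v =
      consL (f v) ∘ₗ consL (g v) ∘ₗ mapL g + consL (f v) ∘ₗ prism f g := by
    refine chain_hom_ext fun l => ?_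
    simp only [LinearMap.comp_apply, LinearMap.add_apply, consL_gen, prism_gen, mapL_gen]
    rfl
  exact LinearMap.congr_fun this x

/-- The prism formula, by induction along the list. It holds on the empty simplex too, which every
induced map fixes, so that the right-hand side is zero modulo two. -/
theorem bdL_prism (f g : S → T) (x : Chain (List S)) :
    bdL (prism f g x) + prism f g (bdL x) = mapL f x + mapL g x := by
  have : bdL ∘ₗ prism f g + prism f g ∘ₗ bdL = mapL f + mapL g := by
    refine chain_hom_ext fun l => ?_
    simp only [LinearMap.comp_apply, LinearMap.add_apply, mapL_gen, bdL_gen, prism_gen]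
    induction l with
    | nil => simp [bdList, prismList, ZModModule.add_self]
    | cons v l ih =>
      have h2 := bdL_mapL g (gen l)
      rw [mapL_gen, bdL_gen, bdL_gen] at h2
      simp only [prismList, bdList, map_add, bdL_gen, bdL_consL, prism_gen, prism_consL, h2,
        List.map_cons, ← mapL_gen]
      rw [eq_add_of_add_eq_mod_two ih]
      simp only [map_add, mapL_gen, consL_gen]
      abel_nf
      simp only [two_smul, ZModModule.add_self, zero_add, add_zero]
  exact LinearMap.congr_fun this x

theorem consL_mem {s t : Set (List S)} {v : S} {x : Chain (List S)} (hx : x ∈ spanOn s)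
    (h : ∀ l ∈ s, v :: l ∈ t) : consL v x ∈ spanOn t :=
  map_mem_of_mem_spanOn hx _ fun l hl => by
    rw [consL_gen]
    exact gen_mem_spanOn (h l hl)

theorem mapL_mem {s : Set (List S)} {t : Set (List T)} {f : S → T} {x : Chain (List S)}
    (hx : x ∈ spanOn s) (h : ∀ l ∈ s, l.map f ∈ t) : mapL f x ∈ spanOn t :=
  map_mem_of_mem_spanOn hx _ fun l hl => by
    rw [mapL_gen]
    exact gen_mem_spanOn (h l hl)

theorem mapL_congr {s : Set (List S)} {f g : S → T} {x : Chain (List S)} (hx : x ∈ spanOn s)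
    (h : ∀ l ∈ s, ∀ y ∈ l, f y = g y) : mapL f x = mapL g x :=
  eqOn_of_mem_spanOn hx fun l hl => by
    rw [mapL_gen, mapL_gen, List.map_congr_left (h l hl)]

theorem bdList_mem (l : List S) : bdList l ∈ spanOn {l' | l'.length + 1 = l.length ∧ l' ⊆ l} := by
  induction l with
  | nil => exact Submodule.zero_mem _
  | cons v l ih =>
    refine Submodule.add_mem _ (gen_mem_spanOn ⟨rfl, List.subset_cons_self v l⟩)
      (consL_mem ih ?_)
    rintro l' ⟨h1, h2⟩
    exact ⟨by simp [h1], List.cons_subset_cons v h2⟩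

theorem prismList_mem (f g : S → T) (l : List S) : prismList f g l ∈
    spanOn {l' | l'.length = l.length + 1 ∧ ∀ y ∈ l', ∃ x ∈ l, y = f x ∨ y = g x} := by
  induction l with
  | nil => exact Submodule.zero_mem _
  | cons v l ih =>
    refine Submodule.add_mem _ (gen_mem_spanOn ⟨by simp, ?_⟩) (consL_mem ih ?_)
    · intro y hy
      simp only [List.mem_cons, List.mem_map] at hy ⊢
      rcases hy with rfl | rfl | ⟨x, hx, rfl⟩
      · exact ⟨v, Or.inl rfl, Or.inl rfl⟩
      · exact ⟨v, Or.inl rfl, Or.inr rfl⟩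
      · exact ⟨x, Or.inr hx, Or.inr rfl⟩
    · rintro l' ⟨h1, h2⟩
      refine ⟨by simp [h1], fun y hy => ?_⟩
      rcases List.mem_cons.mp hy with rfl | hy
      · exact ⟨v, List.mem_cons_self, Or.inl rfl⟩
      · obtain ⟨x, hx, h⟩ := h2 y hy
        exact ⟨x, List.mem_cons_of_mem _ hx, h⟩

end ListChains

/-! ### Chains of small simplices, and their acyclicity on contractible compact sets. -/

section SmallChains

variable {S T : Type*} [PseudoMetricSpace S] [PseudoMetricSpace T]

/-- Ordered simplices with `k` vertices in `A`, of diameter less than `ε`. -/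
def smallSimplices (A : Set S) (ε : ℝ) (k : ℕ) : Set (List S) :=
  {l | l.length = k ∧ (∀ x ∈ l, x ∈ A) ∧ ∀ x ∈ l, ∀ y ∈ l, dist x y < ε}

theorem smallSimplices_mono {A B : Set S} (hAB : A ⊆ B) {δ ε : ℝ} (h : δ ≤ ε) (k : ℕ) :
    smallSimplices A δ k ⊆ smallSimplices B ε k :=
  fun _ hl => ⟨hl.1, fun x hx => hAB (hl.2.1 x hx),
    fun x hx y hy => (hl.2.2 x hx y hy).trans_le h⟩

theorem bdL_gen_mem {A : Set S} {ε : ℝ} {k : ℕ} {l : List S} (hl : l ∈ smallSimplices A ε k) :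
    bdL (gen l) ∈ spanOn {l' | l'.length + 1 = k ∧ l' ∈ smallSimplices A ε l'.length} := by
  rw [bdL_gen]
  refine spanOn_mono ?_ (bdList_mem l)
  rintro l' ⟨h1, h2⟩
  exact ⟨h1.trans hl.1, rfl, fun x hx => hl.2.1 x (h2 hx),
    fun x hx y hy => hl.2.2 x (h2 hx) y (h2 hy)⟩

theorem mapL_mem_small {A : Set S} {B : Set T} {δ ε : ℝ} {f : S → T} (hf : ∀ x ∈ A, f x ∈ B)
    (h : ∀ x ∈ A, ∀ y ∈ A, dist x y < δ → dist (f x) (f y) < ε) {k : ℕ} {x : Chain (List S)}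
    (hx : x ∈ spanOn (smallSimplices A δ k)) : mapL f x ∈ spanOn (smallSimplices B ε k) := by
  refine mapL_mem hx fun l hl => ⟨by simpa using hl.1, ?_, ?_⟩
  · intro y hy
    obtain ⟨x, hx, rfl⟩ := List.mem_map.mp hy
    exact hf x (hl.2.1 x hx)
  · intro y hy z hz
    obtain ⟨x, hx, rfl⟩ := List.mem_map.mp hy
    obtain ⟨w, hw, rfl⟩ := List.mem_map.mp hz
    exact h x (hl.2.1 x hx) w (hl.2.1 w hw) (hl.2.2 x hx w hw)

theorem prism_mem_small {A : Set S} {B : Set T} {δ ε : ℝ} {f g : S → T} (hf : ∀ x ∈ A, f x ∈ B)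
    (hg : ∀ x ∈ A, g x ∈ B) (h : ∀ x ∈ A, ∀ y ∈ A, dist x y < δ →
      dist (f x) (f y) < ε ∧ dist (f x) (g y) < ε ∧ dist (g x) (g y) < ε) {k : ℕ}
    {x : Chain (List S)} (hx : x ∈ spanOn (smallSimplices A δ k)) :
    prism f g x ∈ spanOn (smallSimplices B ε (k + 1)) := by
  refine map_mem_of_mem_spanOn hx _ fun l hl => ?_
  rw [prism_gen]
  refine spanOn_mono ?_ (prismList_mem f g l)
  rintro l' ⟨h1, h2⟩
  refine ⟨by rw [h1, hl.1], fun y hy => ?_, fun y hy z hz => ?_⟩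
  · obtain ⟨x, hx, rfl | rfl⟩ := h2 y hy
    · exact hf x (hl.2.1 x hx)
    · exact hg x (hl.2.1 x hx)
  · obtain ⟨x, hx, rfl | rfl⟩ := h2 y hy <;> obtain ⟨w, hw, rfl | rfl⟩ := h2 z hz
    · exact (h x (hl.2.1 x hx) w (hl.2.1 w hw) (hl.2.2 x hx w hw)).1
    · exact (h x (hl.2.1 x hx) w (hl.2.1 w hw) (hl.2.2 x hx w hw)).2.1
    · rw [dist_comm]
      exact (h w (hl.2.1 w hw) x (hl.2.1 x hx) (hl.2.2 w hw x hx)).2.1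
    · exact (h x (hl.2.1 x hx) w (hl.2.1 w hw) (hl.2.2 x hx w hw)).2.2

/-- Every cycle of sufficiently small simplices is the boundary of a chain of small simplices. -/
def SmallAcyclic (A : Set S) : Prop :=
  ∀ ε > 0, ∃ δ > 0, ∀ k, ∀ x ∈ spanOn (smallSimplices A δ k), bdL x = 0 →
    ∃ y ∈ spanOn (smallSimplices A ε (k + 1)), bdL y = x

/-- A contraction of a compact set is uniformly continuous. Cut into sufficiently short time steps,
it moves a small cycle through prisms over small simplices to a cycle supported at one point, and
there one can cone. -/
theorem smallAcyclic_of_contractible {A : Set S} (hA : IsCompact A) [ContractibleSpace A] :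
    SmallAcyclic A := by
  classical
  intro ε hε
  have : CompactSpace A := isCompact_iff_compactSpace.mp hA
  obtain ⟨a, ⟨H⟩⟩ := id_nullhomotopic A
  have hH : UniformContinuous (fun x : unitInterval × A => H x) :=
    CompactSpace.uniformContinuous_of_continuous H.continuous
  obtain ⟨δ, hδ, hδε⟩ := Metric.uniformContinuous_iff.mp hH ε hε
  obtain ⟨n, hn⟩ := exists_nat_one_div_lt hδ
  let t : ℕ → unitInterval := fun i => Set.projIcc 0 1 zero_le_one ((i : ℝ) / (n + 1))
  -- Stage `i` of the contraction, extended by the identity off `A`, where its values play no role.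
  let K : ℕ → S → S := fun i x => if hx : x ∈ A then H (t i, ⟨x, hx⟩) else x
  have hK : ∀ i x (hx : x ∈ A), K i x = H (t i, ⟨x, hx⟩) := fun i x hx => dif_pos hx
  have hKA : ∀ i, ∀ x ∈ A, K i x ∈ A := fun i x hx => by
    rw [hK i x hx]
    exact Subtype.property _
  have ht : ∀ i, dist (t i) (t (i + 1)) < δ := fun i => by
    refine lt_of_le_of_lt ((LipschitzWith.projIcc zero_le_one).dist_le_mul _ _) ?_
    rw [NNReal.coe_one, one_mul, Real.dist_eq, abs_sub_comm, ← sub_div]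
    push_cast
    rw [add_sub_cancel_left, abs_of_nonneg (by positivity)]
    exact hn
  have hdist : ∀ i j, dist (t i) (t j) < δ → ∀ x ∈ A, ∀ y ∈ A, dist x y < δ →
      dist (K i x) (K j y) < ε := fun i j hij x hx y hy hxy => by
    rw [hK i x hx, hK j y hy]
    exact hδε (max_lt hij hxy)
  refine ⟨δ, hδ, fun k x hx hx0 => ?_⟩
  -- The prisms between consecutive stages telescope.
  have key : ∀ i, ∃ y ∈ spanOn (smallSimplices A ε (k + 1)), bdL y = x + mapL (K i) x := by
    intro i
    induction i with
    | zero =>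
      refine ⟨0, Submodule.zero_mem _, ?_⟩
      have : mapL (K 0) x = mapL id x := mapL_congr hx fun l hl y hy => by
        have : t 0 = 0 := by
          simp only [t, Nat.cast_zero, zero_div]
          exact Set.projIcc_left zero_le_one
        rw [hK 0 y (hl.2.1 y hy), this, H.apply_zero]
        rfl
      rw [this, map_zero, mapL, List.map_id_fun]
      exact (ZModModule.add_self x ▸ by rw [Finsupp.lmapDomain_id]; rfl)
    | succ i ih =>
      obtain ⟨y, hy, hyx⟩ := ih
      refine ⟨y + prism (K i) (K (i + 1)) x, Submodule.add_mem _ hy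
        (prism_mem_small (hKA i) (hKA (i + 1)) (fun u hu v hv huv =>
          ⟨hdist i i (by simpa using hδ) u hu v hv huv, hdist i (i + 1) (ht i) u hu v hv huv,
            hdist _ _ (by simpa using hδ) u hu v hv huv⟩) hx), ?_⟩
      have := bdL_prism (K i) (K (i + 1)) x
      rw [hx0, map_zero, add_zero] at this
      rw [map_add, hyx, this, add_assoc, ← add_assoc (mapL (K i) x), ZModModule.add_self, zero_add]
  obtain ⟨y, hy, hyx⟩ := key (n + 1)
  have hconst : mapL (K (n + 1)) x = mapL (fun _ => (a : S)) x := mapL_congr hx fun l hl y hy => by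
    have : t (n + 1) = 1 := by
      have h1 : (((n + 1 : ℕ) : ℝ) / (n + 1)) = 1 := by
        push_cast
        exact div_self (by positivity)
      simp only [t, h1]
      exact Set.projIcc_right zero_le_one
    rw [hK _ y (hl.2.1 y hy), this, H.apply_one]
    rfl
  -- The cone from `a` over the constant cycle consists of simplices of diameter zero.
  refine ⟨y + consL (a : S) (mapL (fun _ => (a : S)) x), Submodule.add_mem _ hy ?_, ?_⟩
  · have := mapL_mem_small (A := A) (B := A) (δ := δ) (ε := ε) (f := fun _ => (a : S))
      (fun _ _ => a.2) (fun _ _ _ _ _ => by simpa using hε) hx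
    have h2 : mapL (fun _ => (a : S)) x ∈
        spanOn {l : List S | l.length = k ∧ ∀ x ∈ l, x = (a : S)} :=
      mapL_mem hx fun l hl => ⟨by simpa using hl.1, fun y hy => by
        obtain ⟨z, _, rfl⟩ := List.mem_map.mp hy
        rfl⟩
    refine consL_mem h2 fun l hl => ⟨by simp [hl.1], fun y hy => ?_, fun y hy z hz => ?_⟩
    · rcases List.mem_cons.mp hy with rfl | hy
      · exact a.2
      · rw [hl.2 y hy]
        exact a.2
    · have h3 : ∀ y ∈ (a : S) :: l, y = a := fun y hy => by
        rcases List.mem_cons.mp hy with rfl | hy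
        · rfl
        · exact hl.2 y hy
      rw [h3 y hy, h3 z hz, dist_self]
      exact hε
  · rw [map_add, hyx, hconst, bdL_consL, bdL_mapL, hx0, map_zero, map_zero, add_zero, add_assoc,
      ZModModule.add_self, add_zero]

end SmallChains

/-! ### Abstract cell complexes and their realization by closed covers. -/

open Filter Topology in
theorem exists_pos_forall_of_finite {ι : Type*} [Finite ι] {P : ι → ℝ → Prop}
    (anti : ∀ i δ δ', δ' ≤ δ → P i δ → P i δ') (h : ∀ i, ∃ δ > 0, P i δ) :
    ∃ δ > 0, ∀ i, P i δ := by
  have h1 : ∀ᶠ δ in 𝓝[>] (0 : ℝ), ∀ i, P i δ := by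
    rw [eventually_all]
    intro i
    obtain ⟨δ, hδ, hP⟩ := h i
    filter_upwards [Ioc_mem_nhdsGT hδ] with δ' hδ'
    exact anti i δ δ' hδ'.2 hP
  obtain ⟨δ, hδ, hpos⟩ := (h1.and self_mem_nhdsWithin).exists
  exact ⟨δ, hpos, hδ⟩

/-- A finite-dimensional augmented cellular complex on a graded poset whose bottom element stands
for the empty cell, with acyclic closed cells. -/
structure CellStructure (Q : Type*) [PartialOrder Q] [OrderBot Q] where
  rk : Q → ℕ
  bd : Chain Q →ₗ[ZMod 2] Chain Q
  rk_bot : rk ⊥ = 0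
  rk_strictMono : StrictMono rk
  bd_mem : ∀ τ, bd (gen τ) ∈ spanOn {ρ | ρ ≤ τ ∧ rk ρ + 1 = rk τ}
  bd_bd : ∀ x, bd (bd x) = 0
  acyclic : ∀ τ, τ ≠ ⊥ → ∀ k, ∀ x ∈ spanOn {ρ | ρ ≤ τ ∧ rk ρ = k}, bd x = 0 →
    ∃ y ∈ spanOn {ρ | ρ ≤ τ ∧ rk ρ = k + 1}, bd y = x

/-- A realization of a cellular complex by closed subsets of a space. -/
structure CellStructure.IsCover {Q : Type*} [PartialOrder Q] [OrderBot Q] (K : CellStructure Q)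
    {S : Type*} [PseudoMetricSpace S] (F : Q → Set S) : Prop where
  closed : ∀ τ, IsClosed (F τ)
  mono : Monotone F
  bot : F ⊥ = ∅
  inter : ∀ τ τ' x, x ∈ F τ → x ∈ F τ' → ∃ ρ, ρ ≤ τ ∧ ρ ≤ τ' ∧ x ∈ F ρ
  cover : ∀ x, ∃ τ, x ∈ F τ
  acyclic : ∀ τ, τ ≠ ⊥ → SmallAcyclic (F τ)

/-! ### Chain maps between cells and small simplices. -/

section Approximation

variable {Q : Type*} [PartialOrder Q] [OrderBot Q] {K : CellStructure Q} {S : Type*}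
  [PseudoMetricSpace S] {F : Q → Set S}

theorem CellStructure.bd_bot (K : CellStructure Q) : K.bd (gen ⊥) = 0 := by
  have h := K.bd_mem ⊥
  have h2 : {ρ : Q | ρ ≤ ⊥ ∧ K.rk ρ + 1 = K.rk ⊥} = ∅ := by
    ext ρ
    simp [K.rk_bot]
  rw [h2, spanOn, Finsupp.supported_empty, Submodule.mem_bot] at h
  exact h

theorem CellStructure.rk_pos (K : CellStructure Q) {τ : Q} (h : τ ≠ ⊥) : 0 < K.rk τ := by
  rw [← K.rk_bot]
  exact K.rk_strictMono (bot_lt_iff_ne_bot.mpr h)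

/-- The cells assigned to the vertices of a small simplex are pairwise comparable, so a maximal one
is greatest. Its closed cell can carry the whole simplex. -/
theorem exists_max_of_small {Q : Type*} [PartialOrder Q] {p : S → Q} {δ : ℝ} (hp : ∀ x y, dist x y < δ → p x ≤ p y ∨ p y ≤ p x)
    {k : ℕ} {l : List S} (hl : l ∈ smallSimplices Set.univ δ k) (hne : l ≠ []) :
    ∃ x ∈ l, ∀ y ∈ l, p y ≤ p x := by
  classical
  obtain ⟨x, hx, hmax⟩ := l.toFinset.exists_maximalFor p (by
    obtain ⟨a, ha⟩ := List.exists_mem_of_ne_nil l hne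
    exact ⟨a, by simpa using ha⟩)
  refine ⟨x, by simpa using hx, fun y hy => ?_⟩
  rcases hp x y (hl.2.2 x (by simpa using hx) y hy) with h | h
  · exact hmax (by simpa using hy) h
  · exact h

/-- Small simplices map to the cellular complex. -/
theorem CellStructure.exists_approximation (K : CellStructure Q) {p : S → Q} (hne : ∀ x, p x ≠ ⊥)
    {δ : ℝ} (hp : ∀ x y, dist x y < δ → p x ≤ p y ∨ p y ≤ p x) :
    ∃ g : Chain (List S) →ₗ[ZMod 2] Chain Q, g (gen []) = gen ⊥ ∧
      ∀ k, ∀ l ∈ smallSimplices Set.univ δ k, K.bd (g (gen l)) = g (bdL (gen l)) ∧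
        g (gen l) ∈ spanOn {ρ | K.rk ρ = k ∧ (ρ = ⊥ ∨ ∃ x ∈ l, ρ ≤ p x)} := by
  classical
  -- `f0` prescribes the value on the empty simplex. Solving the homotopy equation for `K.bd ∘ₗ f0 +
  -- f0 ∘ₗ bdL` is the same as making `f0 + h` a chain map.
  let f0 : Chain (List S) →ₗ[ZMod 2] Chain Q :=
    Finsupp.linearCombination (ZMod 2) fun l => if l = [] then gen ⊥ else 0
  have hf0 : ∀ l, f0 (gen l) = if l = [] then gen ⊥ else 0 := fun l => by
    simp [f0, gen]
  have hbd0 : ∀ l, K.bd (f0 (gen l)) = 0 := fun l => by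
    rw [hf0]
    split_ifs
    · exact K.bd_bot
    · exact map_zero _
  let G : Set (List S) := {l | l ∈ smallSimplices Set.univ δ l.length}
  obtain ⟨h, hh⟩ := exists_homotopy List.length bdL K.bd G (K.bd ∘ₗ f0 + f0 ∘ₗ bdL)
    (fun l y => y ∈ spanOn {ρ | K.rk ρ = l.length ∧ ∃ x ∈ l, ρ ≤ p x})
    (fun l hl => by
      refine spanOn_mono ?_ (bdL_gen_mem hl)
      exact fun l' hl' => ⟨hl'.2, by have := hl'.1; omega⟩)
    (fun l _ => bdL_bdL _)
    (fun l _ => by simp [bdL_bdL, K.bd_bd])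
    (by
      intro l hl h ih hcyc
      simp only [LinearMap.add_apply, LinearMap.comp_apply, hbd0, zero_add] at hcyc ⊢
      by_cases hl0 : l = []
      · subst hl0
        refine ⟨0, Submodule.zero_mem _, ?_⟩
        rw [bdL_gen]
        simp [bdList]
      · obtain ⟨x, hx, hmax⟩ := exists_max_of_small hp hl hl0
        obtain ⟨k, hk⟩ : ∃ k, l.length = k + 1 :=
          ⟨l.length - 1, by have := List.length_pos_of_ne_nil hl0; omega⟩
        obtain ⟨y, hy, hyx⟩ := K.acyclic (p x) (hne x) k
          (f0 (bdL (gen l)) + h (bdL (gen l))) (by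
            rw [bdL_gen]
            refine map_mem_of_mem_spanOn (bdList_mem l) (f0 + h) fun l' hl' => ?_
            have hlen : l'.length = k := by have := hl'.1; omega
            refine Submodule.add_mem _ ?_ ?_
            · rw [hf0]
              split_ifs with h0
              · refine gen_mem_spanOn ⟨bot_le, ?_⟩
                rw [K.rk_bot, ← hlen, h0]
                rfl
              · exact Submodule.zero_mem _
            · refine spanOn_mono ?_ (ih l' ⟨rfl, fun _ _ => Set.mem_univ _, fun a ha b hb =>
                hl.2.2 a (hl'.2 ha) b (hl'.2 hb)⟩ (by omega)).1
              rintro ρ ⟨h1, z, hz, h2⟩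
              exact ⟨h2.trans (hmax z (hl'.2 hz)), h1.trans hlen⟩) hcyc
        refine ⟨y, spanOn_mono ?_ hy, hyx⟩
        rintro ρ ⟨h1, h2⟩
        exact ⟨by rw [h2, hk], x, hx, h1⟩)
  refine ⟨f0 + h, ?_, fun k l hl => ?_⟩
  · have : h (gen []) = 0 := by
      have h1 := (hh [] ⟨rfl, by simp, by simp⟩).1
      simpa [spanOn] using h1
    rw [LinearMap.add_apply, this, hf0, if_pos rfl, add_zero]
  · have hl' : l ∈ G := by
      have := hl
      rwa [← hl.1] at this
    obtain ⟨h1, h2⟩ := hh l hl'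
    constructor
    · simp only [LinearMap.add_apply, LinearMap.comp_apply, map_add] at h2 ⊢
      rw [eq_add_of_add_eq_mod_two h2]
      rw [← add_assoc, ← add_assoc, ZModModule.add_self, zero_add]
    · refine Submodule.add_mem _ ?_ ?_
      swap
      · refine spanOn_mono ?_ h1
        exact fun ρ hρ => ⟨hρ.1.trans hl.1, Or.inr hρ.2⟩
      rw [hf0]
      split_ifs with h0
      · refine gen_mem_spanOn ⟨?_, Or.inl rfl⟩
        rw [K.rk_bot, ← hl.1, h0]
        rfl
      · exact Submodule.zero_mem _

/-- Each filling enlarges the simplices, so the scales for `N` successive fillings are found by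
iterating the modulus of acyclicity backwards from `ε`. Finiteness of `Q` allows one modulus for all
cells. -/
theorem CellStructure.IsCover.exists_scales [Finite Q] (hF : K.IsCover F) {ε : ℝ} (hε : 0 < ε) (N : ℕ) :
    ∃ e : ℕ → ℝ, (∀ k, 0 < e k) ∧ Monotone e ∧ (∀ k, e k ≤ ε) ∧
      ∀ k < N, ∀ τ, τ ≠ ⊥ → ∀ j, ∀ x ∈ spanOn (smallSimplices (F τ) (e k) j), bdL x = 0 →
        ∃ y ∈ spanOn (smallSimplices (F τ) (e (k + 1)) (j + 1)), bdL y = x := by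
  have hmod : ∀ ε > 0, ∃ δ > 0, ∀ τ, τ ≠ ⊥ → ∀ j, ∀ x ∈ spanOn (smallSimplices (F τ) δ j),
      bdL x = 0 → ∃ y ∈ spanOn (smallSimplices (F τ) ε (j + 1)), bdL y = x := by
    intro ε hε
    refine exists_pos_forall_of_finite ?_ ?_
    · intro τ δ δ' hle h hτ j x hx
      exact h hτ j x (spanOn_mono (smallSimplices_mono subset_rfl hle j) hx)
    · intro τ
      by_cases hτ : τ = ⊥
      · exact ⟨1, one_pos, fun h => absurd hτ h⟩
      · obtain ⟨δ, hδ, h⟩ := hF.acyclic τ hτ ε hε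
        exact ⟨δ, hδ, fun _ => h⟩
  choose! m hm hm' using hmod
  let d : ℕ → ℝ := fun n => Nat.rec ε (fun _ a => min a (m a)) n
  have hds : ∀ n, d (n + 1) = min (d n) (m (d n)) := fun n => rfl
  have hpos : ∀ n, 0 < d n := by
    intro n
    induction n with
    | zero => exact hε
    | succ n ih =>
      rw [hds]
      exact lt_min ih (hm _ ih)
  have hanti : Antitone d := antitone_nat_of_succ_le fun n => by
    rw [hds]
    exact min_le_left _ _
  refine ⟨fun k => d (N - k), fun k => hpos _, fun a b h => hanti (by omega),
    fun k => hanti (Nat.zero_le _), fun k hk τ hτ j x hx hx0 => ?_⟩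
  obtain ⟨n, hn⟩ : ∃ n, N - k = n + 1 := ⟨N - k - 1, by omega⟩
  simp only [hn, show N - (k + 1) = n by omega] at hx ⊢
  refine hm' (d n) (hpos n) τ hτ j x (spanOn_mono (smallSimplices_mono subset_rfl ?_ j) hx) hx0
  rw [hds]
  exact min_le_right _ _

variable [Finite Q]

-- By compactness: points ever closer to both `F τ` and `F τ'` accumulate at a common point of the
-- two, and this lies in a common face.
open Filter Topology in
theorem CellStructure.IsCover.exists_near [CompactSpace S] (hF : K.IsCover F) {η : ℝ} (hη : 0 < η) :
    ∃ δ > 0, ∀ τ τ' x, x ∈ Metric.thickening δ (F τ) → x ∈ Metric.thickening δ (F τ') →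
      ∃ ρ, ρ ≤ τ ∧ ρ ≤ τ' ∧ x ∈ Metric.thickening η (F ρ) := by
  have h := exists_pos_forall_of_finite (ι := Q × Q) (P := fun i δ => ∀ x,
    x ∈ Metric.thickening δ (F i.1) → x ∈ Metric.thickening δ (F i.2) →
      ∃ ρ, ρ ≤ i.1 ∧ ρ ≤ i.2 ∧ x ∈ Metric.thickening η (F ρ)) ?_ ?_
  · obtain ⟨δ, hδ, h⟩ := h
    exact ⟨δ, hδ, fun τ τ' => h (τ, τ')⟩
  · intro i δ δ' hle h x h1 h2
    exact h x (Metric.thickening_mono hle _ h1) (Metric.thickening_mono hle _ h2)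
  · rintro ⟨τ, τ'⟩
    by_contra! hcon
    choose! u hu1 hu2 hu3 using fun n : ℕ => hcon (1 / ((n : ℝ) + 1)) Nat.one_div_pos_of_nat
    obtain ⟨x, -, φ, hφ, hx⟩ := isCompact_univ.tendsto_subseq (x := u) fun _ => Set.mem_univ _
    have hlim : ∀ σ, (∀ n : ℕ, u n ∈ Metric.thickening (1 / ((n : ℝ) + 1)) (F σ)) → x ∈ F σ := by
      intro σ hσ
      choose v hv hv' using fun n => Metric.mem_thickening_iff.mp (hσ n)
      refine (hF.closed σ).mem_of_tendsto (b := atTop) (f := fun n => v (φ n)) ?_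
        (Eventually.of_forall fun n => hv _)
      refine tendsto_of_tendsto_of_dist hx ?_
      refine squeeze_zero (fun _ => dist_nonneg) (fun n => (hv' (φ n)).le) ?_
      exact (tendsto_one_div_add_atTop_nhds_zero_nat (𝕜 := ℝ)).comp hφ.tendsto_atTop
    obtain ⟨ρ, h1, h2, h3⟩ := hF.inter τ τ' x (hlim τ hu1) (hlim τ' hu2)
    obtain ⟨n, hn⟩ := (Metric.tendsto_nhds.mp hx η hη).exists
    exact hu3 (φ n) ρ h1 h2 (Metric.mem_thickening_iff.mpr ⟨x, h3, hn⟩)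

/-- Points can be moved slightly into cells so that nearby points go to comparable cells. -/
theorem CellStructure.IsCover.exists_assignment [CompactSpace S] (hF : K.IsCover F) {ε : ℝ}
    (hε : 0 < ε) :
    ∃ δ > 0, ∃ (p : S → Q) (ρ : S → S), (∀ x, ρ x ∈ F (p x) ∧ dist x (ρ x) < ε) ∧
      (∀ x y, dist x y < δ → p x ≤ p y ∨ p y ≤ p x) ∧ ∀ x τ, x ∈ F τ → p x ≤ τ := by
  choose! m hm hm' using fun (η : ℝ) (hη : 0 < η) => hF.exists_near hη
  -- The thickness of the neighbourhood of a cell decreases with its rank. The factor 1/2 leaves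
  -- room for the doubled thickness in `hle`.
  let η : ℕ → ℝ := fun n => Nat.rec ε (fun _ a => min a (m a) / 2) n
  have hη0 : η 0 = ε := rfl
  have hηs : ∀ n, η (n + 1) = min (η n) (m (η n)) / 2 := fun n => rfl
  have hpos : ∀ n, 0 < η n := by
    intro n
    induction n with
    | zero => exact hε
    | succ n ih =>
      rw [hηs]
      have := hm _ ih
      positivity
  have hanti : Antitone η := antitone_nat_of_succ_le fun n => by
    have h1 := min_le_left (η n) (m (η n))
    have h2 := hpos n
    rw [hηs]
    linarith
  have hmod : ∀ n, 2 * η (n + 1) ≤ m (η n) := fun n => by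
    have h1 := min_le_right (η n) (m (η n))
    rw [hηs]
    linarith
  -- The assigned cell has least rank among the cells whose thickening contains `x`.
  have hex : ∀ x, ∃ τ, x ∈ Metric.thickening (η (K.rk τ)) (F τ) ∧
      ∀ τ', x ∈ Metric.thickening (η (K.rk τ')) (F τ') → K.rk τ ≤ K.rk τ' := by
    intro x
    obtain ⟨τ, hτ⟩ := hF.cover x
    obtain ⟨σ, h1, h2⟩ := (measure K.rk).wf.has_min
      {τ | x ∈ Metric.thickening (η (K.rk τ)) (F τ)}
      ⟨τ, Metric.self_subset_thickening (hpos _) _ hτ⟩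
    exact ⟨σ, h1, fun τ' h => not_lt.mp (h2 τ' h)⟩
  choose p hp hmin using hex
  choose ρ hρ hρ' using fun x => Metric.mem_thickening_iff.mp (hp x)
  -- If `x` is also near `F τ`, it is near a common face of `p x` and `τ`. A proper face of `p x`
  -- would contradict minimality of the rank, so this face is `p x`.
  have hle : ∀ x τ, x ∈ Metric.thickening (2 * η (K.rk (p x))) (F τ) → p x ≤ τ := by
    intro x τ hx
    have hne : p x ≠ ⊥ := fun h => by
      have := hρ x
      rw [h, hF.bot] at this
      exact this
    obtain ⟨k, hk⟩ : ∃ k, K.rk (p x) = k + 1 := ⟨K.rk (p x) - 1, by have := K.rk_pos hne; omega⟩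
    rw [hk] at hx
    have h1 := hp x
    rw [hk] at h1
    have hk0 := hpos (k + 1)
    obtain ⟨σ, h2, h3, h4⟩ := hm' (η k) (hpos k) (p x) τ x
      (Metric.thickening_mono (by have := hmod k; linarith) _ h1)
      (Metric.thickening_mono (hmod k) _ hx)
    rcases eq_or_lt_of_le h2 with rfl | h2
    · exact h3
    · have h5 := K.rk_strictMono h2
      have h6 := hmin x σ (Metric.thickening_mono (hanti (by omega)) _ h4)
      omega
  obtain ⟨N, hN⟩ : ∃ N, ∀ τ, K.rk τ ≤ N := by
    obtain ⟨N, hN⟩ := (Set.finite_range K.rk).bddAbove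
    exact ⟨N, fun τ => hN ⟨τ, rfl⟩⟩
  have hcomp : ∀ x y, dist x y < η N → K.rk (p x) ≤ K.rk (p y) → p x ≤ p y := by
    intro x y hxy h
    refine hle x (p y) (Metric.mem_thickening_iff.mpr ⟨ρ y, hρ y, ?_⟩)
    have h1 := dist_triangle x y (ρ y)
    have h2 := hρ' y
    have h3 := hanti h
    have h4 := hanti (hN (p x))
    linarith
  refine ⟨η N, hpos N, p, ρ, fun x => ⟨hρ x, (hρ' x).trans_le ?_⟩, fun x y hxy => ?_,
    fun x τ hx => ?_⟩
  · exact (hanti (Nat.zero_le _)).trans hη0.le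
  · rcases le_total (K.rk (p x)) (K.rk (p y)) with h | h
    · exact Or.inl (hcomp x y hxy h)
    · exact Or.inr (hcomp y x (by rwa [dist_comm]) h)
  · exact hle x τ (Metric.self_subset_thickening (by have := hpos (K.rk (p x)); linarith) _ hx)

/-- The cellular complex maps to small simplices, carried by the closed cells. -/
theorem CellStructure.IsCover.exists_realization (hF : K.IsCover F) {ε : ℝ} (hε : 0 < ε) :
    ∃ α : Chain Q →ₗ[ZMod 2] Chain (List S), (∀ x, bdL (α x) = α (K.bd x)) ∧
      α (gen ⊥) = gen [] ∧ ∀ τ, α (gen τ) ∈ spanOn (smallSimplices (F τ) ε (K.rk τ)) := by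
  classical
  obtain ⟨N, hN⟩ : ∃ N, ∀ τ, K.rk τ ≤ N := by
    obtain ⟨N, hN⟩ := (Set.finite_range K.rk).bddAbove
    exact ⟨N, fun τ => hN ⟨τ, rfl⟩⟩
  obtain ⟨e, -, he, heε, hac⟩ := hF.exists_scales hε N
  let f0 : Chain Q →ₗ[ZMod 2] Chain (List S) :=
    Finsupp.linearCombination (ZMod 2) fun τ => if τ = ⊥ then gen [] else 0
  have hf0 : ∀ τ, f0 (gen τ) = if τ = ⊥ then gen [] else 0 := fun τ => by
    simp [f0, gen]
  have hbd0 : ∀ τ, bdL (f0 (gen τ)) = 0 := fun τ => by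
    rw [hf0]
    split_ifs
    · rw [bdL_gen]
      rfl
    · exact map_zero _
  have hmem : ∀ τ y, y ∈ spanOn (smallSimplices (F τ) (e (K.rk τ)) (K.rk τ)) → 
      f0 (gen τ) + y ∈ spanOn (smallSimplices (F τ) (e (K.rk τ)) (K.rk τ)) := by
    intro τ y hy
    refine Submodule.add_mem _ ?_ hy
    rw [hf0]
    split_ifs with h
    · exact gen_mem_spanOn ⟨by rw [h, K.rk_bot]; rfl, by simp, by simp⟩
    · exact Submodule.zero_mem _
  obtain ⟨h, hh⟩ := exists_homotopy K.rk K.bd bdL Set.univ (bdL ∘ₗ f0 + f0 ∘ₗ K.bd)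
    -- The second condition keeps the value prescribed by `f0` on the bottom cell.
    (fun τ y => y ∈ spanOn (smallSimplices (F τ) (e (K.rk τ)) (K.rk τ)) ∧ (τ = ⊥ → y = 0))
    (fun τ _ => by
      refine spanOn_mono ?_ (K.bd_mem τ)
      exact fun ρ hρ => ⟨Set.mem_univ _, by have := hρ.2; omega⟩)
    (fun τ _ => K.bd_bd _)
    (fun τ _ => by simp [bdL_bdL, K.bd_bd])
    (by
      intro τ _ h ih hcyc
      simp only [LinearMap.add_apply, LinearMap.comp_apply, hbd0, zero_add] at hcyc ⊢
      by_cases hτ : τ = ⊥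
      · subst hτ
        rw [K.bd_bot]
        exact ⟨0, ⟨Submodule.zero_mem _, fun _ => rfl⟩, by simp⟩
      · obtain ⟨k, hk⟩ : ∃ k, K.rk τ = k + 1 := ⟨K.rk τ - 1, by have := K.rk_pos hτ; omega⟩
        have hx : f0 (K.bd (gen τ)) + h (K.bd (gen τ)) ∈
            spanOn (smallSimplices (F τ) (e k) k) := by
          refine map_mem_of_mem_spanOn (K.bd_mem τ) (f0 + h) fun ρ hρ => ?_
          have h1 := hmem ρ _ (ih ρ (Set.mem_univ _) (by have := hρ.2; omega)).1.1
          rw [show K.rk ρ = k by have := hρ.2; omega] at h1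
          exact spanOn_mono (smallSimplices_mono (hF.mono hρ.1) le_rfl k) h1
        obtain ⟨y, hy, hyx⟩ := hac k (by have := hN τ; omega) τ hτ k _ hx hcyc
        rw [hk]
        exact ⟨y, ⟨hy, fun h => absurd h hτ⟩, hyx⟩)
  refine ⟨f0 + h, fun x => ?_, ?_, fun τ => ?_⟩
  · have : bdL ∘ₗ (f0 + h) = (f0 + h) ∘ₗ K.bd := chain_hom_ext fun τ => by
      have h1 := (hh τ (Set.mem_univ _)).2
      simp only [LinearMap.add_apply, LinearMap.comp_apply, map_add] at h1 ⊢
      rw [eq_add_of_add_eq_mod_two h1]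
      rw [← add_assoc, ← add_assoc, ZModModule.add_self, zero_add]
    exact LinearMap.congr_fun this x
  · rw [LinearMap.add_apply, (hh ⊥ (Set.mem_univ _)).1.2 rfl, hf0, if_pos rfl, add_zero]
  · exact spanOn_mono (smallSimplices_mono subset_rfl (heε _) _) (hmem τ _ (hh τ (Set.mem_univ _)).1.1)

end Approximation

/-! ### Homotopy equivalence of cells and small simplices, and its consequences. -/

section Comparison

variable {Q : Type*} [PartialOrder Q] [OrderBot Q] {K : CellStructure Q}
  {S : Type*} [PseudoMetricSpace S] {F : Q → Set S}

/-- Being a realization of the cells by simplices smaller than `δ`. -/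
structure CellStructure.IsRealization (K : CellStructure Q) (F : Q → Set S) (δ : ℝ)
    (α : Chain Q →ₗ[ZMod 2] Chain (List S)) : Prop where
  comm : ∀ x, bdL (α x) = α (K.bd x)
  bot : α (gen ⊥) = gen []
  mem : ∀ τ, α (gen τ) ∈ spanOn (smallSimplices (F τ) δ (K.rk τ))

/-- Being a chain map from simplices smaller than `δ` to the cellular complex. -/
structure CellStructure.IsApproximation (K : CellStructure Q) (δ : ℝ)
    (g : Chain (List S) →ₗ[ZMod 2] Chain Q) : Prop where
  comm : ∀ k, ∀ x ∈ spanOn (smallSimplices Set.univ δ k), K.bd (g x) = g (bdL x)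
  mem : ∀ k, ∀ x ∈ spanOn (smallSimplices Set.univ δ k), g x ∈ spanOn {ρ | K.rk ρ = k}

theorem CellStructure.IsRealization.mem_univ {δ δ' : ℝ} {α : Chain Q →ₗ[ZMod 2] Chain (List S)}
    (hα : K.IsRealization F δ α) (h : δ ≤ δ') {k : ℕ} {x : Chain Q}
    (hx : x ∈ spanOn {ρ | K.rk ρ = k}) : α x ∈ spanOn (smallSimplices Set.univ δ' k) :=
  map_mem_of_mem_spanOn hx α fun τ hτ => by
    have := hα.mem τ
    rw [show K.rk τ = k from hτ] at this
    exact spanOn_mono (smallSimplices_mono (Set.subset_univ _) h k) this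

variable [Finite Q]

theorem CellStructure.IsCover.exists_isRealization (hF : K.IsCover F) {ε : ℝ} (hε : 0 < ε) :
    ∃ α, K.IsRealization F ε α := by
  obtain ⟨α, h1, h2, h3⟩ := hF.exists_realization hε
  exact ⟨α, h1, h2, h3⟩

variable [CompactSpace S]

/-- At a small enough scale, the cellular complex and the complex of small simplices are mutually
inverse up to homotopy. -/
theorem CellStructure.IsCover.exists_comparison (hF : K.IsCover F) {ε : ℝ} (hε : 0 < ε) (N : ℕ) :
    ∃ δ > 0, ∃ g : Chain (List S) →ₗ[ZMod 2] Chain Q, K.IsApproximation δ g ∧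
      (∀ α, K.IsRealization F δ α → ∀ k, ∀ z ∈ spanOn {ρ | K.rk ρ = k}, K.bd z = 0 →
        ∃ w ∈ spanOn {ρ | K.rk ρ = k + 1}, K.bd w = g (α z) + z) ∧
      ∃ α, K.IsRealization F ε α ∧ ∀ k ≤ N, ∀ x ∈ spanOn (smallSimplices Set.univ δ k),
        bdL x = 0 → ∃ y ∈ spanOn (smallSimplices Set.univ ε (k + 1)), bdL y = x + α (g x) := by
  obtain ⟨e, hepos, hemono, heε, hac⟩ := hF.exists_scales hε (N + 1)
  have he0 := hepos 0
  -- With `δ ≤ e 0 / 4` as well, moving both ends of a `δ`-short edge by less than a quarter of `e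
  -- 0` keeps it shorter than `e 0`.
  obtain ⟨δ0, hδ0, p, ρ, hρ, hp0, hpF⟩ := hF.exists_assignment (ε := e 0 / 4) (by positivity)
  obtain ⟨δ, hδ, hδδ0, hδe⟩ : ∃ δ > 0, δ ≤ δ0 ∧ δ ≤ e 0 / 4 :=
    ⟨min δ0 (e 0 / 4), lt_min hδ0 (by positivity), min_le_left _ _, min_le_right _ _⟩
  have hp : ∀ x y, dist x y < δ → p x ≤ p y ∨ p y ≤ p x :=
    fun x y h => hp0 x y (h.trans_le hδδ0)
  have hne : ∀ x, p x ≠ ⊥ := fun x h => by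
    have := (hρ x).1
    rw [h, hF.bot] at this
    exact this
  obtain ⟨g, hg0, hg⟩ := K.exists_approximation hne hp
  have hgap : K.IsApproximation δ g := by
    refine ⟨fun k x hx => eqOn_of_mem_spanOn (f := K.bd ∘ₗ g) (g := g ∘ₗ bdL) hx
      fun l hl => (hg k l hl).1, fun k x hx => map_mem_of_mem_spanOn hx g fun l hl => ?_⟩
    refine spanOn_mono ?_ (hg k l hl).2
    exact fun ρ hρ => hρ.1
  obtain ⟨α, hα1, hα2, hα3⟩ := hF.exists_realization he0
  refine ⟨δ, hδ, g, hgap, fun α hα => ?_, α, ⟨hα1, hα2, fun τ => ?_⟩, ?_⟩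
  -- The composite `g ∘ₗ α` and the identity are both carried by the closed cell, since a point of
  -- `F τ` is assigned a cell below `τ`.
  · obtain ⟨h, hh⟩ := exists_homotopy K.rk K.bd K.bd Set.univ (g ∘ₗ α + LinearMap.id)
      (fun τ y => y ∈ spanOn {ρ | ρ ≤ τ ∧ K.rk ρ = K.rk τ + 1})
      (fun τ _ => by
        refine spanOn_mono ?_ (K.bd_mem τ)
        exact fun ρ hρ => ⟨Set.mem_univ _, by have := hρ.2; omega⟩)
      (fun τ _ => K.bd_bd _)
      (fun τ _ => by
        have h1 := hgap.comm (K.rk τ) (α (gen τ))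
          (hα.mem_univ le_rfl (gen_mem_spanOn (s := {ρ | K.rk ρ = K.rk τ}) rfl))
        simp only [LinearMap.add_apply, LinearMap.comp_apply, LinearMap.id_apply, map_add, h1,
          hα.comm])
      (by
        intro τ _ h ih hcyc
        by_cases hτ : τ = ⊥
        · subst hτ
          refine ⟨0, Submodule.zero_mem _, ?_⟩
          simp only [LinearMap.add_apply, LinearMap.comp_apply, LinearMap.id_apply, hα.bot, hg0,
            K.bd_bot, map_zero, ZModModule.add_self]
        · refine K.acyclic τ hτ (K.rk τ) _ ?_ hcyc
          refine Submodule.add_mem _ (Submodule.add_mem _ ?_ (gen_mem_spanOn ⟨le_rfl, rfl⟩)) ?_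
          · refine map_mem_of_mem_spanOn (hα.mem τ) g fun l hl => ?_
            refine spanOn_mono ?_ (hg (K.rk τ) l
              (smallSimplices_mono (Set.subset_univ _) le_rfl _ hl)).2
            rintro ρ ⟨h1, rfl | ⟨x, hx, h2⟩⟩
            · exact ⟨bot_le, h1⟩
            · exact ⟨h2.trans (hpF x τ (hl.2.1 x hx)), h1⟩
          · refine map_mem_of_mem_spanOn (K.bd_mem τ) h fun ρ hρ => ?_
            have hρ2 := hρ.2
            refine spanOn_mono ?_ (ih ρ (Set.mem_univ _) (by omega)).1
            exact fun σ hσ => ⟨hσ.1.trans hρ.1, by have := hσ.2; omega⟩)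
    intro k z hz hz0
    refine ⟨h z, map_mem_of_mem_spanOn hz h fun τ hτ => ?_, ?_⟩
    · refine spanOn_mono ?_ (hh τ (Set.mem_univ _)).1
      exact fun σ hσ => hσ.2.trans (by rw [show K.rk τ = k from hτ])
    · have := eqOn_of_mem_spanOn (f := K.bd ∘ₗ h + h ∘ₗ K.bd) hz fun τ _ => (hh τ (Set.mem_univ _)).2
      simpa [hz0] using this
  · exact spanOn_mono (smallSimplices_mono subset_rfl (heε 0) _) (hα3 τ)
  -- The other composite is first compared with `mapL ρ` rather than with the identity: only the
  -- moved vertices are known to lie in the assigned cells. Lengths are bounded by `N`, as finitely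
  -- many scales are available.
  · let G : Set (List S) := {l | l.length ≤ N ∧ l ∈ smallSimplices Set.univ δ l.length}
    obtain ⟨h, hh⟩ := exists_homotopy List.length bdL bdL G (α ∘ₗ g + mapL ρ)
      (fun l y => y ∈ spanOn (smallSimplices {s | ∃ x ∈ l, s ∈ F (p x)} (e (l.length + 1))
        (l.length + 1)))
      (fun l hl => by
        refine spanOn_mono ?_ (bdL_gen_mem hl.2)
        exact fun l' hl' => ⟨⟨by have := hl'.1; have := hl.1; omega, hl'.2⟩,
          by have := hl'.1; omega⟩)
      (fun l _ => bdL_bdL _)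
      (fun l hl => by
        simp only [LinearMap.add_apply, LinearMap.comp_apply, map_add, bdL_mapL, hα1,
          (hg _ l hl.2).1])
      (by
        intro l hl h ih hcyc
        by_cases hl0 : l = []
        · subst hl0
          refine ⟨0, Submodule.zero_mem _, ?_⟩
          simp only [LinearMap.add_apply, LinearMap.comp_apply, hg0, hα2, mapL_gen, List.map_nil,
            bdL_gen, bdList, map_zero, ZModModule.add_self]
        · obtain ⟨x, hx, hmax⟩ := exists_max_of_small hp hl.2 hl0
          obtain ⟨y, hy, hyx⟩ := hac l.length (by have := hl.1; omega) (p x) (hne x) l.length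
            ((α ∘ₗ g + mapL ρ) (gen l) + h (bdL (gen l))) (by
              refine Submodule.add_mem _ (Submodule.add_mem _ ?_ ?_) ?_
              · refine map_mem_of_mem_spanOn (hg _ l hl.2).2 α fun σ hσ => ?_
                rw [← hσ.1]
                refine spanOn_mono (smallSimplices_mono (hF.mono ?_) (hemono (Nat.zero_le _)) _)
                  (hα3 σ)
                rcases hσ.2 with rfl | ⟨z, hz, h2⟩
                · exact bot_le
                · exact h2.trans (hmax z hz)
              · rw [mapL_gen]
                refine gen_mem_spanOn ⟨by simp, fun y hy => ?_, fun y hy z hz => ?_⟩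
                · obtain ⟨w, hw, rfl⟩ := List.mem_map.mp hy
                  exact hF.mono (hmax w hw) (hρ w).1
                · obtain ⟨w, hw, rfl⟩ := List.mem_map.mp hy
                  obtain ⟨v, hv, rfl⟩ := List.mem_map.mp hz
                  have h1 := hl.2.2.2 w hw v hv
                  have h2 := dist_triangle4_left w (ρ w) v (ρ v)
                  have h3 := (hρ w).2
                  have h4 := (hρ v).2
                  have h5 := hemono (Nat.zero_le l.length)
                  have h6 := dist_triangle4 (ρ w) w v (ρ v)
                  rw [dist_comm (ρ w) w] at h6
                  linarith
              · rw [bdL_gen]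
                refine map_mem_of_mem_spanOn (bdList_mem l) h fun l' hl' => ?_
                have hlen := hl'.1
                have := (ih l' ⟨by have := hl.1; omega, rfl, fun _ _ => Set.mem_univ _,
                  fun a ha b hb => hl.2.2.2 a (hl'.2 ha) b (hl'.2 hb)⟩ (by omega)).1
                rw [hlen] at this
                refine spanOn_mono (smallSimplices_mono ?_ le_rfl _) this
                rintro s ⟨z, hz, hs⟩
                exact hF.mono (hmax z (hl'.2 hz)) hs) hcyc
          refine ⟨y, spanOn_mono (smallSimplices_mono ?_ le_rfl _) hy, hyx⟩
          exact fun s hs => ⟨x, hx, hs⟩)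
    intro k hk x hx hx0
    have hG : smallSimplices Set.univ δ k ⊆ G := fun l hl =>
      ⟨hl.1.le.trans hk, by have := hl; rwa [← hl.1] at this⟩
    -- The prism joins the identity to `mapL ρ` and completes the homotopy.
    refine ⟨prism id ρ x + h x, Submodule.add_mem _ ?_ ?_, ?_⟩
    · refine prism_mem_small (fun _ _ => Set.mem_univ _) (fun _ _ => Set.mem_univ _) ?_ hx
      intro a _ b _ hab
      have h1 := (hρ a).2
      have h2 := (hρ b).2
      have h3 := heε 0
      have h4 := dist_triangle a b (ρ b)
      have h6 := dist_triangle4 (ρ a) a b (ρ b)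
      rw [dist_comm (ρ a) a] at h6
      simp only [id]
      exact ⟨by linarith, by linarith, by linarith⟩
    · refine map_mem_of_mem_spanOn hx h fun l hl => ?_
      have := (hh l (hG hl)).1
      rw [hl.1] at this
      exact spanOn_mono (smallSimplices_mono (Set.subset_univ _) (heε _) _) this
    · have h1 := eqOn_of_mem_spanOn (f := bdL ∘ₗ h + h ∘ₗ bdL) hx fun l hl => (hh l (hG hl)).2
      simp only [LinearMap.add_apply, LinearMap.comp_apply, hx0, map_zero, add_zero] at h1
      have h2 := bdL_prism id ρ x
      rw [hx0, map_zero, add_zero, mapL_id] at h2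
      rw [map_add, h1, h2, add_comm (α (g x)), add_assoc, ← add_assoc (mapL ρ x),
        ZModModule.add_self, zero_add]

/-- Two cellular structures on the same compact space can be compared by a chain map that is
injective on homology. -/
theorem CellStructure.IsCover.exists_map {Q' : Type*} [PartialOrder Q'] [OrderBot Q'] [Finite Q']
    {K' : CellStructure Q'} {F' : Q' → Set S} (hF : K.IsCover F) (hF' : K'.IsCover F') (N : ℕ) :
    ∃ Θ : Chain Q →ₗ[ZMod 2] Chain Q', ∀ k ≤ N, ∀ z ∈ spanOn {ρ | K.rk ρ = k}, K.bd z = 0 →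
      Θ z ∈ spanOn {ρ | K'.rk ρ = k} ∧ K'.bd (Θ z) = 0 ∧
      ((∃ w ∈ spanOn {ρ | K'.rk ρ = k + 1}, K'.bd w = Θ z) →
        ∃ w ∈ spanOn {ρ | K.rk ρ = k + 1}, K.bd w = z) := by
  -- The order of choices matters: the scale `δ` at which `g` is defined, then `δ'` so that the
  -- homotopy for the second structure stays below `δ`, and finally a realization `α` small for
  -- both.
  obtain ⟨δ, hδ, g, hg, hgα, -⟩ := hF.exists_comparison one_pos 0
  obtain ⟨δ', hδ', g', hg', -, α', hα', hαg'⟩ := hF'.exists_comparison hδ N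
  obtain ⟨α, hα0⟩ := hF.exists_isRealization (ε := min δ δ') (lt_min hδ hδ')
  have hα : K.IsRealization F δ α := ⟨hα0.comm, hα0.bot, fun τ =>
    spanOn_mono (smallSimplices_mono subset_rfl (min_le_left _ _) _) (hα0.mem τ)⟩
  refine ⟨g' ∘ₗ α, fun k hk z hz hz0 => ?_⟩
  have hαz := hα0.mem_univ (min_le_right δ δ') hz
  have hαz0 : bdL (α z) = 0 := by rw [hα.comm, hz0, map_zero]
  refine ⟨hg'.mem k _ hαz, ?_, ?_⟩
  · rw [LinearMap.comp_apply, hg'.comm k _ hαz, hαz0, map_zero]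
  · rintro ⟨w, hw, hwz⟩
    obtain ⟨y, hy, hyz⟩ := hαg' k hk (α z) hαz hαz0
    have hu : y + α' w ∈ spanOn (smallSimplices Set.univ δ (k + 1)) :=
      Submodule.add_mem _ hy (hα'.mem_univ le_rfl hw)
    have hbu : bdL (y + α' w) = α z := by
      rw [map_add, hyz, hα'.comm, hwz, LinearMap.comp_apply, add_assoc, ZModModule.add_self,
        add_zero]
    obtain ⟨v, hv, hvz⟩ := hgα α hα k z hz hz0
    refine ⟨g (y + α' w) + v, Submodule.add_mem _ (hg.mem _ _ hu) hv, ?_⟩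
    rw [map_add, hg.comm _ _ hu, hbu, hvz, ← add_assoc, ZModModule.add_self, zero_add]

/-- If the space is a retract of an acyclic one then the cellular complex is acyclic. -/
theorem CellStructure.IsCover.exists_of_retract (hF : K.IsCover F) {T : Type*}
    [PseudoMetricSpace T] [CompactSpace T] (hT : SmallAcyclic (Set.univ : Set T)) {i : S → T}
    {r : T → S} (hi : Continuous i) (hr : Continuous r) (hri : ∀ x, r (i x) = x) (k : ℕ)
    (z : Chain Q) (hz : z ∈ spanOn {ρ | K.rk ρ = k}) (hz0 : K.bd z = 0) :
    ∃ w ∈ spanOn {ρ | K.rk ρ = k + 1}, K.bd w = z := by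
  -- Scales are chosen backwards along the route: realize the cycle, push it into `T`, fill it
  -- there, retract, and approximate by cells.
  obtain ⟨δ, hδ, g, hg, hgα, -⟩ := hF.exists_comparison one_pos 0
  obtain ⟨δ1, hδ1, hr1⟩ := Metric.uniformContinuous_iff.mp
    (CompactSpace.uniformContinuous_of_continuous hr) δ hδ
  obtain ⟨δ2, hδ2, hac⟩ := hT δ1 hδ1
  obtain ⟨δ3, hδ3, hi3⟩ := Metric.uniformContinuous_iff.mp
    (CompactSpace.uniformContinuous_of_continuous hi) δ2 hδ2
  obtain ⟨α, hα0⟩ := hF.exists_isRealization (ε := min δ δ3) (lt_min hδ hδ3)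
  have hα : K.IsRealization F δ α := ⟨hα0.comm, hα0.bot, fun τ =>
    spanOn_mono (smallSimplices_mono subset_rfl (min_le_left _ _) _) (hα0.mem τ)⟩
  have hαz0 : bdL (α z) = 0 := by rw [hα.comm, hz0, map_zero]
  obtain ⟨y, hy, hyz⟩ := hac k (mapL i (α z)) (mapL_mem_small (fun _ _ => Set.mem_univ _)
    (fun _ _ _ _ h => hi3 h) (hα0.mem_univ (min_le_right δ δ3) hz)) (by
      rw [bdL_mapL, hαz0, map_zero])
  have hry : mapL r y ∈ spanOn (smallSimplices Set.univ δ (k + 1)) :=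
    mapL_mem_small (fun _ _ => Set.mem_univ _) (fun _ _ _ _ h => hr1 h) hy
  have hbry : bdL (mapL r y) = α z := by
    rw [bdL_mapL, hyz]
    have : mapL r ∘ₗ mapL i = LinearMap.id := chain_hom_ext fun l => by
      rw [LinearMap.comp_apply, mapL_gen, mapL_gen, List.map_map, LinearMap.id_apply,
        show r ∘ i = id from funext hri, List.map_id]
    exact LinearMap.congr_fun this _
  obtain ⟨v, hv, hvz⟩ := hgα α hα k z hz hz0
  refine ⟨g (mapL r y) + v, Submodule.add_mem _ (hg.mem _ _ hry) hv, ?_⟩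
  rw [map_add, hg.comm _ _ hry, hbry, hvz, ← add_assoc, ZModModule.add_self, zero_add]

end Comparison

/-! ### The hemisphere decomposition of the sphere, and the no-retraction theorem. -/

section Hemispheres

/-- The cells of the decomposition of the unit sphere of `ℝᵈ` into hemispheres. -/
@[ext] structure Hemisphere (d : ℕ) where
  idx : Fin d
  sgn : Bool

namespace Hemisphere

variable {d : ℕ}

instance : PartialOrder (Hemisphere d) where
  le a b := a = b ∨ a.idx < b.idx
  le_refl a := Or.inl rfl
  le_trans a b c := by
    rintro (rfl | h1) (rfl | h2)
    · exact Or.inl rfl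
    · exact Or.inr h2
    · exact Or.inr h1
    · exact Or.inr (h1.trans h2)
  le_antisymm a b := by
    rintro (rfl | h1) (h2 | h2)
    · rfl
    · rfl
    · exact h2.symm
    · exact absurd (h1.trans h2) (lt_irrefl _)

theorem le_def {a b : Hemisphere d} : a ≤ b ↔ a = b ∨ a.idx < b.idx := Iff.rfl

instance : Finite (Hemisphere d) :=
  Finite.of_injective (fun a : Hemisphere d => (a.idx, a.sgn)) fun a b h => by
    obtain ⟨h1, h2⟩ := Prod.mk.inj h
    exact Hemisphere.ext h1 h2

instance : Finite (WithBot (Hemisphere d)) := inferInstanceAs (Finite (Option (Hemisphere d)))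

/-- The rank of a hemisphere, one more than its dimension. -/
def rank (q : WithBot (Hemisphere d)) : ℕ := WithBot.recBotCoe 0 (fun a => (a.idx : ℕ) + 1) q

@[simp] theorem rank_bot : rank (⊥ : WithBot (Hemisphere d)) = 0 := rfl

@[simp] theorem rank_coe (a : Hemisphere d) : rank (a : WithBot (Hemisphere d)) = a.idx + 1 := rfl

/-- A hemisphere, as a cell. -/
abbrev cell (i : ℕ) (h : i < d) (s : Bool) : WithBot (Hemisphere d) :=
  ((⟨⟨i, h⟩, s⟩ : Hemisphere d) : WithBot (Hemisphere d))

variable (d) in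
/-- The generating cycle among the cells of rank `j`. -/
noncomputable def fundamental : ℕ → Chain (WithBot (Hemisphere d))
  | 0 => gen ⊥
  | i + 1 => if h : i < d then gen (cell i h true) +
      gen (cell i h false) else 0

/-- The boundary of a hemisphere is the fundamental cycle of its rim. -/
noncomputable def boundary :
    Chain (WithBot (Hemisphere d)) →ₗ[ZMod 2] Chain (WithBot (Hemisphere d)) :=
  Finsupp.linearCombination (ZMod 2) fun q =>
    WithBot.recBotCoe (C := fun _ => Chain (WithBot (Hemisphere d))) 0
      (fun a => fundamental d a.idx) q

theorem boundary_bot : boundary (gen (⊥ : WithBot (Hemisphere d))) = 0 := by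
  simp [boundary, gen]

theorem boundary_coe (a : Hemisphere d) :
    boundary (gen (a : WithBot (Hemisphere d))) = fundamental d a.idx := by
  simp [boundary, gen]

theorem fundamental_succ {i : ℕ} (h : i < d) : fundamental d (i + 1) =
    gen (cell i h true) + gen (cell i h false) := dif_pos h

theorem boundary_fundamental (i : ℕ) : boundary (fundamental d i) = 0 := by
  rcases i with _ | i
  · exact boundary_bot
  · by_cases h : i < d
    · rw [fundamental_succ h, map_add, boundary_coe, boundary_coe, ZModModule.add_self]
    · rw [fundamental, dif_neg h, map_zero]

theorem fundamental_apply {i : ℕ} (h : i < d) (s : Bool) :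
    fundamental d (i + 1) (cell i h s) = 1 := by
  rw [fundamental_succ h]
  cases s <;> simp [gen]

theorem fundamental_ne_zero {i : ℕ} (h : i ≤ d) : fundamental d i ≠ 0 := by
  rcases i with _ | i
  · simp [fundamental, gen]
  · intro h0
    have := fundamental_apply h true
    rw [h0] at this
    simp at this

theorem fundamental_mem (i : ℕ) : fundamental d i ∈ spanOn {q | rank q = i} := by
  rcases i with _ | i
  · exact gen_mem_spanOn rfl
  · by_cases h : i < d
    · rw [fundamental_succ h]
      exact Submodule.add_mem _ (gen_mem_spanOn rfl) (gen_mem_spanOn rfl)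
    · rw [fundamental, dif_neg h]
      exact Submodule.zero_mem _

theorem eq_of_rank_succ {i : ℕ} {q : WithBot (Hemisphere d)} (hq : rank q = i + 1) :
    ∃ (h : i < d) (s : Bool), q = (cell i h s) := by
  induction q using WithBot.recBotCoe with
  | bot => simp at hq
  | coe a =>
    rw [rank_coe] at hq
    have h : i < d := by have := a.idx.2; omega
    refine ⟨h, a.sgn, ?_⟩
    congr 1
    exact Hemisphere.ext (Fin.ext (by simp; omega)) rfl

theorem eq_bot_of_rank {q : WithBot (Hemisphere d)} (hq : rank q = 0) : q = ⊥ := by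
  induction q using WithBot.recBotCoe with
  | bot => rfl
  | coe a => simp at hq

/-- The cycles of the hemispherical complex. -/
theorem eq_zero_or_fundamental {i : ℕ} {x : Chain (WithBot (Hemisphere d))}
    (hx : x ∈ spanOn {q | rank q = i}) (hx0 : boundary x = 0) : x = 0 ∨ x = fundamental d i := by
  have hxs : ∀ q, rank q ≠ i → x q = 0 := fun q hq =>
    Finsupp.notMem_support_iff.mp fun h => hq ((Finsupp.mem_supported _ _).mp hx h)
  have h2 : ∀ c : ZMod 2, c = 0 ∨ c = 1 := by decide
  rcases i with _ | i
  · have hx1 : x = x ⊥ • gen ⊥ := by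
      ext q
      by_cases hq : q = ⊥
      · subst hq
        simp [gen]
      · rw [hxs q fun h => hq (eq_bot_of_rank h)]
        simp [gen, Ne.symm hq]
    rcases h2 (x ⊥) with h | h
    · left
      rw [hx1, h, zero_smul]
    · right
      rw [hx1, h, one_smul]
      rfl
  · by_cases hi : i < d
    · set a : WithBot (Hemisphere d) := (cell i hi true) with ha
      set b : WithBot (Hemisphere d) := (cell i hi false) with hb
      have hab : a ≠ b := by simp [ha, hb]
      have hx1 : x = x a • gen a + x b • gen b := by
        ext q
        by_cases hq : rank q = i + 1
        · obtain ⟨_, s, rfl⟩ := eq_of_rank_succ hq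
          cases s
          · change x b = (x a • gen a + x b • gen b) b
            simp [gen, hab]
          · change x a = (x a • gen a + x b • gen b) a
            simp [gen, hab.symm]
        · have h1 : a ≠ q := fun h => hq (by rw [← h]; rfl)
          have h2 : b ≠ q := fun h => hq (by rw [← h]; rfl)
          rw [hxs q hq]
          simp [gen, h1, h2]
      have h3 : x a = x b := by
        rw [hx1, map_add, map_smul, map_smul, ha, hb, boundary_coe, boundary_coe, ← add_smul,
          smul_eq_zero] at hx0
        exact add_eq_zero_iff_eq_mod_two.mp (hx0.resolve_right (fundamental_ne_zero hi.le))
      rw [← h3] at hx1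
      rcases h2 (x a) with h | h
      · left
        rw [hx1, h, zero_smul, zero_smul, add_zero]
      · right
        rw [hx1, h, one_smul, one_smul, fundamental_succ hi]
    · left
      ext q
      rw [hxs q fun hq => hi (eq_of_rank_succ hq).1]
      rfl

variable (d) in
/-- The hemispherical complex. -/
noncomputable def cellStructure : CellStructure (WithBot (Hemisphere d)) where
  rk := rank
  bd := boundary
  rk_bot := rfl
  rk_strictMono := by
    intro q q' h
    induction q' using WithBot.recBotCoe with
    | bot => exact absurd h not_lt_bot
    | coe b =>
      induction q using WithBot.recBotCoe with
      | bot => simp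
      | coe a =>
        have h1 := WithBot.coe_lt_coe.mp h
        rcases le_def.mp h1.le with h2 | h2
        · exact absurd h2 h1.ne
        · simpa using h2
  bd_mem τ := by
    induction τ using WithBot.recBotCoe with
    | bot =>
      rw [boundary_bot]
      exact Submodule.zero_mem _
    | coe a =>
      rw [boundary_coe]
      refine spanOn_mono ?_ (fundamental_mem (a.idx : ℕ))
      intro q hq
      refine ⟨?_, by rw [show rank q = a.idx from hq, rank_coe]⟩
      induction q using WithBot.recBotCoe with
      | bot => exact bot_le
      | coe b =>
        refine WithBot.coe_le_coe.mpr (Or.inr ?_)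
        have : (b.idx : ℕ) + 1 = a.idx := hq
        exact Fin.lt_def.mpr (by omega)
  bd_bd x := by
    have : boundary ∘ₗ boundary = (0 : Chain (WithBot (Hemisphere d)) →ₗ[ZMod 2] _) := by
      refine chain_hom_ext fun τ => ?_
      rw [LinearMap.comp_apply, LinearMap.zero_apply]
      induction τ using WithBot.recBotCoe with
      | bot => rw [boundary_bot, map_zero]
      | coe a => rw [boundary_coe, boundary_fundamental]
    exact LinearMap.congr_fun this x
  acyclic τ hτ k x hx hx0 := by
    obtain ⟨a, rfl⟩ := WithBot.ne_bot_iff_exists.mp hτ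
    have hx' : x ∈ spanOn {q : WithBot (Hemisphere d) | rank q = k} := by
      refine spanOn_mono ?_ hx
      exact fun q hq => hq.2
    rcases eq_zero_or_fundamental hx' hx0 with rfl | rfl
    · exact ⟨0, Submodule.zero_mem _, map_zero _⟩
    -- A fundamental cycle of rank `k` bounds a hemisphere with index `k`; the sign of `a` is chosen
    -- so that for `k = a.idx` this is `a` itself.
    · by_cases hk : k ≤ a.idx
      · have hkd : k < d := by have := a.idx.2; omega
        refine ⟨gen (cell k hkd a.sgn), gen_mem_spanOn ⟨?_, rfl⟩, boundary_coe _⟩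
        refine WithBot.coe_le_coe.mpr ?_
        rcases eq_or_lt_of_le hk with h | h
        · exact Or.inl (Hemisphere.ext (Fin.ext h) rfl)
        · exact Or.inr (Fin.lt_def.mpr h)
      · obtain ⟨i, rfl⟩ : ∃ i, k = i + 1 := ⟨k - 1, by omega⟩
        by_cases hi : i < d
        · exfalso
          -- From index `a.idx` on, the fundamental cycle contains a hemisphere of opposite sign,
          -- which is not a face of `a`.
          have h1 : cell i hi (!a.sgn) ∈
              (fundamental d (i + 1)).support := by
            rw [Finsupp.mem_support_iff, fundamental_apply]
            exact one_ne_zero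
          have h2 := ((Finsupp.mem_supported _ _).mp hx h1).1
          rcases le_def.mp (WithBot.coe_le_coe.mp h2) with h | h
          · have := congrArg Hemisphere.sgn h
            simp at this
          · have := Fin.lt_def.mp h
            simp at this
            omega
        · exact ⟨0, Submodule.zero_mem _, by rw [map_zero, fundamental, dif_neg hi]⟩

/-- The sign of a hemisphere. -/
def sign (a : Hemisphere d) : ℝ := if a.sgn then 1 else -1

theorem sign_mul_self (a : Hemisphere d) : sign a * sign a = 1 := by
  unfold sign
  split_ifs <;> norm_num

theorem abs_sign (a : Hemisphere d) : |sign a| = 1 := by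
  unfold sign
  split_ifs <;> norm_num

/-- A closed hemisphere, as a subset of the unit sphere. -/
def closedCell (a : Hemisphere d) : Set (Metric.sphere (0 : Fin d → ℝ) 1) :=
  {x | (∀ j, a.idx < j → x.1 j = 0) ∧ 0 ≤ sign a * x.1 a.idx}

theorem isClosed_closedCell (a : Hemisphere d) : IsClosed (closedCell a) := by
  have h1 : ∀ j, Continuous fun x : Metric.sphere (0 : Fin d → ℝ) 1 => x.1 j :=
    fun j => (continuous_apply j).comp continuous_subtype_val
  have h2 : closedCell a = (⋂ j, ⋂ _ : a.idx < j, {x | x.1 j = 0}) ∩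
      {x | 0 ≤ sign a * x.1 a.idx} := by
    ext x
    simp [closedCell]
  rw [h2]
  refine IsClosed.inter ?_ (isClosed_le continuous_const (continuous_const.mul (h1 _)))
  exact isClosed_iInter fun j => isClosed_iInter fun _ => isClosed_eq (h1 j) continuous_const

theorem norm_coord_le (x : Metric.sphere (0 : Fin d → ℝ) 1) (j : Fin d) : |x.1 j| ≤ 1 := by
  have h1 := norm_le_pi_norm x.1 j
  have h2 : ‖x.1‖ = 1 := mem_sphere_zero_iff_norm.mp x.2
  rwa [h2] at h1

/-- The norm is the supremum norm, so the unit sphere is the boundary of a cube: some coordinate has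
absolute value 1. -/
theorem exists_norm_coord_eq (x : Metric.sphere (0 : Fin d → ℝ) 1) : ∃ j, |x.1 j| = 1 := by
  by_contra! h
  have h2 : ‖x.1‖ = 1 := mem_sphere_zero_iff_norm.mp x.2
  have h3 : ‖x.1‖ < 1 := (pi_norm_lt_iff one_pos).mpr fun j =>
    lt_of_le_of_ne (norm_coord_le x j) (h j)
  exact absurd h2 h3.ne

theorem mem_sphere_of_coord {x : Fin d → ℝ} (h1 : ∀ j, |x j| ≤ 1) (h2 : ∃ j, |x j| = 1) :
    x ∈ Metric.sphere (0 : Fin d → ℝ) 1 := by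
  rw [mem_sphere_zero_iff_norm]
  refine le_antisymm ((pi_norm_le_iff_of_nonneg zero_le_one).mpr h1) ?_
  obtain ⟨j, hj⟩ := h2
  rw [← hj]
  exact norm_le_pi_norm x j

/-- The contraction of a closed hemisphere to its pole. -/
noncomputable def contraction (a : Hemisphere d) (t : ℝ) (x : Fin d → ℝ) (j : Fin d) : ℝ :=
  if j = a.idx then sign a * max (sign a * x j) (min 1 (2 * t)) else x j * min 1 (2 - 2 * t)

theorem continuous_contraction (a : Hemisphere d) :
    Continuous fun y : ℝ × (Fin d → ℝ) => contraction a y.1 y.2 := by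
  refine continuous_pi fun j => ?_
  unfold contraction
  have h1 : Continuous fun y : ℝ × (Fin d → ℝ) => y.2 j := (continuous_apply j).comp continuous_snd
  split_ifs
  · exact continuous_const.mul ((continuous_const.mul h1).max
      (continuous_const.min (continuous_const.mul continuous_fst)))
  · exact h1.mul (continuous_const.min (continuous_const.sub (continuous_const.mul continuous_fst)))

/-- In the first half of the time the polar coordinate rises to absolute value 1 while the others
rest; in the second half the others shrink to 0. At every moment some coordinate has absolute value
1, so the path stays on the boundary of the cube. -/
theorem contraction_mem (a : Hemisphere d) {t : ℝ} (ht : t ∈ Set.Icc (0 : ℝ) 1)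
    {x : Metric.sphere (0 : Fin d → ℝ) 1} (hx : x ∈ closedCell a) :
    ∃ h : contraction a t x.1 ∈ Metric.sphere (0 : Fin d → ℝ) 1,
      (⟨contraction a t x.1, h⟩ : Metric.sphere (0 : Fin d → ℝ) 1) ∈ closedCell a := by
  obtain ⟨ht0, ht1⟩ := ht
  have hk : contraction a t x.1 a.idx =
      sign a * max (sign a * x.1 a.idx) (min 1 (2 * t)) := if_pos rfl
  have hj : ∀ j, j ≠ a.idx → contraction a t x.1 j = x.1 j * min 1 (2 - 2 * t) :=
    fun j h => if_neg h
  have hle : sign a * x.1 a.idx ≤ 1 := by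
    have h1 := norm_coord_le x a.idx
    refine (le_abs_self _).trans ?_
    rwa [abs_mul, abs_sign, one_mul]
  have hmax0 : 0 ≤ max (sign a * x.1 a.idx) (min 1 (2 * t)) := le_max_of_le_left hx.2
  have hmax1 : max (sign a * x.1 a.idx) (min 1 (2 * t)) ≤ 1 := max_le hle (min_le_left _ _)
  have hmin0 : 0 ≤ min 1 (2 - 2 * t) := le_min zero_le_one (by linarith)
  refine ⟨mem_sphere_of_coord (fun j => ?_) ?_, fun j h => ?_, ?_⟩
  · rcases eq_or_ne j a.idx with rfl | h
    · rw [hk, abs_mul, abs_sign, one_mul, abs_of_nonneg hmax0]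
      exact hmax1
    · rw [hj j h, abs_mul, abs_of_nonneg hmin0]
      exact mul_le_one₀ (norm_coord_le x j) hmin0 (min_le_left _ _)
  · by_cases ht2 : 1 ≤ 2 * t
    · refine ⟨a.idx, ?_⟩
      rw [hk, abs_mul, abs_sign, one_mul, min_eq_left ht2, max_eq_right hle, abs_one]
    · obtain ⟨j, hj1⟩ := exists_norm_coord_eq x
      refine ⟨j, ?_⟩
      rcases eq_or_ne j a.idx with rfl | h
      · have h3 : sign a * x.1 a.idx = 1 := by
          rw [← abs_of_nonneg hx.2, abs_mul, abs_sign, one_mul, hj1]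
        rw [hk, abs_mul, abs_sign, one_mul, h3, max_eq_left (min_le_left _ _), abs_one]
      · rw [hj j h, min_eq_left (by linarith), mul_one, hj1]
  · dsimp only
    rw [hj j h.ne', hx.1 j h, zero_mul]
  · dsimp only
    rw [hk, ← mul_assoc, sign_mul_self, one_mul]
    exact hmax0

theorem contractibleSpace_closedCell (a : Hemisphere d) : ContractibleSpace (closedCell a) := by
  have hpole0 : ∀ j, (Pi.single a.idx (sign a) : Fin d → ℝ) j =
      if j = a.idx then sign a else 0 := fun j => by rw [Pi.single_apply]
  have hpole : (Pi.single a.idx (sign a) : Fin d → ℝ) ∈ Metric.sphere (0 : Fin d → ℝ) 1 := by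
    refine mem_sphere_of_coord (fun j => ?_) ⟨a.idx, ?_⟩
    · rw [hpole0]
      split_ifs
      · exact (abs_sign a).le
      · simp
    · rw [hpole0, if_pos rfl, abs_sign]
  have hpole' : (⟨_, hpole⟩ : Metric.sphere (0 : Fin d → ℝ) 1) ∈ closedCell a := by
    refine ⟨fun j h => ?_, ?_⟩
    · dsimp only
      rw [hpole0, if_neg h.ne']
    · dsimp only
      rw [hpole0, if_pos rfl, sign_mul_self]
      exact zero_le_one
  rw [contractible_iff_id_nullhomotopic]
  refine ⟨⟨_, hpole'⟩, ⟨⟨⟨fun y => ⟨⟨contraction a y.1 y.2.1.1, (contraction_mem a y.1.2 y.2.2).1⟩,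
    (contraction_mem a y.1.2 y.2.2).2⟩, ?_⟩, ?_, ?_⟩⟩⟩
  · refine Continuous.subtype_mk (Continuous.subtype_mk ?_ _) _
    exact (continuous_contraction a).comp ((continuous_subtype_val.comp continuous_fst).prodMk
      (continuous_subtype_val.comp (continuous_subtype_val.comp continuous_snd)))
  · intro x
    refine Subtype.ext (Subtype.ext (funext fun j => ?_))
    change contraction a (0 : ℝ) x.1.1 j = x.1.1 j
    unfold contraction
    split_ifs with h
    · subst h
      rw [mul_zero, min_eq_right zero_le_one, max_eq_left x.2.2, ← mul_assoc, sign_mul_self, one_mul]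
    · norm_num
  · intro x
    refine Subtype.ext (Subtype.ext (funext fun j => ?_))
    change contraction a (1 : ℝ) x.1.1 j = (Pi.single a.idx (sign a) : Fin d → ℝ) j
    rw [hpole0]
    unfold contraction
    split_ifs with h
    · subst h
      have hle : sign a * x.1.1 a.idx ≤ 1 := by
        refine (le_abs_self _).trans ?_
        rw [abs_mul, abs_sign, one_mul]
        exact norm_coord_le x.1 a.idx
      rw [min_eq_left (by norm_num), max_eq_right hle, mul_one]
    · norm_num

variable (d) in
/-- The closed hemispheres, together with the empty cell. -/
def closedCells (q : WithBot (Hemisphere d)) : Set (Metric.sphere (0 : Fin d → ℝ) 1) :=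
  WithBot.recBotCoe (C := fun _ => Set (Metric.sphere (0 : Fin d → ℝ) 1)) ∅ closedCell q

/-- Every point lies in a smallest closed hemisphere. -/
theorem exists_least (x : Metric.sphere (0 : Fin d → ℝ) 1) :
    ∃ a : Hemisphere d, x ∈ closedCell a ∧ ∀ b, x ∈ closedCell b → a ≤ b := by
  classical
  obtain ⟨j0, hj0⟩ := exists_norm_coord_eq x
  let s : Finset (Fin d) := Finset.univ.filter fun j => x.1 j ≠ 0
  have hs : s.Nonempty := ⟨j0, by
    rw [Finset.mem_filter]
    refine ⟨Finset.mem_univ _, fun h => ?_⟩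
    rw [h, abs_zero] at hj0
    exact zero_ne_one hj0⟩
  have hk : x.1 (s.max' hs) ≠ 0 := (Finset.mem_filter.mp (s.max'_mem hs)).2
  have hgt : ∀ j, s.max' hs < j → x.1 j = 0 := fun j hj => by
    by_contra h
    exact absurd (s.le_max' j (Finset.mem_filter.mpr ⟨Finset.mem_univ _, h⟩)) (not_le.mpr hj)
  refine ⟨⟨s.max' hs, decide (0 < x.1 (s.max' hs))⟩, ⟨hgt, ?_⟩, fun b hb => ?_⟩
  · unfold sign
    by_cases h : 0 < x.1 (s.max' hs)
    · simpa [h] using h.le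
    · simpa [h] using not_lt.mp h
  · rcases lt_trichotomy (s.max' hs) b.idx with h | h | h
    · exact Or.inr h
    · left
      refine Hemisphere.ext h ?_
      have h2 := hb.2
      rw [← h] at h2
      unfold sign at h2
      cases hbs : b.sgn
      · rw [hbs] at h2
        simpa using h2
      · rw [hbs] at h2
        simp only [if_true, one_mul] at h2
        simpa using lt_of_le_of_ne h2 hk.symm
    · exact absurd (hb.1 _ h) hk

theorem isCover : (cellStructure d).IsCover (closedCells d) where
  closed τ := by
    induction τ using WithBot.recBotCoe with
    | bot => exact isClosed_empty
    | coe a => exact isClosed_closedCell a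
  mono := by
    intro τ τ' h
    induction τ using WithBot.recBotCoe with
    | bot => exact Set.empty_subset _
    | coe a =>
      induction τ' using WithBot.recBotCoe with
      | bot => simp at h
      | coe b =>
        rcases le_def.mp (WithBot.coe_le_coe.mp h) with rfl | h
        · exact le_rfl
        · intro x hx
          refine ⟨fun j hj => hx.1 j (h.trans hj), ?_⟩
          rw [hx.1 _ h, mul_zero]
  bot := rfl
  inter τ τ' x h1 h2 := by
    obtain ⟨a, ha, hmin⟩ := exists_least x
    refine ⟨a, ?_, ?_, ha⟩
    · induction τ using WithBot.recBotCoe with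
      | bot => exact absurd h1 (Set.notMem_empty x)
      | coe b => exact WithBot.coe_le_coe.mpr (hmin b h1)
    · induction τ' using WithBot.recBotCoe with
      | bot => exact absurd h2 (Set.notMem_empty x)
      | coe b => exact WithBot.coe_le_coe.mpr (hmin b h2)
  cover x := by
    obtain ⟨a, ha, -⟩ := exists_least x
    exact ⟨a, ha⟩
  acyclic τ hτ := by
    obtain ⟨a, rfl⟩ := WithBot.ne_bot_iff_exists.mp hτ
    have := contractibleSpace_closedCell a
    change SmallAcyclic (closedCell a)
    exact smallAcyclic_of_contractible (isClosed_closedCell a).isCompact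

end Hemisphere

theorem smallAcyclic_closedBall (d : ℕ) :
    SmallAcyclic (Set.univ : Set (Metric.closedBall (0 : Fin d → ℝ) 1)) := by
  have h1 : ContractibleSpace (Metric.closedBall (0 : Fin d → ℝ) 1) :=
    (convex_closedBall (0 : Fin d → ℝ) 1).contractibleSpace
      (Metric.nonempty_closedBall.mpr zero_le_one)
  have h2 : ContractibleSpace (Set.univ : Set (Metric.closedBall (0 : Fin d → ℝ) 1)) :=
    (Homeomorph.Set.univ _).contractibleSpace
  exact smallAcyclic_of_contractible isCompact_univ

/-- The unit sphere is not a retract of the unit ball. -/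
theorem not_exists_retraction (d : ℕ) (r : (Fin d → ℝ) → (Fin d → ℝ))
    (hr : ContinuousOn r (Metric.closedBall 0 1))
    (hmem : ∀ x ∈ Metric.closedBall (0 : Fin d → ℝ) 1, r x ∈ Metric.sphere (0 : Fin d → ℝ) 1)
    (hid : ∀ x ∈ Metric.sphere (0 : Fin d → ℝ) 1, r x = x) : False := by
  obtain ⟨w, hw, hwz⟩ := Hemisphere.isCover.exists_of_retract (smallAcyclic_closedBall d)
    (i := fun x => ⟨x.1, Metric.sphere_subset_closedBall x.2⟩) (r := fun x => ⟨r x.1, hmem x.1 x.2⟩)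
    (continuous_subtype_val.subtype_mk _)
    ((continuousOn_iff_continuous_domRestrict.mp hr).subtype_mk _)
    (fun x => Subtype.ext (hid x.1 x.2)) d (Hemisphere.fundamental d d)
    (Hemisphere.fundamental_mem d) (Hemisphere.boundary_fundamental d)
  -- There are no cells of rank `d + 1`, so the nonzero top cycle of the sphere cannot bound.
  have hw0 : w = 0 := by
    ext q
    by_contra h
    have h1 : Hemisphere.rank q = d + 1 :=
      (Finsupp.mem_supported _ _).mp hw (Finsupp.mem_support_iff.mpr h)
    exact absurd (Hemisphere.eq_of_rank_succ h1).1 (lt_irrefl _)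
  rw [hw0, map_zero] at hwz
  exact Hemisphere.fundamental_ne_zero le_rfl hwz.symm

end Hemispheres

/-! ### Invariance of domain, from the no-retraction theorem. -/

section InvarianceOfDomain

variable {d : ℕ}

/-- A continuous map of the unit ball to itself that is close to the identity has a zero. -/
theorem exists_zero_of_near_id {g : (Fin d → ℝ) → (Fin d → ℝ)}
    (hg : ContinuousOn g (Metric.closedBall 0 1))
    (hnear : ∀ x ∈ Metric.closedBall (0 : Fin d → ℝ) 1, ‖g x - x‖ ≤ 1 / 2) :
    ∃ x ∈ Metric.closedBall (0 : Fin d → ℝ) 1, g x = 0 := by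
  by_contra! hne
  -- The weight is 0 up to radius 3/4 and 1 on the sphere, so `R` passes from `g` to the identity.
  -- Where the weight is positive, `R x` differs from `x` by at most 1/2 and cannot vanish;
  -- normalizing `R` would give a retraction.
  let w : (Fin d → ℝ) → ℝ := fun x => max 0 (4 * ‖x‖ - 3)
  have hw : Continuous w := continuous_const.max ((continuous_const.mul continuous_norm).sub
    continuous_const)
  let R : (Fin d → ℝ) → (Fin d → ℝ) := fun x => (1 - w x) • g x + w x • x
  have hR : ContinuousOn R (Metric.closedBall 0 1) :=
    ((continuous_const.sub hw).continuousOn.smul hg).add (hw.smul continuous_id).continuousOn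
  have hR0 : ∀ x ∈ Metric.closedBall (0 : Fin d → ℝ) 1, R x ≠ 0 := by
    intro x hx h0
    have hx1 : ‖x‖ ≤ 1 := by simpa using hx
    by_cases h : 4 * ‖x‖ - 3 ≤ 0
    · have : w x = 0 := max_eq_left h
      simp only [R, this, sub_zero, one_smul, zero_smul, add_zero] at h0
      exact hne x hx h0
    · push Not at h
      have hwx : w x = 4 * ‖x‖ - 3 := max_eq_right h.le
      have h1 : R x - x = (1 - w x) • (g x - x) := by
        simp only [R]
        module
      have h2 : ‖R x - x‖ ≤ 1 / 2 := by
        rw [h1, norm_smul, Real.norm_eq_abs, abs_of_nonneg (by rw [hwx]; linarith)]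
        have h3 := hnear x hx
        have h4 := norm_nonneg (g x - x)
        have h5 : 1 - w x ≤ 1 := by rw [hwx]; linarith
        have h6 : 0 ≤ 1 - w x := by rw [hwx]; linarith
        nlinarith
      rw [h0, zero_sub, norm_neg] at h2
      linarith
  refine not_exists_retraction d (fun x => ‖R x‖⁻¹ • R x) ?_ ?_ ?_
  · exact (hR.norm.inv₀ fun x hx => norm_ne_zero_iff.mpr (hR0 x hx)).smul hR
  · intro x hx
    rw [mem_sphere_zero_iff_norm, norm_smul, norm_inv, norm_norm]
    exact inv_mul_cancel₀ (norm_ne_zero_iff.mpr (hR0 x hx))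
  · intro x hx
    have hx1 : ‖x‖ = 1 := mem_sphere_zero_iff_norm.mp hx
    have : R x = x := by
      have : w x = 1 := by
        simp only [w, hx1]
        norm_num
      simp [R, this]
    rw [this, hx1, inv_one, one_smul]

-- Uniform continuity of `G` around the compact set gives one radius on which smoothing changes `G`
-- by at most `δ`.
open scoped ContDiff Topology in
theorem exists_contDiff_near {G : (Fin d → ℝ) → (Fin d → ℝ)} (hG : Continuous G)
    {C : Set (Fin d → ℝ)} (hC : IsCompact C) {δ : ℝ} (hδ : 0 < δ) :
    ∃ P : (Fin d → ℝ) → (Fin d → ℝ), ContDiff ℝ ∞ P ∧ ∀ y ∈ C, ‖P y - G y‖ ≤ δ := by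
  have h1 := hC.uniformContinuousAt_of_continuousAt G (fun a _ => hG.continuousAt)
    (Metric.dist_mem_uniformity hδ)
  obtain ⟨ε, hε, h2⟩ := Metric.mem_uniformity_dist.mp h1
  obtain ⟨P, hP, h3⟩ := hG.exists_contDiff_dist_le_of_forall_mem_ball_dist_le hε
  refine ⟨P, hP, fun y hy => ?_⟩
  rw [← dist_eq_norm]
  refine h3 y δ fun x hx => ?_
  have h4 : (y, x) ∈ {x : (Fin d → ℝ) × (Fin d → ℝ) | x.1 ∈ C → (G x.1, G x.2) ∈
      {p : (Fin d → ℝ) × (Fin d → ℝ) | dist p.1 p.2 < δ}} := h2 (by rwa [dist_comm])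
  have h5 := h4 hy
  rw [dist_comm]
  exact le_of_lt h5

-- A smooth map sends the sphere, a null set, to a null set, which cannot contain a ball.
open scoped ContDiff in
theorem exists_small_notMem_image {P : (Fin d → ℝ) → (Fin d → ℝ)} (hP : ContDiff ℝ ∞ P)
    (c : Fin d → ℝ) {ε δ : ℝ} (hε : 0 < ε) (hδ : 0 < δ) :
    ∃ b : Fin d → ℝ, ‖b‖ < δ ∧ b ∉ P '' Metric.sphere c ε := by
  by_contra! h
  have h1 : MeasureTheory.volume (P '' Metric.sphere c ε) = 0 :=
    MeasureTheory.addHaar_image_eq_zero_of_differentiableOn_of_addHaar_eq_zero _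
      (hP.differentiable (by simp)).differentiableOn
      (MeasureTheory.Measure.addHaar_sphere_of_ne_zero _ _ hε.ne')
  have h2 : Metric.ball (0 : Fin d → ℝ) δ ⊆ P '' Metric.sphere c ε :=
    fun b hb => h b (mem_ball_zero_iff.mp hb)
  exact absurd (MeasureTheory.measure_mono_null h2 h1)
    (Metric.measure_ball_pos _ _ hδ).ne'

/-- The image of the centre is an interior point of the image of the ball under an injective
continuous map. -/
theorem mem_interior_image_closedBall {f : (Fin d → ℝ) → (Fin d → ℝ)}
    (hf : ContinuousOn f (Metric.closedBall 0 1)) (hinj : Set.InjOn f (Metric.closedBall 0 1)) :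
    f 0 ∈ interior (f '' Metric.closedBall 0 1) := by
  by_contra hnot
  set B := Metric.closedBall (0 : Fin d → ℝ) 1 with hB
  have hBc : IsCompact B := isCompact_closedBall _ _
  set K := f '' B with hK
  have hKc : IsCompact K := hBc.image_of_continuousOn hf
  have h0B : (0 : Fin d → ℝ) ∈ B := Metric.mem_closedBall_self zero_le_one
  -- `f` embeds the compact ball, and its inverse extends to the whole space by Tietze's theorem.
  obtain ⟨G, hGf⟩ : ∃ G : C(Fin d → ℝ, Fin d → ℝ), ∀ x ∈ B, G (f x) = x := by
    have : CompactSpace B := isCompact_iff_compactSpace.mp hBc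
    have he : Topology.IsClosedEmbedding (B.domRestrict f) :=
      (continuousOn_iff_continuous_domRestrict.mp hf).isClosedEmbedding
        (Set.injOn_iff_injective.mp hinj)
    obtain ⟨G, hG⟩ := (⟨Subtype.val, continuous_subtype_val⟩ :
      C(B, Fin d → ℝ)).exists_extension' he
    exact ⟨G, fun x hx => congrFun hG ⟨x, hx⟩⟩
  have hGc := G.continuous
  obtain ⟨ε0, hε0, hGε0⟩ := Metric.continuousAt_iff.mp (hGc.continuousAt (x := f 0)) (1 / 10)
    (by norm_num)
  obtain ⟨ε, hε, hε2⟩ : ∃ ε > 0, 2 * ε < ε0 := ⟨ε0 / 3, by positivity, by linarith⟩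
  have hGε : ∀ y, dist y (f 0) ≤ 2 * ε → ‖G y‖ ≤ 1 / 10 := fun y hy => by
    have := hGε0 (lt_of_le_of_lt hy hε2)
    rw [hGf 0 h0B, dist_zero_right] at this
    exact this.le
  -- As `f 0` is not interior to `K`, there are points outside `K` arbitrarily near it.
  obtain ⟨c, hcK, hc⟩ : ∃ c, c ∉ K ∧ dist c (f 0) < ε := by
    by_contra! h
    refine hnot (mem_interior_iff_mem_nhds.mpr (Metric.mem_nhds_iff.mpr ⟨ε, hε, fun c hc => ?_⟩))
    by_contra hcK
    exact absurd hc (not_lt.mpr (h c hcK))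
  -- The only zero of `G` on `K` is `f 0`, which is within `ε` of `c`; hence `G` is bounded away
  -- from zero on `T₁`.
  set T₁ := K ∩ {y | ε ≤ dist y c} with hT₁
  have hT₁c : IsCompact T₁ :=
    hKc.inter_right (isClosed_le continuous_const (continuous_id.dist continuous_const))
  have hG1 : ∀ y ∈ T₁, 0 < ‖G y‖ := by
    rintro _ ⟨⟨x, hx, rfl⟩, h⟩
    rw [hGf x hx, norm_pos_iff]
    rintro rfl
    rw [dist_comm] at hc
    exact absurd hc (not_lt.mpr h)
  obtain ⟨δ, hδ, hδ10, hδG⟩ : ∃ δ > 0, δ ≤ 1 / 10 ∧ ∀ y ∈ T₁, δ ≤ ‖G y‖ := by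
    obtain ⟨δ, hδ, h⟩ := hT₁c.exists_forall_le' (f := fun y => ‖G y‖)
      hGc.norm.continuousOn (a := 0) hG1
    exact ⟨min δ (1 / 10), lt_min hδ (by norm_num), min_le_right _ _,
      fun y hy => (min_le_left _ _).trans (h y hy)⟩
  -- A smooth approximation `P`, translated by a small `b` avoided by `P` on the sphere around `c`.
  -- The map `P - b` is `δ`-close to `G`, and vanishes neither on `T₁` nor on this sphere.
  obtain ⟨P, hP, hPG⟩ := exists_contDiff_near hGc (hKc.union (isCompact_sphere c ε))
    (δ := δ / 3) (by positivity)
  obtain ⟨b, hb, hbP⟩ := exists_small_notMem_image hP c hε (δ := δ / 3) (by positivity)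
  have hPb : ∀ y ∈ K ∪ Metric.sphere c ε, ‖P y - b - G y‖ < δ := fun y hy => by
    have h1 := hPG y hy
    calc ‖P y - b - G y‖ = ‖(P y - G y) - b‖ := by congr 1; abel
      _ ≤ ‖P y - G y‖ + ‖b‖ := norm_sub_le _ _
      _ < δ := by linarith
  -- `Φ` pushes the part of `K` near `c` radially onto the sphere around `c` and fixes the rest; it
  -- is continuous because `c ∉ K`. Thus `P ∘ Φ ∘ f - b` has no zero, yet it is close to the
  -- identity.
  let Φ : (Fin d → ℝ) → (Fin d → ℝ) := fun y => c + max (ε / ‖y - c‖) 1 • (y - c)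
  have hne : ∀ y ∈ K, ‖y - c‖ ≠ 0 := fun y hy h => by
    rw [norm_eq_zero, sub_eq_zero] at h
    exact hcK (h ▸ hy)
  have hsub : Continuous fun y : Fin d → ℝ => y - c := continuous_id.sub continuous_const
  have hΦ : ContinuousOn Φ K :=
    continuousOn_const.add (ContinuousOn.smul (ContinuousOn.sup
      (ContinuousOn.div continuousOn_const hsub.norm.continuousOn hne) continuousOn_const)
      hsub.continuousOn)
  have hΦ1 : ∀ y ∈ K, ε ≤ dist y c → Φ y = y := fun y hy h => by
    rw [dist_eq_norm] at h
    have : ε / ‖y - c‖ ≤ 1 := (div_le_one (hε.trans_le h)).mpr h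
    simp only [Φ, max_eq_right this, one_smul, add_sub_cancel]
  have hΦ2 : ∀ y ∈ K, dist y c < ε → Φ y ∈ Metric.sphere c ε := fun y hy h => by
    rw [dist_eq_norm] at h
    have hpos : 0 < ‖y - c‖ := lt_of_le_of_ne (norm_nonneg _) (hne y hy).symm
    have : 1 ≤ ε / ‖y - c‖ := (one_le_div hpos).mpr h.le
    rw [Metric.mem_sphere, dist_eq_norm]
    simp only [Φ, max_eq_left this, add_sub_cancel_left]
    rw [norm_smul, Real.norm_eq_abs, abs_of_nonneg (by positivity), div_mul_cancel₀ _ hpos.ne']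
  have hcont : ContinuousOn (fun x => P (Φ (f x)) - b) B := by
    refine (ContinuousOn.sub ?_ continuousOn_const)
    exact hP.continuous.comp_continuousOn (hΦ.comp hf fun x hx => ⟨x, hx, rfl⟩)
  have hnear : ∀ x ∈ B, ‖P (Φ (f x)) - b - x‖ ≤ 1 / 2 := by
    intro x hx
    have hfx : f x ∈ K := ⟨x, hx, rfl⟩
    rcases le_or_gt ε (dist (f x) c) with h | h
    · rw [hΦ1 _ hfx h]
      have h1 := hPb (f x) (Or.inl hfx)
      rw [hGf x hx] at h1
      linarith
    · have h1 := hPb _ (Or.inr (hΦ2 _ hfx h))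
      have h2 : ‖G (Φ (f x))‖ ≤ 1 / 10 := hGε _ (by
        have h3 := dist_triangle (Φ (f x)) c (f 0)
        rw [Metric.mem_sphere.mp (hΦ2 _ hfx h)] at h3
        linarith)
      have h4 : ‖x‖ ≤ 1 / 10 := by
        rw [← hGf x hx]
        refine hGε _ ?_
        have h3 := dist_triangle (f x) c (f 0)
        linarith
      calc ‖P (Φ (f x)) - b - x‖
          = ‖(P (Φ (f x)) - b - G (Φ (f x))) + (G (Φ (f x)) - x)‖ := by congr 1; abel
        _ ≤ ‖P (Φ (f x)) - b - G (Φ (f x))‖ + ‖G (Φ (f x)) - x‖ := norm_add_le _ _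
        _ ≤ ‖P (Φ (f x)) - b - G (Φ (f x))‖ + (‖G (Φ (f x))‖ + ‖x‖) := by
          gcongr
          exact norm_sub_le _ _
        _ ≤ 1 / 2 := by linarith
  obtain ⟨x, hx, hx0⟩ := exists_zero_of_near_id hcont hnear
  have hfx : f x ∈ K := ⟨x, hx, rfl⟩
  rcases le_or_gt ε (dist (f x) c) with h | h
  · rw [hΦ1 _ hfx h] at hx0
    have h1 := hPb (f x) (Or.inl hfx)
    rw [hx0, zero_sub, norm_neg] at h1
    exact absurd (hδG _ ⟨hfx, h⟩) (not_le.mpr h1)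
  · exact hbP ⟨_, hΦ2 _ hfx h, sub_eq_zero.mp hx0⟩

/-- **Invariance of domain.** -/
theorem isOpen_image_of_injOn {U : Set (Fin d → ℝ)} (hU : IsOpen U) {f : (Fin d → ℝ) → (Fin d → ℝ)}
    (hf : ContinuousOn f U) (hinj : Set.InjOn f U) : IsOpen (f '' U) := by
  rw [isOpen_iff_mem_nhds]
  rintro _ ⟨x, hx, rfl⟩
  obtain ⟨ε, hε, hεU⟩ := Metric.nhds_basis_closedBall.mem_iff.mp (hU.mem_nhds hx)
  let A : (Fin d → ℝ) → (Fin d → ℝ) := fun y => x + ε • y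
  have hA : Continuous A := continuous_const.add (continuous_id.const_smul ε)
  have hAinj : Function.Injective A := fun a b h => by
    simpa [A, hε.ne'] using h
  have hAU : ∀ y ∈ Metric.closedBall (0 : Fin d → ℝ) 1, A y ∈ U := fun y hy => by
    refine hεU ?_
    rw [mem_closedBall_zero_iff] at hy
    rw [Metric.mem_closedBall, dist_eq_norm]
    simp only [A, add_sub_cancel_left, norm_smul, Real.norm_eq_abs, abs_of_pos hε]
    nlinarith
  have h := mem_interior_image_closedBall (f := f ∘ A) (hf.comp hA.continuousOn hAU)
    (hinj.comp hAinj.injOn hAU)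
  have hA0 : A 0 = x := by simp [A]
  rw [Function.comp_apply, hA0] at h
  refine Filter.mem_of_superset (mem_interior_iff_mem_nhds.mp h) ?_
  rintro _ ⟨y, hy, rfl⟩
  exact ⟨A y, hAU y hy, rfl⟩

/-- Invariance of domain for maps from the unit sphere of `ℝᵈ` to `ℝᵏ`, where `k < d`: the image of
an open set is open, and the open set is empty unless `k = d - 1`. -/
theorem isOpen_image_sphere {k : ℕ} (hk : k < d) {V : Set (Fin d → ℝ)} (hV : IsOpen V)
    {f : (Fin d → ℝ) → (Fin k → ℝ)} (hf : ContinuousOn f (V ∩ Metric.sphere 0 1))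
    (hinj : Set.InjOn f (V ∩ Metric.sphere 0 1)) :
    IsOpen (f '' (V ∩ Metric.sphere 0 1)) ∧ (k + 1 < d → V ∩ Metric.sphere 0 1 = ∅) := by
  let N : (Fin d → ℝ) → (Fin d → ℝ) := fun x => ‖x‖⁻¹ • x
  have hN : ContinuousOn N {x | x ≠ 0} :=
    (continuous_norm.continuousOn.inv₀ fun x hx => norm_ne_zero_iff.mpr hx).smul continuousOn_id
  have hNs : ∀ x, x ≠ 0 → N x ∈ Metric.sphere (0 : Fin d → ℝ) 1 := fun x hx => by
    rw [mem_sphere_zero_iff_norm, norm_smul, norm_inv, norm_norm]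
    exact inv_mul_cancel₀ (norm_ne_zero_iff.mpr hx)
  let U : Set (Fin d → ℝ) := {x | x ≠ 0} ∩ N ⁻¹' V
  have hU : IsOpen U := hN.isOpen_inter_preimage isOpen_ne hV
  have hUV : ∀ x ∈ U, N x ∈ V ∩ Metric.sphere 0 1 := fun x hx => ⟨hx.2, hNs x hx.1⟩
  have hVU : ∀ x ∈ V ∩ Metric.sphere 0 1, x ∈ U ∧ N x = x ∧ ‖x‖ = 1 := fun x hx => by
    have h1 : ‖x‖ = 1 := mem_sphere_zero_iff_norm.mp hx.2
    have h2 : N x = x := by simp only [N, h1, inv_one, one_smul]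
    refine ⟨⟨?_, ?_⟩, h2, h1⟩
    · rintro rfl
      simp at h1
    · rw [Set.mem_preimage, h2]
      exact hx.1
  let j : (Fin k → ℝ) → ℝ → (Fin d → ℝ) := fun z t i =>
    if h : (i : ℕ) < k then z ⟨i, h⟩ else if (i : ℕ) = k then t else 0
  have hj : Continuous fun y : (Fin k → ℝ) × ℝ => j y.1 y.2 := by
    refine continuous_pi fun i => ?_
    simp only [j]
    split_ifs
    · exact (continuous_apply _).comp continuous_fst
    · exact continuous_snd
    · exact continuous_const
  have hjinj : ∀ z t z' t', j z t = j z' t' → z = z' ∧ t = t' := by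
    intro z t z' t' h
    constructor
    · funext i
      have := congrFun h ⟨i, i.2.trans hk⟩
      simpa [j] using this
    · have := congrFun h ⟨k, hk⟩
      simpa [j] using this
  -- Polar coordinates: the direction goes through `f`, the radius becomes coordinate `k`, and the
  -- remaining coordinates are zero. This is injective on an open set of full dimension.
  let F : (Fin d → ℝ) → (Fin d → ℝ) := fun x => j (f (N x)) ‖x‖
  have hO : IsOpen (F '' U) := by
    refine isOpen_image_of_injOn hU ?_ ?_
    · exact hj.comp_continuousOn ((hf.comp (hN.mono fun x hx => hx.1) hUV).prodMk
        continuous_norm.continuousOn)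
    · intro x hx y hy hxy
      obtain ⟨h1, h2⟩ := hjinj _ _ _ _ hxy
      have h3 := hinj (hUV x hx) (hUV y hy) h1
      have h4 : ‖x‖ • N x = ‖y‖ • N y := by rw [h2, h3]
      simp only [N, smul_smul] at h4
      rwa [mul_inv_cancel₀ (norm_ne_zero_iff.mpr hx.1), mul_inv_cancel₀ (norm_ne_zero_iff.mpr hy.1),
        one_smul, one_smul] at h4
  constructor
  · have : f '' (V ∩ Metric.sphere 0 1) = (fun z => j z 1) ⁻¹' (F '' U) := by
      ext z
      constructor
      · rintro ⟨x, hx, rfl⟩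
        obtain ⟨h1, h2, h3⟩ := hVU x hx
        exact ⟨x, h1, by simp only [F, h2, h3]⟩
      · rintro ⟨x, hx, hxz⟩
        exact ⟨N x, hUV x hx, (hjinj _ _ _ _ hxz).1⟩
    rw [this]
    exact hO.preimage (hj.comp (continuous_id.prodMk continuous_const))
  · intro hkd
    rw [Set.eq_empty_iff_forall_notMem]
    intro x hx
    obtain ⟨h1, h2, h3⟩ := hVU x hx
    have h4 : F x ∈ F '' U := ⟨x, h1, rfl⟩
    obtain ⟨ε, hε, hεO⟩ := Metric.isOpen_iff.mp hO (F x) h4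
    -- Coordinate `k + 1` is zero on the image, so a nonempty image could not be open.
    have h5 : F x + Pi.single ⟨k + 1, hkd⟩ (ε / 2) ∈ F '' U := by
      refine hεO ?_
      rw [Metric.mem_ball, dist_eq_norm, add_sub_cancel_left, Pi.norm_single, Real.norm_eq_abs,
        abs_of_pos (by positivity)]
      linarith
    obtain ⟨y, -, hy⟩ := h5
    have h6 := congrFun hy ⟨k + 1, hkd⟩
    simp [F, j] at h6
    linarith

end InvarianceOfDomain

/-! ### Faces and boundaries in regular CW complexes. -/

section RegularCells

open Topology

variable {X : Type*} [TopologicalSpace X] [Topology.CWComplex (Set.univ : Set X)]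

namespace Face

/-- The open cell in `X`. -/
def opn (σ : Face X) : Set X := RelCWComplex.openCell σ.dim σ.cell

/-- The boundary of the cell in `X`. -/
def frontier (σ : Face X) : Set X := RelCWComplex.cellFrontier σ.dim σ.cell

/-- The characteristic map of the cell. -/
def charMap (σ : Face X) : (Fin σ.dim → ℝ) → X := RelCWComplex.map σ.dim σ.cell

theorem closed_eq (σ : Face X) : σ.closed = σ.frontier ∪ σ.opn :=
  (RelCWComplex.cellFrontier_union_openCell_eq_closedCell _ _).symm

theorem opn_subset_closed (σ : Face X) : σ.opn ⊆ σ.closed :=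
  RelCWComplex.openCell_subset_closedCell _ _

theorem frontier_subset_closed (σ : Face X) : σ.frontier ⊆ σ.closed :=
  RelCWComplex.cellFrontier_subset_closedCell _ _

theorem opn_nonempty (σ : Face X) : σ.opn.Nonempty := RelCWComplex.openCell_nonempty _ _

theorem continuousOn_charMap (σ : Face X) : ContinuousOn σ.charMap (Metric.closedBall 0 1) :=
  RelCWComplex.continuousOn _ _

theorem isClosed_closed [T2Space X] (σ : Face X) : IsClosed σ.closed :=
  RelCWComplex.isClosed_closedCell

theorem isClosed_frontier [T2Space X] (σ : Face X) : IsClosed σ.frontier :=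
  RelCWComplex.isClosed_cellFrontier

theorem exists_finite_frontier (σ : Face X) : ∃ T : Set (Face X), T.Finite ∧
    (∀ τ ∈ T, τ.dim < σ.dim) ∧ ∀ x ∈ σ.frontier, ∃ τ ∈ T, x ∈ τ.opn := by
  obtain ⟨I, hI⟩ := CWComplex.cellFrontier_subset_finite_openCell σ.dim σ.cell
  refine ⟨⋃ m ∈ Finset.range σ.dim, (fun j => (⟨m, j⟩ : Face X)) '' (I m : Set _), ?_, ?_, ?_⟩
  · exact Set.Finite.biUnion (Finset.finite_toSet _) fun m _ => (Finset.finite_toSet _).image _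
  · intro τ hτ
    simp only [Set.mem_iUnion, Finset.mem_range, Set.mem_image] at hτ
    obtain ⟨m, hm, j, _, rfl⟩ := hτ
    exact hm
  · intro x hx
    have h2 := hI hx
    simp only [Set.mem_iUnion] at h2
    obtain ⟨m, hm, j, hj, hx⟩ := h2
    refine ⟨⟨m, j⟩, ?_, hx⟩
    simp only [Set.mem_iUnion, Finset.mem_range, Set.mem_image]
    exact ⟨m, hm, j, hj, rfl⟩

theorem dim_lt_of_mem_frontier {σ τ : Face X} {x : X} (h : x ∈ σ.frontier) (hx : x ∈ τ.opn) :
    τ.dim < σ.dim := by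
  obtain ⟨T, -, hT, h'⟩ := σ.exists_finite_frontier
  obtain ⟨ρ, hρ, hxρ⟩ := h' x h
  rw [eq_of_mem hx hxρ]
  exact hT ρ hρ

theorem eq_or_dim_lt {σ τ : Face X} {x : X} (h : x ∈ σ.closed) (hx : x ∈ τ.opn) :
    τ = σ ∨ τ.dim < σ.dim := by
  rw [closed_eq] at h
  rcases h with h | h
  · exact Or.inr (dim_lt_of_mem_frontier h hx)
  · exact Or.inl (eq_of_mem hx h)

theorem exists_mem_opn {σ : Face X} {x : X} (h : x ∈ σ.closed) : ∃ τ : Face X, x ∈ τ.opn := by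
  rw [closed_eq] at h
  rcases h with h | h
  · obtain ⟨T, -, -, h'⟩ := σ.exists_finite_frontier
    obtain ⟨ρ, -, hxρ⟩ := h' x h
    exact ⟨ρ, hxρ⟩
  · exact ⟨σ, h⟩

theorem dim_lt_of_lt {σ τ : Face X} (h : τ < σ) : τ.dim < σ.dim := by
  obtain ⟨x, hx⟩ := τ.opn_nonempty
  rcases eq_or_dim_lt (h.le (τ.opn_subset_closed hx)) hx with h' | h'
  · exact absurd h' h.ne
  · exact h'

theorem injOn_charMap (hX : IsRegularCW X) (σ : Face X) :
    Set.InjOn σ.charMap (Metric.closedBall 0 1) := hX _ _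

/-- The characteristic map of `σ`, followed by the inverse chart of `ρ`, is an injective continuous
map from a piece of the sphere to Euclidean space, so invariance of domain applies. Regularity of
`σ` gives the injectivity. -/
theorem isOpen_symm_image (hX : IsRegularCW X) (σ ρ : Face X) (hρ : ρ.dim < σ.dim)
    {V : Set (Fin σ.dim → ℝ)} (hV : IsOpen V)
    (hVρ : ∀ z ∈ V ∩ Metric.sphere 0 1, σ.charMap z ∈ ρ.opn) :
    IsOpen ((RelCWComplex.map ρ.dim ρ.cell).symm ∘ σ.charMap '' (V ∩ Metric.sphere 0 1)) ∧
      (ρ.dim + 1 < σ.dim → V ∩ Metric.sphere 0 1 = ∅) := by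
  have htarget : (RelCWComplex.map ρ.dim ρ.cell).target = ρ.opn := by
    rw [← PartialEquiv.image_source_eq_target, RelCWComplex.source_eq]
    rfl
  have hsub : V ∩ Metric.sphere (0 : Fin σ.dim → ℝ) 1 ⊆ Metric.closedBall 0 1 :=
    Set.inter_subset_right.trans Metric.sphere_subset_closedBall
  refine isOpen_image_sphere hρ hV ?_ ?_
  · refine (RelCWComplex.continuousOn_symm ρ.dim ρ.cell).comp
      (σ.continuousOn_charMap.mono hsub) fun z hz => ?_
    rw [htarget]
    exact hVρ z hz
  · intro z hz w hw h
    refine injOn_charMap hX σ (hsub hz) (hsub hw) ?_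
    refine (RelCWComplex.map ρ.dim ρ.cell).symm.injOn ?_ ?_ h
    · rw [PartialEquiv.symm_source, htarget]
      exact hVρ z hz
    · rw [PartialEquiv.symm_source, htarget]
      exact hVρ w hw

variable [T2Space X]

/-- If no cell of larger dimension meets a piece of the boundary of `σ`, then the intersection of
the piece with the open cell `ρ` is relatively open. -/
theorem exists_isOpen_inter_sphere (σ ρ : Face X) {W : Set (Fin σ.dim → ℝ)} (hW : IsOpen W)
    (hmax : ∀ z ∈ W ∩ Metric.sphere 0 1, ∀ τ : Face X, σ.charMap z ∈ τ.opn → τ.dim ≤ ρ.dim) :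
    ∃ V : Set (Fin σ.dim → ℝ), IsOpen V ∧
      V ∩ Metric.sphere 0 1 = (W ∩ Metric.sphere 0 1) ∩ σ.charMap ⁻¹' ρ.opn := by
  obtain ⟨T, hTf, -, hT⟩ := σ.exists_finite_frontier
  have hfin : {τ ∈ T | τ ≠ ρ ∧ τ.dim ≤ ρ.dim}.Finite := hTf.subset fun τ hτ => hτ.1
  -- Removing the finitely many other closed cells of at most the dimension of `ρ` leaves, inside
  -- `W`, precisely the trace of the open cell `ρ`: such cells do not meet it.
  have hC : IsClosed (⋃ τ ∈ {τ ∈ T | τ ≠ ρ ∧ τ.dim ≤ ρ.dim}, τ.closed) :=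
    hfin.isClosed_biUnion fun τ _ => τ.isClosed_closed
  have hS := (σ.continuousOn_charMap.mono Metric.sphere_subset_closedBall).preimage_isClosed_of_isClosed
    Metric.isClosed_sphere hC
  refine ⟨W \ (Metric.sphere 0 1 ∩ σ.charMap ⁻¹' _), hW.sdiff hS, ?_⟩
  ext z
  constructor
  · rintro ⟨⟨hzW, hz⟩, hzS⟩
    refine ⟨⟨hzW, hzS⟩, ?_⟩
    obtain ⟨τ, hτ, hzτ⟩ := hT (σ.charMap z) ⟨z, hzS, rfl⟩
    by_cases h : τ = ρ
    · exact h ▸ hzτ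
    · refine absurd ⟨hzS, ?_⟩ hz
      simp only [Set.mem_preimage, Set.mem_iUnion]
      exact ⟨τ, ⟨hτ, h, hmax z ⟨hzW, hzS⟩ τ hzτ⟩, τ.opn_subset_closed hzτ⟩
  · rintro ⟨⟨hzW, hzS⟩, hzρ⟩
    refine ⟨⟨hzW, fun h => ?_⟩, hzS⟩
    have h2 := h.2
    simp only [Set.mem_preimage, Set.mem_iUnion] at h2
    obtain ⟨τ, ⟨-, hne, hdim⟩, hzτ⟩ := h2
    rcases eq_or_dim_lt hzτ hzρ with h' | h'
    · exact hne h'.symm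
    · exact absurd hdim (not_le.mpr h')

/-- A cell of codimension one that meets the boundary of `σ` is a face of `σ`. -/
theorem le_of_codim_one (hX : IsRegularCW X) {σ ρ : Face X} (hρ : ρ.dim + 1 = σ.dim) {x : X}
    (hx : x ∈ σ.frontier) (hxρ : x ∈ ρ.opn) : ρ ≤ σ := by
  obtain ⟨V, hV, hVeq⟩ := exists_isOpen_inter_sphere σ ρ isOpen_univ fun z hz τ hτ => by
    have := dim_lt_of_mem_frontier (σ := σ) ⟨z, hz.2, rfl⟩ hτ
    omega
  rw [Set.univ_inter] at hVeq
  have hopen := (isOpen_symm_image hX σ ρ (by omega) hV (fun z hz => by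
    rw [hVeq] at hz
    exact hz.2)).1
  set u := (RelCWComplex.map ρ.dim ρ.cell).symm ∘ σ.charMap '' (V ∩ Metric.sphere 0 1) with hu
  have hsource : (RelCWComplex.map ρ.dim ρ.cell).source = Metric.ball 0 1 :=
    RelCWComplex.source_eq _ _
  have hmem : ∀ y, y ∈ u ↔ y ∈ Metric.ball (0 : Fin ρ.dim → ℝ) 1 ∧ ρ.charMap y ∈ σ.frontier := by
    intro y
    rw [hu, hVeq]
    constructor
    · rintro ⟨z, ⟨hz, ⟨w, hw, hwz⟩⟩, rfl⟩
      have h1 : (RelCWComplex.map ρ.dim ρ.cell).symm (σ.charMap z) = w := by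
        rw [← hwz]
        exact (RelCWComplex.map ρ.dim ρ.cell).left_inv (hsource ▸ hw)
      rw [Function.comp_apply, h1]
      refine ⟨hw, z, hz, hwz.symm⟩
    · rintro ⟨hy, z, hz, hzy⟩
      refine ⟨z, ⟨hz, y, hy, hzy.symm⟩, ?_⟩
      rw [Function.comp_apply]
      change (RelCWComplex.map ρ.dim ρ.cell).symm (RelCWComplex.map σ.dim σ.cell z) = y
      rw [hzy]
      exact (RelCWComplex.map ρ.dim ρ.cell).left_inv (hsource ▸ hy)
  -- The points of the open cell `ρ` lying on the boundary of `σ` form an open set by invariance of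
  -- domain, and a relatively closed one because the boundary is closed. The open ball is connected.
  have hsub : Metric.ball (0 : Fin ρ.dim → ℝ) 1 ⊆ u := by
    refine (convex_ball (0 : Fin ρ.dim → ℝ) 1).isPreconnected.subset_of_closure_inter_subset hopen
      ?_ ?_
    · obtain ⟨y, hy, rfl⟩ := hxρ
      exact ⟨y, hy, (hmem y).mpr ⟨hy, hx⟩⟩
    · rintro y ⟨hyu, hy⟩
      refine (hmem y).mpr ⟨hy, ?_⟩
      have hc : ContinuousAt ρ.charMap y := (ρ.continuousOn_charMap.mono
        Metric.ball_subset_closedBall).continuousAt (Metric.isOpen_ball.mem_nhds hy)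
      have h1 := hc.continuousWithinAt.mem_closure_image hyu
      refine σ.isClosed_frontier.closure_subset_iff.mpr ?_ h1
      rintro _ ⟨w, hw, rfl⟩
      exact ((hmem w).mp hw).2
  have h2 : ρ.opn ⊆ σ.closed := by
    rintro _ ⟨y, hy, rfl⟩
    exact σ.frontier_subset_closed ((hmem y).mp (hsub hy)).2
  have h3 := σ.isClosed_closed.closure_subset_iff.mpr h2
  rwa [opn, RelCWComplex.closure_openCell_eq_closedCell] at h3

/-- The boundary of a cell of a regular complex is the union of its faces of codimension one. -/
theorem exists_codim_one (hX : IsRegularCW X) {σ : Face X} {x : X} (hx : x ∈ σ.frontier) :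
    ∃ ρ : Face X, ρ ≤ σ ∧ ρ.dim + 1 = σ.dim ∧ x ∈ ρ.closed := by
  by_contra! hne
  let C : Set X := ⋃ ρ ∈ {ρ : Face X | ρ ≤ σ ∧ ρ.dim + 1 = σ.dim}, ρ.closed
  have hmemC : ∀ x, x ∈ C ↔ ∃ ρ : Face X, (ρ ≤ σ ∧ ρ.dim + 1 = σ.dim) ∧ x ∈ ρ.closed := fun x => by
    simp [C]
  have hC : IsClosed C :=
    (σ.finite_le.subset fun ρ hρ => hρ.1).isClosed_biUnion fun τ _ => τ.isClosed_closed
  have hS := (σ.continuousOn_charMap.mono Metric.sphere_subset_closedBall).preimage_isClosed_of_isClosed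
    Metric.isClosed_sphere hC
  let W := (Metric.sphere (0 : Fin σ.dim → ℝ) 1 ∩ σ.charMap ⁻¹' C)ᶜ
  have hWS : ∀ z ∈ W ∩ Metric.sphere 0 1, ∀ ρ : Face X, ρ ≤ σ → ρ.dim + 1 = σ.dim →
      σ.charMap z ∉ ρ.closed := by
    rintro z ⟨hzW, hzS⟩ ρ h1 h2 h3
    exact hzW ⟨hzS, (hmemC _).mpr ⟨ρ, ⟨h1, h2⟩, h3⟩⟩
  obtain ⟨z, hzS, rfl⟩ := hx
  have hzW : z ∈ W := fun h => by
    obtain ⟨ρ, ⟨h3, h4⟩, h5⟩ := (hmemC _).mp h.2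
    exact hne ρ h3 h4 h5
  have hex : ∀ z ∈ W ∩ Metric.sphere 0 1, ∀ τ : Face X, σ.charMap z ∈ τ.opn → τ.dim < σ.dim :=
    fun z hz τ hτ => dim_lt_of_mem_frontier (σ := σ) ⟨z, hz.2, rfl⟩ hτ
  -- Among the cells meeting the uncovered part of the boundary, one of largest dimension has an
  -- open trace. Invariance of domain forces codimension one, so it is a face and its points were
  -- covered after all.
  let N : Set ℕ := {k | ∃ z ∈ W ∩ Metric.sphere 0 1, ∃ τ : Face X, σ.charMap z ∈ τ.opn ∧ τ.dim = k}
  have hN : BddAbove N := ⟨σ.dim, by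
    rintro _ ⟨z, hz, τ, hτ, rfl⟩
    exact (hex z hz τ hτ).le⟩
  have hNne : N.Nonempty := by
    obtain ⟨τ, hτ⟩ := exists_mem_opn (σ.frontier_subset_closed ⟨z, hzS, rfl⟩ : σ.charMap z ∈ _)
    exact ⟨_, z, ⟨hzW, hzS⟩, τ, hτ, rfl⟩
  obtain ⟨w, hw, ρ, hwρ, hρ⟩ := Nat.sSup_mem hNne hN
  have hmax : ∀ z ∈ W ∩ Metric.sphere 0 1, ∀ τ : Face X, σ.charMap z ∈ τ.opn → τ.dim ≤ ρ.dim :=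
    fun z hz τ hτ => by
      rw [hρ]
      exact le_csSup hN ⟨z, hz, τ, hτ, rfl⟩
  obtain ⟨V, hV, hVeq⟩ := exists_isOpen_inter_sphere σ ρ hS.isOpen_compl hmax
  have h1 := (isOpen_symm_image hX σ ρ (hex w hw ρ hwρ) hV fun z hz => by
    rw [hVeq] at hz
    exact hz.2).2
  have hwV : w ∈ V ∩ Metric.sphere 0 1 := hVeq ▸ ⟨hw, hwρ⟩
  have h2 : ρ.dim + 1 = σ.dim := by
    by_contra h
    have h3 := hex w hw ρ hwρ
    rw [h1 (by omega)] at hwV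
    exact hwV
  exact hWS w hw ρ (le_of_codim_one hX h2 ⟨w, hw.2, rfl⟩ hwρ) h2 (ρ.opn_subset_closed hwρ)

/-- Every cell that meets a closed cell of a regular complex is a face of it. -/
theorem le_of_mem_opn (hX : IsRegularCW X) {σ τ : Face X} {x : X} (hx : x ∈ σ.closed)
    (hxτ : x ∈ τ.opn) : τ ≤ σ := by
  induction hd : σ.dim using Nat.strong_induction_on generalizing σ with
  | _ d ih =>
    rw [closed_eq] at hx
    rcases hx with hx | hx
    · obtain ⟨ρ, h1, h2, h3⟩ := exists_codim_one hX hx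
      exact (ih ρ.dim (by omega) h3 rfl).trans h1
    · exact (eq_of_mem hx hxτ).ge

theorem closed_subset_frontier {σ τ : Face X} (hX : IsRegularCW X) (h : τ < σ) :
    τ.closed ⊆ σ.frontier := by
  intro x hx
  have h1 := h.le hx
  rw [closed_eq] at h1
  rcases h1 with h1 | h1
  · exact h1
  · exact absurd (le_of_mem_opn hX hx h1) h.not_ge

theorem mem_closed_inter {σ τ : Face X} (hX : IsRegularCW X) {x : X} (h1 : x ∈ σ.closed)
    (h2 : x ∈ τ.closed) : ∃ ρ : Face X, ρ ≤ σ ∧ ρ ≤ τ ∧ x ∈ ρ.closed := by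
  obtain ⟨ρ, hρ⟩ := exists_mem_opn h1
  exact ⟨ρ, le_of_mem_opn hX h1 hρ, le_of_mem_opn hX h2 hρ, ρ.opn_subset_closed hρ⟩

/-- An edge of a regular complex has exactly two vertices. -/
theorem exists_two_vertices (hX : IsRegularCW X) {σ : Face X} (hσ : σ.dim = 1) :
    ∃ u v : Face X, u ≠ v ∧ u.dim = 0 ∧ v.dim = 0 ∧ ∀ τ : Face X, τ < σ ↔ τ = u ∨ τ = v := by
  obtain ⟨d, e⟩ := σ
  obtain rfl : d = 1 := hσ
  obtain ⟨a, b, hab⟩ := CWComplex.exists_cellFrontier_one_eq e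
  have hinj := injOn_charMap hX ⟨1, e⟩
  have h2 : ∀ a : RelCWComplex.cell (Set.univ : Set X) 0, (⟨0, a⟩ : Face X).closed =
      {(⟨0, a⟩ : Face X).charMap ![]} := fun a => RelCWComplex.closedCell_zero_eq_singleton
  have hfr : (⟨1, e⟩ : Face X).frontier = (⟨0, a⟩ : Face X).closed ∪ (⟨0, b⟩ : Face X).closed := hab
  refine ⟨⟨0, a⟩, ⟨0, b⟩, ?_, rfl, rfl, fun τ => ⟨fun h => ?_, ?_⟩⟩
  -- If the two vertices coincided, both ends of the interval would go to one point, against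
  -- injectivity on the closed ball.
  · intro h
    rw [← h, Set.union_self, h2] at hfr
    have h3 : ∀ s : ℝ, |s| = 1 → (⟨1, e⟩ : Face X).charMap (fun _ => s) =
        (⟨0, a⟩ : Face X).charMap ![] := fun s hs => by
      rw [← Set.mem_singleton_iff, ← hfr]
      refine ⟨fun _ => s, ?_, rfl⟩
      rw [mem_sphere_zero_iff_norm, pi_norm_const, Real.norm_eq_abs, hs]
    have h4 : ∀ s : ℝ, |s| = 1 → (fun _ => s) ∈ Metric.closedBall (0 : Fin 1 → ℝ) 1 :=
      fun s hs => by rw [mem_closedBall_zero_iff, pi_norm_const, Real.norm_eq_abs, hs]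
    have h5 := hinj (h4 1 (by simp)) (h4 (-1) (by simp))
      ((h3 1 (by simp)).trans (h3 (-1) (by simp)).symm)
    have h6 := congrFun h5 0
    norm_num at h6
  · obtain ⟨x, hx⟩ := τ.opn_nonempty
    have h3 := closed_subset_frontier hX h (τ.opn_subset_closed hx)
    rw [hfr] at h3
    rcases h3 with h3 | h3
    · rcases eq_or_dim_lt h3 hx with h4 | h4
      · exact Or.inl h4
      · simp at h4
    · rcases eq_or_dim_lt h3 hx with h4 | h4
      · exact Or.inr h4
      · simp at h4
  · have h3 : ∀ c : RelCWComplex.cell (Set.univ : Set X) 0, (⟨0, c⟩ : Face X).closed ⊆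
        (⟨1, e⟩ : Face X).frontier → (⟨0, c⟩ : Face X) < ⟨1, e⟩ := fun c hc =>
      lt_of_le_of_ne (hc.trans (frontier_subset_closed _)) fun h => by
        have := congrArg Face.dim h
        simp at this
    rintro (rfl | rfl)
    · exact h3 a (hfr ▸ Set.subset_union_left)
    · exact h3 b (hfr ▸ Set.subset_union_right)

end Face
end RegularCells

/-! ### Maps of free modules induced by maps of bases. -/

section FreeModuleMaps

variable {B B' : Type*} {f : B → B'}

/-- The map of free modules induced by a map of bases. -/
noncomputable abbrev mapGen (f : B → B') : Chain B →ₗ[ZMod 2] Chain B' :=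
  Finsupp.lmapDomain (ZMod 2) (ZMod 2) f

theorem mapGen_gen (f : B → B') (b : B) : mapGen f (gen b) = gen (f b) :=
  Finsupp.mapDomain_single

theorem mapGen_injective (hf : Function.Injective f) : Function.Injective (mapGen f) :=
  Finsupp.mapDomain_injective hf

theorem mapGen_mem_iff (hf : Function.Injective f) {s : Set B'} {x : Chain B} :
    mapGen f x ∈ spanOn s ↔ x ∈ spanOn (f ⁻¹' s) := by
  classical
  rw [Finsupp.mem_supported, Finsupp.mem_supported, Finsupp.lmapDomain_apply,
    Finsupp.mapDomain_support_of_injective hf, Finset.coe_image, Set.image_subset_iff]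

theorem exists_mapGen_eq (hf : Function.Injective f) {s : Set B'} (hs : s ⊆ Set.range f)
    {x : Chain B'} (hx : x ∈ spanOn s) : ∃ y ∈ spanOn (f ⁻¹' s), mapGen f y = x := by
  have h : mapGen f (Finsupp.comapDomain f x hf.injOn) = x :=
    Finsupp.mapDomain_comapDomain f hf x (((Finsupp.mem_supported _ _).mp hx).trans hs)
  exact ⟨_, (mapGen_mem_iff hf).mp (h.symm ▸ hx), h⟩

theorem eq_smul_gen {b : B} {x : Chain B} (hx : x ∈ spanOn {b}) : x = 0 ∨ x = gen b := by
  have h2 : ∀ c : ZMod 2, c = 0 ∨ c = 1 := by decide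
  have h3 : x = Finsupp.single b (x b) := by
    ext c
    by_cases hc : c = b
    · subst hc
      simp
    · rw [Finsupp.single_eq_of_ne hc]
      exact Finsupp.notMem_support_iff.mp fun h => hc ((Finsupp.mem_supported _ _).mp hx h)
  rcases h2 (x b) with h | h
  · left
    rw [h3, h, Finsupp.single_zero]
  · right
    rw [h3, h]

theorem eq_zero_of_mem_spanOn_empty {s : Set B} (hs : ∀ b, b ∉ s) {x : Chain B}
    (hx : x ∈ spanOn s) : x = 0 := by
  rw [Set.eq_empty_iff_forall_notMem.mpr hs, spanOn, Finsupp.supported_empty] at hx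
  exact hx

end FreeModuleMaps

/-! ### Acyclicity of the augmented cellular complex of a closed cell. -/

section ReducedComplex

variable {X : Type*} [TopologicalSpace X] [Topology.CWComplex (Set.univ : Set X)]

theorem Face.mem_below {σ τ : Face X} : τ ∈ σ.below ↔ τ ≤ σ := by
  simp [Face.below]

theorem cellularBoundary_gen (σ : Face X) : cellularBoundary X (gen σ) =
    ∑ τ ∈ σ.below, if τ.dim + 1 = σ.dim then gen τ else 0 := by
  simp [cellularBoundary]

theorem cellularBoundary_mem (σ : Face X) :
    cellularBoundary X (gen σ) ∈ spanOn {τ | τ ≤ σ ∧ τ.dim + 1 = σ.dim} := by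
  rw [cellularBoundary_gen]
  refine Submodule.sum_mem _ fun τ hτ => ?_
  split_ifs with h
  · exact gen_mem_spanOn ⟨Face.mem_below.mp hτ, h⟩
  · exact Submodule.zero_mem _

theorem cellularBoundary_apply {σ τ : Face X} (h : τ ≤ σ) (hd : τ.dim + 1 = σ.dim) :
    cellularBoundary X (gen σ) τ = 1 := by
  classical
  rw [cellularBoundary_gen, Finsupp.finsetSum_apply, Finset.sum_eq_single τ]
  · simp [hd]
  · intro ρ _ hρ
    split_ifs
    · exact Finsupp.single_eq_of_ne hρ.symm
    · rfl
  · intro h'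
    exact absurd (Face.mem_below.mpr h) h'

theorem augmentation_gen (σ : Face X) : augmentation X (gen σ) = if σ.dim = 0 then 1 else 0 := by
  simp [augmentation]

/-- Only edges have a boundary in dimension 0, and an edge of a regular complex has exactly two
vertices. -/
theorem augmentation_boundary [T2Space X] (hX : IsRegularCW X) (x : Chain (Face X)) :
    augmentation X (cellularBoundary X x) = 0 := by
  classical
  suffices h : augmentation X ∘ₗ cellularBoundary X = 0 by
    rw [← LinearMap.comp_apply, h, LinearMap.zero_apply]
  refine chain_hom_ext fun σ => ?_
  rw [LinearMap.comp_apply, LinearMap.zero_apply]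
  by_cases hσ : σ.dim = 1
  · obtain ⟨u, v, huv, hu, hv, h⟩ := Face.exists_two_vertices hX hσ
    have h1 : cellularBoundary X (gen σ) = gen u + gen v := by
      rw [cellularBoundary_gen, ← Finset.sum_filter]
      have : σ.below.filter (fun τ => τ.dim + 1 = σ.dim) = {u, v} := by
        ext τ
        rw [Finset.mem_filter, Face.mem_below, Finset.mem_insert, Finset.mem_singleton, ← h]
        constructor
        · rintro ⟨h1, h2⟩
          refine lt_of_le_of_ne h1 ?_
          rintro rfl
          omega
        · intro h1
          refine ⟨h1.le, ?_⟩
          have := Face.dim_lt_of_lt h1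
          omega
      rw [this, Finset.sum_pair huv]
    rw [h1, map_add, augmentation_gen, augmentation_gen, hu, hv]
    decide
  · have := map_mem_of_mem_spanOn (cellularBoundary_mem σ) (augmentation X) (N := ⊥) fun τ hτ => by
      rw [Submodule.mem_bot, augmentation_gen, if_neg (fun h => hσ (by rw [← hτ.2, h]))]
    exact this

/-- The rank of a cell in the augmented face poset, one more than its dimension. -/
def reducedRank (q : WithBot (Face X)) : ℕ := WithBot.recBotCoe 0 (fun σ => σ.dim + 1) q

@[simp] theorem reducedRank_bot : reducedRank (⊥ : WithBot (Face X)) = 0 := rfl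

@[simp] theorem reducedRank_coe (σ : Face X) :
    reducedRank (σ : WithBot (Face X)) = σ.dim + 1 := rfl

theorem reducedRank_strictMono : StrictMono (reducedRank : WithBot (Face X) → ℕ) := by
  intro p q h
  induction q using WithBot.recBotCoe with
  | bot => simp at h
  | coe τ =>
    induction p using WithBot.recBotCoe with
    | bot => simp
    | coe σ => simpa using Face.dim_lt_of_lt (WithBot.coe_lt_coe.mp h)

variable (X) in
/-- The differential of the augmented cellular complex; the augmentation is the empty cell. -/
noncomputable def reducedBoundary : Chain (WithBot (Face X)) →ₗ[ZMod 2] Chain (WithBot (Face X)) :=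
  Finsupp.linearCombination (ZMod 2) fun q =>
    WithBot.recBotCoe (C := fun _ => Chain (WithBot (Face X))) 0
      (fun σ => mapGen WithBot.some (cellularBoundary X (gen σ)) +
        augmentation X (gen σ) • gen ⊥) q

theorem reducedBoundary_bot : reducedBoundary X (gen ⊥) = 0 := by
  simp [reducedBoundary]

theorem reducedBoundary_mapGen (x : Chain (Face X)) :
    reducedBoundary X (mapGen WithBot.some x) =
      mapGen WithBot.some (cellularBoundary X x) + augmentation X x • gen ⊥ := by
  have : reducedBoundary X ∘ₗ mapGen WithBot.some = mapGen WithBot.some ∘ₗ cellularBoundary X +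
      (augmentation X).smulRight (gen ⊥) := by
    refine chain_hom_ext fun σ => ?_
    rw [LinearMap.comp_apply, mapGen_gen]
    simp [reducedBoundary]
  exact congrArg (fun f => f x) this

theorem reducedBoundary_coe (σ : Face X) : reducedBoundary X (gen (σ : WithBot (Face X))) =
    mapGen WithBot.some (cellularBoundary X (gen σ)) + augmentation X (gen σ) • gen ⊥ := by
  rw [← reducedBoundary_mapGen, mapGen_gen]

theorem reducedBoundary_mem (q : WithBot (Face X)) : reducedBoundary X (gen q) ∈
    spanOn {ρ | ρ ≤ q ∧ reducedRank ρ + 1 = reducedRank q} := by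
  induction q using WithBot.recBotCoe with
  | bot =>
    rw [reducedBoundary_bot]
    exact Submodule.zero_mem _
  | coe σ =>
    rw [reducedBoundary_coe]
    refine Submodule.add_mem _ ?_ ?_
    · rw [mapGen_mem_iff WithBot.coe_injective]
      refine spanOn_mono ?_ (cellularBoundary_mem σ)
      exact fun τ hτ => ⟨WithBot.coe_le_coe.mpr hτ.1, congrArg (· + 1) hτ.2⟩
    · rw [augmentation_gen]
      split_ifs with h
      · rw [one_smul]
        exact gen_mem_spanOn ⟨bot_le, by simp [h]⟩
      · rw [zero_smul]
        exact Submodule.zero_mem _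

theorem reducedBoundary_reducedBoundary [T2Space X] (hX : IsRegularCW X)
    (hdd : ∀ x, cellularBoundary X (cellularBoundary X x) = 0) (x : Chain (WithBot (Face X))) :
    reducedBoundary X (reducedBoundary X x) = 0 := by
  suffices h : reducedBoundary X ∘ₗ reducedBoundary X = 0 by
    rw [← LinearMap.comp_apply, h, LinearMap.zero_apply]
  refine chain_hom_ext fun q => ?_
  rw [LinearMap.comp_apply, LinearMap.zero_apply]
  induction q using WithBot.recBotCoe with
  | bot => rw [reducedBoundary_bot, map_zero]
  | coe σ =>
    rw [reducedBoundary_coe, map_add, map_smul, reducedBoundary_bot, smul_zero, add_zero,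
      reducedBoundary_mapGen, hdd, map_zero, augmentation_boundary hX, zero_smul, add_zero]

/-- A vertex has augmentation 1. Any other cell has a nonempty boundary, hence a face of codimension
one, which occurs with coefficient 1. -/
theorem reducedBoundary_ne_zero [T2Space X] (hX : IsRegularCW X) (σ : Face X) :
    reducedBoundary X (gen (σ : WithBot (Face X))) ≠ 0 := by
  intro h
  rw [reducedBoundary_coe] at h
  by_cases hσ : σ.dim = 0
  · have h1 : cellularBoundary X (gen σ) = 0 :=
      eq_zero_of_mem_spanOn_empty (fun τ hτ => by
        have := hτ.2
        omega) (cellularBoundary_mem σ)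
    rw [h1, map_zero, zero_add, augmentation_gen, if_pos hσ, one_smul] at h
    exact one_ne_zero ((Finsupp.single_eq_zero).mp h)
  · rw [augmentation_gen, if_neg hσ, zero_smul, add_zero] at h
    have h1 := mapGen_injective WithBot.coe_injective (h.trans (map_zero _).symm)
    obtain ⟨x, hx⟩ := Topology.RelCWComplex.nonempty_cellFrontier hσ σ.cell
    obtain ⟨ρ, h2, h3, -⟩ := Face.exists_codim_one hX hx
    have h4 := cellularBoundary_apply h2 h3
    rw [h1] at h4
    exact zero_ne_one h4

/-- Every cycle of the augmented complex of the closed cell `σ` is a boundary there. -/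
def IsAcyclicFace (σ : Face X) : Prop :=
  ∀ k, ∀ x ∈ spanOn {ρ : WithBot (Face X) | ρ ≤ σ ∧ reducedRank ρ = k}, reducedBoundary X x = 0 →
    ∃ y ∈ spanOn {ρ : WithBot (Face X) | ρ ≤ σ ∧ reducedRank ρ = k + 1}, reducedBoundary X y = x

/-- The proper faces of a cell, including the empty one. -/
abbrev ProperFace (σ : Face X) := {q : WithBot (Face X) // q < σ}

instance (σ : Face X) : OrderBot (ProperFace σ) where
  bot := ⟨⊥, WithBot.bot_lt_coe σ⟩
  bot_le _ := Subtype.mk_le_mk.mpr bot_le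

instance (σ : Face X) : Finite (ProperFace σ) := by
  have h : {q : WithBot (Face X) | q < σ}.Finite := by
    refine ((σ.finite_le.image WithBot.some).insert ⊥).subset fun q hq => ?_
    induction q using WithBot.recBotCoe with
    | bot => exact Or.inl rfl
    | coe τ => exact Or.inr ⟨τ, (WithBot.coe_lt_coe.mp hq).le, rfl⟩
  exact h.to_subtype

/-- The augmented cellular complex of the boundary of a cell. -/
noncomputable def properBoundary (σ : Face X) :
    Chain (ProperFace σ) →ₗ[ZMod 2] Chain (ProperFace σ) :=
  Finsupp.lcomapDomain Subtype.val Subtype.val_injective ∘ₗ reducedBoundary X ∘ₗ mapGen Subtype.val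

theorem mapGen_properBoundary (σ : Face X) (x : Chain (ProperFace σ)) :
    mapGen Subtype.val (properBoundary σ x) = reducedBoundary X (mapGen Subtype.val x) := by
  refine Finsupp.mapDomain_comapDomain _ Subtype.val_injective _ ?_
  have h : mapGen Subtype.val x ∈ spanOn {q : WithBot (Face X) | q < σ} := by
    rw [mapGen_mem_iff Subtype.val_injective]
    refine spanOn_mono ?_ (mem_spanOn_support x)
    exact fun q _ => q.2
  have h2 := map_mem_of_mem_spanOn h (reducedBoundary X)
    (N := spanOn {q : WithBot (Face X) | q < σ}) fun q hq => by
      refine spanOn_mono ?_ (reducedBoundary_mem q)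
      exact fun ρ hρ => lt_of_le_of_lt hρ.1 hq
  exact fun q hq => ⟨⟨q, (Finsupp.mem_supported _ _).mp h2 hq⟩, rfl⟩

/-- The boundary of a cell as a cellular complex with acyclic closed cells. -/
noncomputable def properStructure [T2Space X] (hX : IsRegularCW X)
    (hdd : ∀ x, cellularBoundary X (cellularBoundary X x) = 0) (σ : Face X)
    (hσ : ∀ τ, τ < σ → IsAcyclicFace τ) : CellStructure (ProperFace σ) where
  rk q := reducedRank q.1
  bd := properBoundary σ
  rk_bot := rfl
  rk_strictMono _ _ h := reducedRank_strictMono h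
  bd_mem τ := by
    have := mapGen_properBoundary σ (gen τ)
    rw [mapGen_gen] at this
    have h2 := reducedBoundary_mem τ.1
    rw [← this, mapGen_mem_iff Subtype.val_injective] at h2
    exact h2
  bd_bd x := by
    refine mapGen_injective Subtype.val_injective ?_
    rw [mapGen_properBoundary, mapGen_properBoundary, reducedBoundary_reducedBoundary hX hdd,
      map_zero]
  acyclic τ hτ k x hx hx0 := by
    obtain ⟨⟨q, hq⟩, rfl⟩ : ∃ q, τ = q := ⟨τ, rfl⟩
    induction q using WithBot.recBotCoe with
    | bot => exact absurd rfl hτ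
    | coe τ =>
      have hlt := WithBot.coe_lt_coe.mp hq
      obtain ⟨y, hy, hyx⟩ := hσ τ hlt k (mapGen Subtype.val x)
        ((mapGen_mem_iff Subtype.val_injective).mpr hx)
        (by rw [← mapGen_properBoundary, hx0, map_zero])
      obtain ⟨z, hz, rfl⟩ := exists_mapGen_eq (f := (Subtype.val : ProperFace σ → _))
        Subtype.val_injective (fun ρ hρ => ⟨⟨ρ, lt_of_le_of_lt hρ.1 hq⟩, rfl⟩) hy
      refine ⟨z, hz, mapGen_injective Subtype.val_injective ?_⟩
      rw [mapGen_properBoundary, hyx]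

/-- The preimage of a proper face under the characteristic map. -/
def properCell (σ : Face X) (q : ProperFace σ) : Set (Metric.sphere (0 : Fin σ.dim → ℝ) 1) :=
  {y | ∃ τ : Face X, (τ : WithBot (Face X)) = q.1 ∧ σ.charMap y.1 ∈ τ.closed}

theorem properCell_coe {σ τ : Face X} (h : (τ : WithBot (Face X)) < σ) :
    properCell σ ⟨τ, h⟩ = {y | σ.charMap y.1 ∈ τ.closed} := by
  ext y
  constructor
  · rintro ⟨ρ, h1, h2⟩
    rwa [WithBot.coe_injective h1] at h2
  · exact fun h => ⟨τ, rfl, h⟩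

theorem Face.continuous_sphere (σ : Face X) :
    Continuous fun y : Metric.sphere (0 : Fin σ.dim → ℝ) 1 => σ.charMap y.1 :=
  continuousOn_iff_continuous_domRestrict.mp
    (σ.continuousOn_charMap.mono Metric.sphere_subset_closedBall)

theorem isClosed_properCell [T2Space X] (σ : Face X) (q : ProperFace σ) :
    IsClosed (properCell σ q) := by
  obtain ⟨q, hq⟩ := q
  induction q using WithBot.recBotCoe with
  | bot =>
    convert isClosed_empty
    ext y
    simp [properCell]
  | coe τ =>
    rw [properCell_coe]
    exact τ.isClosed_closed.preimage σ.continuous_sphere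

/-- The preimage of `τ` in the boundary sphere of `σ` and the closed ball of `τ` are embedded by the
two characteristic maps with the same image, so the preimage is homeomorphic to a ball. -/
theorem contractibleSpace_properCell [T2Space X] (hX : IsRegularCW X) {σ τ : Face X}
    (h : (τ : WithBot (Face X)) < σ) : ContractibleSpace (properCell σ ⟨τ, h⟩) := by
  have hlt := WithBot.coe_lt_coe.mp h
  have hc : CompactSpace (properCell σ ⟨τ, h⟩) :=
    isCompact_iff_compactSpace.mp (isClosed_properCell _ _).isCompact
  have hb : CompactSpace (Metric.closedBall (0 : Fin τ.dim → ℝ) 1) :=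
    isCompact_iff_compactSpace.mp (isCompact_closedBall _ _)
  have h1 : Topology.IsClosedEmbedding
      fun y : properCell σ ⟨τ, h⟩ => σ.charMap y.1.1 :=
    (σ.continuous_sphere.comp continuous_subtype_val).isClosedEmbedding fun y z hyz => by
      refine Subtype.ext (Subtype.ext (Face.injOn_charMap hX σ ?_ ?_ hyz))
      · exact Metric.sphere_subset_closedBall y.1.2
      · exact Metric.sphere_subset_closedBall z.1.2
  have h2 : Topology.IsClosedEmbedding
      fun y : Metric.closedBall (0 : Fin τ.dim → ℝ) 1 => τ.charMap y.1 :=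
    (continuousOn_iff_continuous_domRestrict.mp τ.continuousOn_charMap).isClosedEmbedding
      (Set.injOn_iff_injective.mp (Face.injOn_charMap hX τ))
  have h3 : Set.range (fun y : properCell σ ⟨τ, h⟩ => σ.charMap y.1.1) =
      Set.range fun y : Metric.closedBall (0 : Fin τ.dim → ℝ) 1 => τ.charMap y.1 := by
    ext x
    constructor
    · rintro ⟨⟨y, hy⟩, rfl⟩
      rw [properCell_coe] at hy
      obtain ⟨z, hz, hzy⟩ := hy
      exact ⟨⟨z, hz⟩, hzy⟩
    · rintro ⟨z, rfl⟩
      have hz : τ.charMap z.1 ∈ τ.closed := ⟨z.1, z.2, rfl⟩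
      obtain ⟨y, hy, hyz⟩ := Face.closed_subset_frontier hX hlt hz
      refine ⟨⟨⟨y, hy⟩, ?_⟩, hyz⟩
      rw [properCell_coe]
      have h5 : σ.charMap y = τ.charMap z.1 := hyz
      rwa [Set.mem_ofPred_eq, h5]
  have h4 : ContractibleSpace (Metric.closedBall (0 : Fin τ.dim → ℝ) 1) :=
    (convex_closedBall (0 : Fin τ.dim → ℝ) 1).contractibleSpace
      (Metric.nonempty_closedBall.mpr zero_le_one)
  exact (h1.isEmbedding.toHomeomorph.trans ((Homeomorph.setCongr h3).trans
    h2.isEmbedding.toHomeomorph.symm)).contractibleSpace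

/-- The codimension-one faces cover the sphere, and two closed faces meet in a union of common
faces; both facts rest on regularity. -/
theorem isCover_properCell [T2Space X] (hX : IsRegularCW X)
    (hdd : ∀ x, cellularBoundary X (cellularBoundary X x) = 0) (σ : Face X)
    (hσ : ∀ τ, τ < σ → IsAcyclicFace τ) :
    (properStructure hX hdd σ hσ).IsCover (properCell σ) where
  closed := isClosed_properCell σ
  mono := by
    rintro ⟨p, hp⟩ ⟨q, hq⟩ h y ⟨τ, h1, h2⟩
    have h3 : (τ : WithBot (Face X)) ≤ q := h1.trans_le h
    obtain ⟨ρ, rfl⟩ : ∃ ρ : Face X, (ρ : WithBot (Face X)) = q :=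
      WithBot.ne_bot_iff_exists.mp (ne_bot_of_le_ne_bot WithBot.coe_ne_bot h3)
    exact ⟨ρ, rfl, WithBot.coe_le_coe.mp h3 h2⟩
  bot := by
    ext y
    constructor
    · rintro ⟨τ, h, -⟩
      exact absurd h WithBot.coe_ne_bot
    · exact fun h => absurd h (Set.notMem_empty y)
  inter := by
    rintro ⟨p, hp⟩ ⟨q, hq⟩ y ⟨τ, h1, h2⟩ ⟨τ', h3, h4⟩
    obtain ⟨ρ, h5, h6, h7⟩ := Face.mem_closed_inter hX h2 h4
    have h8 : (ρ : WithBot (Face X)) ≤ p := (WithBot.coe_le_coe.mpr h5).trans_eq h1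
    exact ⟨⟨ρ, h8.trans_lt hp⟩, h8, (WithBot.coe_le_coe.mpr h6).trans_eq h3, ρ, rfl, h7⟩
  cover y := by
    obtain ⟨ρ, h1, h2, h3⟩ := Face.exists_codim_one hX (σ := σ) ⟨y.1, y.2, rfl⟩
    have h4 : ρ < σ := lt_of_le_of_ne h1 (by
      rintro rfl
      omega)
    exact ⟨⟨ρ, WithBot.coe_lt_coe.mpr h4⟩, ρ, rfl, h3⟩
  acyclic := by
    rintro ⟨q, hq⟩ hne
    induction q using WithBot.recBotCoe with
    | bot => exact absurd rfl hne
    | coe τ =>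
      have := contractibleSpace_properCell hX hq
      exact smallAcyclic_of_contractible (isClosed_properCell σ _).isCompact

/-- The augmented cellular complex of a closed cell of a regular complex is acyclic. -/
theorem isAcyclicFace [T2Space X] (hX : IsRegularCW X)
    (hdd : ∀ x, cellularBoundary X (cellularBoundary X x) = 0) (σ : Face X) : IsAcyclicFace σ := by
  induction hd : σ.dim using Nat.strong_induction_on generalizing σ with
  | _ d ih =>
  have hσ : ∀ τ, τ < σ → IsAcyclicFace τ := fun τ h => ih _ (hd ▸ Face.dim_lt_of_lt h) τ rfl
  -- Compares the proper faces with the hemispheres on the boundary sphere; the range of degrees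
  -- reaches the top rank `σ.dim`.
  obtain ⟨Θ, hΘ⟩ := (isCover_properCell hX hdd σ hσ).exists_map Hemisphere.isCover σ.dim
  set K := properStructure hX hdd σ hσ with hK
  have hval : Function.Injective (Subtype.val : ProperFace σ → WithBot (Face X)) :=
    Subtype.val_injective
  -- Below the top every cycle of hemispheres bounds, and `Θ` is injective on homology.
  have hlow : ∀ k < σ.dim, ∀ z ∈ spanOn {ρ | K.rk ρ = k}, K.bd z = 0 →
      ∃ w ∈ spanOn {ρ | K.rk ρ = k + 1}, K.bd w = z := by
    intro k hk z hz hz0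
    obtain ⟨h1, h2, h3⟩ := hΘ k hk.le z hz hz0
    refine h3 ?_
    rcases Hemisphere.eq_zero_or_fundamental h1 h2 with h | h
    · exact ⟨0, Submodule.zero_mem _, by rw [h, map_zero]⟩
    · refine ⟨gen (Hemisphere.cell k hk true), gen_mem_spanOn rfl, ?_⟩
      rw [h]
      exact Hemisphere.boundary_coe _
  -- No proper face has rank `σ.dim + 1`, so in top rank a bounding cycle is zero and `Θ` is
  -- injective on cycles themselves.
  have htop : ∀ z ∈ spanOn {ρ | K.rk ρ = σ.dim}, K.bd z = 0 → Θ z = 0 → z = 0 := by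
    intro z hz hz0 hΘz
    obtain ⟨w, hw, rfl⟩ := (hΘ σ.dim le_rfl z hz hz0).2.2 ⟨0, Submodule.zero_mem _, by
      rw [hΘz, map_zero]⟩
    rw [eq_zero_of_mem_spanOn_empty (fun q hq => ?_) hw, map_zero]
    have h1 : reducedRank q.1 < σ.dim + 1 := reducedRank_strictMono q.2
    have h2 : reducedRank q.1 = σ.dim + 1 := hq
    omega
  have htop2 : ∀ z ∈ spanOn {ρ | K.rk ρ = σ.dim}, K.bd z = 0 →
      ∀ z' ∈ spanOn {ρ | K.rk ρ = σ.dim}, K.bd z' = 0 → z' ≠ 0 → z = 0 ∨ z = z' := by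
    intro z hz hz0 z' hz' hz0' hne
    have h1 := hΘ σ.dim le_rfl z hz hz0
    have h2 := hΘ σ.dim le_rfl z' hz' hz0'
    rcases Hemisphere.eq_zero_or_fundamental h1.1 h1.2.1 with h | h
    · exact Or.inl (htop z hz hz0 h)
    rcases Hemisphere.eq_zero_or_fundamental h2.1 h2.2.1 with h' | h'
    · exact absurd (htop z' hz' hz0' h') hne
    · right
      rw [← add_eq_zero_iff_eq_mod_two]
      exact htop _ (Submodule.add_mem _ hz hz') (by rw [map_add, hz0, hz0', add_zero])
        (by rw [map_add, h, h', ZModModule.add_self])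
  have hpull : ∀ k ≤ σ.dim, ∀ x ∈ spanOn {ρ : WithBot (Face X) | ρ ≤ σ ∧ reducedRank ρ = k},
      reducedBoundary X x = 0 → ∃ z ∈ spanOn {ρ | K.rk ρ = k}, K.bd z = 0 ∧
        mapGen Subtype.val z = x := by
    intro k hk x hx hx0
    obtain ⟨z, hz, rfl⟩ := exists_mapGen_eq hval (s := {ρ | ρ < σ ∧ reducedRank ρ = k})
      (fun ρ hρ => ⟨⟨ρ, hρ.1⟩, rfl⟩)
      (by
        refine spanOn_mono ?_ hx
        refine fun ρ hρ => ⟨lt_of_le_of_ne hρ.1 ?_, hρ.2⟩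
        rintro rfl
        have h1 := hρ.2
        rw [reducedRank_coe] at h1
        omega)
    refine ⟨z, ?_, mapGen_injective hval ?_, rfl⟩
    · refine spanOn_mono ?_ hz
      exact fun q hq => hq.2
    · rw [map_zero, ← hx0]
      exact mapGen_properBoundary σ z
  intro k x hx hx0
  rcases lt_trichotomy k σ.dim with hk | hk | hk
  · obtain ⟨z, hz, hz0, rfl⟩ := hpull k hk.le x hx hx0
    obtain ⟨w, hw, rfl⟩ := hlow k hk z hz hz0
    refine ⟨mapGen Subtype.val w, ?_, (mapGen_properBoundary σ w).symm⟩
    rw [mapGen_mem_iff hval]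
    refine spanOn_mono ?_ hw
    exact fun q hq => ⟨q.2.le, hq⟩
  · obtain ⟨z, hz, hz0, rfl⟩ := hpull k hk.le x hx hx0
    -- The boundary of `σ` is a nonzero top cycle, hence the only one; `σ` itself fills it.
    obtain ⟨b, hb, hb0, hbe⟩ := hpull σ.dim le_rfl (reducedBoundary X (gen (σ : WithBot (Face X))))
      (by
        refine spanOn_mono ?_ (reducedBoundary_mem (σ : WithBot (Face X)))
        exact fun ρ hρ => ⟨hρ.1, Nat.succ_injective hρ.2⟩)
      (reducedBoundary_reducedBoundary hX hdd _)
    subst hk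
    rcases htop2 z hz hz0 b hb hb0 (by
      rintro rfl
      rw [map_zero] at hbe
      exact reducedBoundary_ne_zero hX σ hbe.symm) with h | h
    · exact ⟨0, Submodule.zero_mem _, by rw [h, map_zero, map_zero]⟩
    · refine ⟨gen σ, gen_mem_spanOn ⟨le_rfl, rfl⟩, ?_⟩
      rw [h, hbe]
  · have hx1 : x ∈ spanOn {(σ : WithBot (Face X))} := by
      refine spanOn_mono ?_ hx
      intro ρ hρ
      by_contra h
      have h1 := reducedRank_strictMono (lt_of_le_of_ne hρ.1 h)
      rw [hρ.2, reducedRank_coe] at h1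
      omega
    rcases eq_smul_gen hx1 with h | h
    · exact ⟨0, Submodule.zero_mem _, by rw [h, map_zero]⟩
    · rw [h] at hx0
      exact absurd hx0 (reducedBoundary_ne_zero hX σ)

/-- A positive-dimensional cycle of a closed cell is a boundary there, and so is a sum of an even
number of vertices. -/
theorem exists_boundary_eq [T2Space X] (hX : IsRegularCW X)
    (hdd : ∀ x, cellularBoundary X (cellularBoundary X x) = 0) (σ : Face X) {k : ℕ}
    {x : Chain (Face X)} (hx : x ∈ spanOn {ρ | ρ ≤ σ ∧ ρ.dim = k}) (hx0 : cellularBoundary X x = 0)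
    (haug : k = 0 → augmentation X x = 0) :
    ∃ y ∈ spanOn {ρ | ρ ≤ σ ∧ ρ.dim = k + 1}, cellularBoundary X y = x := by
  have h0 : augmentation X x = 0 := by
    by_cases hk : k = 0
    · exact haug hk
    · have := map_mem_of_mem_spanOn hx (augmentation X) (N := ⊥) fun τ hτ => by
        rw [Submodule.mem_bot, augmentation_gen, if_neg (fun h => hk (by rw [← hτ.2, h]))]
      exact this
  obtain ⟨y, hy, hyx⟩ := isAcyclicFace hX hdd σ (k + 1) (mapGen WithBot.some x)
    (by
      rw [mapGen_mem_iff WithBot.coe_injective]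
      refine spanOn_mono ?_ hx
      exact fun τ hτ => ⟨WithBot.coe_le_coe.mpr hτ.1, congrArg (· + 1) hτ.2⟩)
    (by rw [reducedBoundary_mapGen, hx0, h0, map_zero, zero_smul, add_zero])
  obtain ⟨z, hz, rfl⟩ := exists_mapGen_eq WithBot.coe_injective (by
    rintro ρ ⟨-, hρ⟩
    refine WithBot.ne_bot_iff_exists.mp ?_
    rintro rfl
    simp at hρ) hy
  have hz' : z ∈ spanOn {ρ : Face X | ρ ≤ σ ∧ ρ.dim = k + 1} := by
    refine spanOn_mono ?_ hz
    exact fun τ hτ => ⟨WithBot.coe_le_coe.mp hτ.1, Nat.succ_injective hτ.2⟩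
  refine ⟨z, hz', mapGen_injective WithBot.coe_injective ?_⟩
  have h1 : augmentation X z = 0 := by
    have := map_mem_of_mem_spanOn hz' (augmentation X) (N := ⊥) fun τ hτ => by
      rw [Submodule.mem_bot, augmentation_gen, if_neg (by rw [hτ.2]; omega)]
    exact this
  rwa [reducedBoundary_mapGen, h1, zero_smul, add_zero] at hyx

/-- Every closed cell has a vertex. -/
theorem exists_vertex_le [T2Space X] (hX : IsRegularCW X) (σ : Face X) :
    ∃ v : Face X, v ≤ σ ∧ v.dim = 0 := by
  induction hd : σ.dim generalizing σ with
  | zero => exact ⟨σ, le_rfl, hd⟩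
  | succ d ih =>
    obtain ⟨x, hx⟩ := Topology.RelCWComplex.nonempty_cellFrontier (by omega : σ.dim ≠ 0) σ.cell
    obtain ⟨ρ, h2, h3, -⟩ := Face.exists_codim_one hX hx
    obtain ⟨v, hv, hv0⟩ := ih ρ (by omega)
    exact ⟨v, hv.trans h2, hv0⟩

end ReducedComplex

/-! ### Normalized chains of nerves: cones and induced maps. -/

section NerveChains

variable {Q R : Type*} [PartialOrder Q] [PartialOrder R]

theorem NerveSimplex.card_eq (s : NerveSimplex Q) : s.verts.card = s.dim + 1 := by
  have := s.nonempty.card_pos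
  unfold NerveSimplex.dim
  omega

open Classical in
/-- The nerve chain of a finite set of elements of a poset, `0` if it is not a simplex. -/
noncomputable def nv (s : Finset Q) : Chain (NerveSimplex Q) :=
  if h : s.Nonempty ∧ IsChain (· ≤ ·) (s : Set Q) then gen ⟨s, h.1, h.2⟩ else 0

theorem nv_of_isChain {s : Finset Q} (h1 : s.Nonempty) (h2 : IsChain (· ≤ ·) (s : Set Q)) :
    nv s = gen ⟨s, h1, h2⟩ := dif_pos ⟨h1, h2⟩

theorem nv_verts (s : NerveSimplex Q) : nv s.verts = gen s := nv_of_isChain s.nonempty s.chain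

theorem nv_empty : nv (∅ : Finset Q) = 0 := dif_neg fun h => Finset.not_nonempty_empty h.1

theorem isChain_erase [DecidableEq Q] {s : Finset Q} (h : IsChain (· ≤ ·) (s : Set Q)) (x : Q) :
    IsChain (· ≤ ·) (s.erase x : Set Q) :=
  h.mono (by exact_mod_cast Finset.erase_subset x s)

theorem isChain_insert_top [DecidableEq Q] {s : Finset Q} (h : IsChain (· ≤ ·) (s : Set Q)) {x : Q}
    (hx : ∀ y ∈ s, y ≤ x) : IsChain (· ≤ ·) ((insert x s : Finset Q) : Set Q) := by
  rw [Finset.coe_insert]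
  exact h.insert fun y hy _ => Or.inr (hx y hy)

theorem isChain_image [DecidableEq R] {s : Finset Q} (h : IsChain (· ≤ ·) (s : Set Q)) (f : Q →o R) :
    IsChain (· ≤ ·) (s.image f : Set R) := by
  rw [Finset.coe_image]
  rintro _ ⟨a, ha, rfl⟩ _ ⟨b, hb, rfl⟩ _
  rcases h.total ha hb with h | h
  · exact Or.inl (f.monotone h)
  · exact Or.inr (f.monotone h)

open Classical in
theorem nerveBoundary_nv {s : Finset Q} (h : IsChain (· ≤ ·) (s : Set Q)) :
    nerveBoundary Q (nv s) = ∑ x ∈ s, nv (s.erase x) := by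
  by_cases hs : s.Nonempty
  · rw [nv_of_isChain hs h]
    simp only [nerveBoundary, Finsupp.linearCombination_single, one_smul]
    refine Finset.sum_congr rfl fun x _ => ?_
    by_cases hx : (s.erase x).Nonempty
    · rw [dif_pos hx, nv_of_isChain hx (isChain_erase h x)]
    · rw [dif_neg hx, Finset.not_nonempty_iff_eq_empty.mp hx, nv_empty]
  · rw [Finset.not_nonempty_iff_eq_empty.mp hs, nv_empty, map_zero, Finset.sum_empty]

theorem nerveBoundary_nerveBoundary (x : Chain (NerveSimplex Q)) :
    nerveBoundary Q (nerveBoundary Q x) = 0 := by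
  classical
  suffices h : nerveBoundary Q ∘ₗ nerveBoundary Q = 0 by
    rw [← LinearMap.comp_apply, h, LinearMap.zero_apply]
  refine chain_hom_ext fun s => ?_
  rw [LinearMap.comp_apply, LinearMap.zero_apply, ← nv_verts, nerveBoundary_nv s.chain, map_sum,
    Finset.sum_congr rfl fun x _ => nerveBoundary_nv (isChain_erase s.chain x), Finset.sum_sigma']
  refine Finset.sum_involution (fun p _ => ⟨p.2, p.1⟩) ?_ ?_ ?_ ?_
  · rintro ⟨x, y⟩ _
    rw [Finset.erase_right_comm]
    exact ZModModule.add_self _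
  · rintro ⟨x, y⟩ h _ heq
    simp only [Finset.mem_sigma, Finset.mem_erase] at h
    simp only [Sigma.mk.injEq, heq_eq_eq] at heq
    exact h.2.1 heq.1
  · rintro ⟨x, y⟩ h
    simp only [Finset.mem_sigma, Finset.mem_erase] at h ⊢
    exact ⟨h.2.2, h.2.1.symm, h.1⟩
  · rintro ⟨x, y⟩ _
    rfl

/-- The augmentation of the nerve chains. -/
noncomputable def nerveAugmentation (Q : Type*) [PartialOrder Q] :
    Chain (NerveSimplex Q) →ₗ[ZMod 2] ZMod 2 :=
  Finsupp.linearCombination (ZMod 2) fun s => if s.dim = 0 then 1 else 0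

theorem nerveAugmentation_gen (s : NerveSimplex Q) :
    nerveAugmentation Q (gen s) = if s.dim = 0 then 1 else 0 := by
  simp [nerveAugmentation]

open Classical in
/-- The cone with apex `τ`. -/
noncomputable def cone (τ : Q) : Chain (NerveSimplex Q) →ₗ[ZMod 2] Chain (NerveSimplex Q) :=
  Finsupp.linearCombination (ZMod 2) fun s => if τ ∈ s.verts then 0 else nv (insert τ s.verts)

open Classical in
theorem cone_nv {τ : Q} {s : Finset Q} (h : IsChain (· ≤ ·) (s : Set Q)) (hs : s.Nonempty) :
    cone τ (nv s) = if τ ∈ s then 0 else nv (insert τ s) := by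
  rw [nv_of_isChain hs h]
  simp [cone]

theorem nv_mem {s : Finset Q} {A : Set (NerveSimplex Q)}
    (h : ∀ t : NerveSimplex Q, t.verts = s → t ∈ A) : nv s ∈ spanOn A := by
  unfold nv
  split_ifs with h1
  · exact gen_mem_spanOn (h _ rfl)
  · exact Submodule.zero_mem _

theorem cone_gen_mem {τ : Q} {s : NerveSimplex Q} (hs : ∀ x ∈ s.verts, x ≤ τ) :
    cone τ (gen s) ∈ spanOn {t | (∀ x ∈ t.verts, x ≤ τ) ∧ t.dim = s.dim + 1} := by
  classical
  rw [← nv_verts, cone_nv s.chain s.nonempty]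
  split_ifs with h
  · exact Submodule.zero_mem _
  · refine nv_mem fun t ht => ⟨fun x hx => ?_, ?_⟩
    · rw [ht, Finset.mem_insert] at hx
      rcases hx with rfl | hx
      · exact le_rfl
      · exact hs x hx
    · have h1 := t.card_eq
      rw [ht, Finset.card_insert_of_notMem h, s.card_eq] at h1
      omega

theorem cone_mem {τ : Q} {d : ℕ} {x : Chain (NerveSimplex Q)}
    (hx : x ∈ spanOn {t | (∀ x ∈ t.verts, x ≤ τ) ∧ t.dim = d}) :
    cone τ x ∈ spanOn {t | (∀ x ∈ t.verts, x ≤ τ) ∧ t.dim = d + 1} :=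
  map_mem_of_mem_spanOn hx _ fun _ hs => hs.2 ▸ cone_gen_mem hs.1

/-- When `τ` is not a vertex this is the usual cone formula. When it is, the cone vanishes, and only
the face opposite `τ` has a nonzero cone, which restores the simplex. -/
theorem nerveBoundary_cone {τ : Q} {x : Chain (NerveSimplex Q)}
    (hx : x ∈ spanOn {t | ∀ x ∈ t.verts, x ≤ τ}) :
    nerveBoundary Q (cone τ x) + cone τ (nerveBoundary Q x) =
      x + nerveAugmentation Q x • nv {τ} := by
  classical
  have := eqOn_of_mem_spanOn hx (f := nerveBoundary Q ∘ₗ cone τ + cone τ ∘ₗ nerveBoundary Q)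
    (g := LinearMap.id + (nerveAugmentation Q).smulRight (nv {τ})) fun s hs => ?_
  · exact this
  rw [Set.mem_ofPred_eq] at hs
  simp only [LinearMap.add_apply, LinearMap.comp_apply, LinearMap.id_apply,
    LinearMap.smulRight_apply]
  have hcard := s.card_eq
  rw [nerveAugmentation_gen, ← nv_verts, cone_nv s.chain s.nonempty, nerveBoundary_nv s.chain,
    map_sum]
  have hcone : ∀ x ∈ s.verts, s.dim ≠ 0 → cone τ (nv (s.verts.erase x)) =
      if τ ∈ s.verts.erase x then 0 else nv (insert τ (s.verts.erase x)) := fun x hx h0 => by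
    refine cone_nv (isChain_erase s.chain x) ?_
    rw [← Finset.card_pos, Finset.card_erase_of_mem hx]
    omega
  by_cases h0 : s.dim = 0
  · obtain ⟨v, hv⟩ := Finset.card_eq_one.mp (by rw [hcard, h0])
    rw [hv, Finset.sum_singleton, Finset.erase_singleton, nv_empty, map_zero, add_zero, if_pos h0,
      one_smul]
    by_cases h : τ ∈ ({v} : Finset Q)
    · rw [Finset.mem_singleton] at h
      rw [if_pos (by simp [h]), map_zero, h, ZModModule.add_self]
    · have hvτ : v ≤ τ := hs v (by simp [hv])
      have hne : τ ≠ v := by simpa using h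
      have hch : IsChain (· ≤ ·) ((insert τ {v} : Finset Q) : Set Q) := isChain_insert_top
        (by simp) (by simpa using hvτ)
      rw [if_neg h, nerveBoundary_nv hch, Finset.sum_pair hne, Finset.erase_insert h,
        Finset.pair_comm, Finset.erase_insert (by simpa using hne.symm)]
  · rw [if_neg h0, zero_smul, add_zero, Finset.sum_congr rfl fun x hx => hcone x hx h0]
    by_cases h : τ ∈ s.verts
    · rw [if_pos h, map_zero, zero_add, Finset.sum_eq_single τ]
      · rw [if_neg (Finset.notMem_erase _ _), Finset.insert_erase h]
      · intro x _ hx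
        rw [if_pos (Finset.mem_erase.mpr ⟨hx.symm, h⟩)]
      · exact fun h' => absurd h h'
    · have hch := isChain_insert_top s.chain hs
      rw [if_neg h, nerveBoundary_nv hch, Finset.sum_insert h, Finset.erase_insert h, add_assoc,
        ← Finset.sum_add_distrib, Finset.sum_eq_zero, add_zero]
      intro x hx
      rw [if_neg fun h' => h (Finset.mem_of_mem_erase h'), Finset.erase_insert_of_ne,
        ZModModule.add_self]
      rintro rfl
      exact h hx

open Classical in
theorem nerveMap_nv (f : Q →o R) {s : Finset Q} (h : IsChain (· ≤ ·) (s : Set Q)) :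
    nerveMap f (nv s) = if (s.image f).card = s.card then nv (s.image f) else 0 := by
  by_cases hs : s.Nonempty
  · rw [nv_of_isChain hs h]
    simp only [nerveMap, Finsupp.linearCombination_single, one_smul]
    split_ifs with h1
    · rw [nv_of_isChain]
    · rfl
  · rw [Finset.not_nonempty_iff_eq_empty.mp hs, nv_empty, map_zero]
    simp [nv_empty]

theorem nerveMap_comp {T : Type*} [PartialOrder T] (f : Q →o R) (g : R →o T) :
    nerveMap (g.comp f) = nerveMap g ∘ₗ nerveMap f := by
  classical
  refine chain_hom_ext fun s => ?_
  rw [LinearMap.comp_apply, ← nv_verts, nerveMap_nv _ s.chain, nerveMap_nv _ s.chain]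
  have himg : s.verts.image (g.comp f) = (s.verts.image f).image g := by
    rw [Finset.image_image]
    rfl
  rw [himg]
  by_cases h : (s.verts.image f).card = s.verts.card
  · rw [if_pos h, nerveMap_nv _ (isChain_image s.chain f), h]
  · rw [if_neg h, map_zero, if_neg]
    intro h1
    have h2 := (Finset.card_image_le (s := s.verts.image f) (f := g))
    have h3 := (Finset.card_image_le (s := s.verts) (f := f))
    omega

theorem nerveMap_gen_mem (f : Q →o R) (s : NerveSimplex Q) : nerveMap f (gen s) ∈
    spanOn {t | (∀ y ∈ t.verts, ∃ x ∈ s.verts, f x = y) ∧ t.dim = s.dim} := by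
  classical
  rw [← nv_verts, nerveMap_nv _ s.chain]
  split_ifs with h
  · refine nv_mem fun t ht => ⟨fun y hy => ?_, ?_⟩
    · rw [ht] at hy
      exact Finset.mem_image.mp hy
    · have h1 := t.card_eq
      rw [ht, h, s.card_eq] at h1
      omega
  · exact Submodule.zero_mem _

/-- If `f` identifies two vertices, the simplex goes to zero, and only the faces omitting one of
these two can survive. They have the same image, so they cancel modulo two. -/
theorem nerveBoundary_nerveMap (f : Q →o R) (x : Chain (NerveSimplex Q)) :
    nerveBoundary R (nerveMap f x) = nerveMap f (nerveBoundary Q x) := by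
  classical
  suffices h : nerveBoundary R ∘ₗ nerveMap f = nerveMap f ∘ₗ nerveBoundary Q by
    exact congrArg (fun g => g x) h
  refine chain_hom_ext fun s => ?_
  rw [LinearMap.comp_apply, LinearMap.comp_apply, ← nv_verts, nerveMap_nv _ s.chain,
    nerveBoundary_nv s.chain, map_sum,
    Finset.sum_congr rfl fun x _ => nerveMap_nv f (isChain_erase s.chain x)]
  by_cases h : Set.InjOn f s.verts
  · rw [if_pos (Finset.card_image_of_injOn h), nerveBoundary_nv (isChain_image s.chain f),
      Finset.sum_image h]
    refine Finset.sum_congr rfl fun x hx => ?_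
    have h1 : (s.verts.image f).erase (f x) = (s.verts.erase x).image f := by
      ext y
      simp only [Finset.mem_erase, Finset.mem_image]
      constructor
      · rintro ⟨hy, z, hz, rfl⟩
        exact ⟨z, ⟨fun h => hy (h ▸ rfl), hz⟩, rfl⟩
      · rintro ⟨z, ⟨hzx, hz⟩, rfl⟩
        exact ⟨fun h' => hzx (h hz hx h'), z, hz, rfl⟩
    rw [if_pos (Finset.card_image_of_injOn (h.mono (by
      exact_mod_cast Finset.erase_subset x s.verts))), h1]
  · rw [if_neg fun h' => h (Finset.card_image_iff.mp h'), map_zero]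
    obtain ⟨a, ha, b, hb, hab, hne⟩ : ∃ a ∈ s.verts, ∃ b ∈ s.verts, f a = f b ∧ a ≠ b := by
      simp only [Set.InjOn] at h
      push Not at h
      exact_mod_cast h
    have h1 : ∀ a ∈ s.verts, ∀ b ∈ s.verts, f a = f b → a ≠ b →
        (s.verts.erase a).image f = s.verts.image f := fun a ha b hb hab hne => by
      refine (Finset.image_subset_image (Finset.erase_subset _ _)).antisymm fun y hy => ?_
      obtain ⟨z, hz, rfl⟩ := Finset.mem_image.mp hy
      by_cases hza : z = a
      · exact Finset.mem_image.mpr ⟨b, Finset.mem_erase.mpr ⟨hne.symm, hb⟩, by rw [hza, hab]⟩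
      · exact Finset.mem_image_of_mem _ (Finset.mem_erase.mpr ⟨hza, hz⟩)
    rw [← Finset.sum_subset (s₁ := {a, b}), Finset.sum_pair hne, h1 a ha b hb hab hne,
      h1 b hb a ha hab.symm hne.symm, Finset.card_erase_of_mem ha, Finset.card_erase_of_mem hb,
      ZModModule.add_self]
    · intro x hx
      rcases Finset.mem_insert.mp hx with rfl | hx
      · exact ha
      · rw [Finset.mem_singleton.mp hx]
        exact hb
    · intro x hx hx2
      simp only [Finset.mem_insert, Finset.mem_singleton, not_or] at hx2
      rw [if_neg]
      intro h2
      exact hne (Finset.card_image_iff.mp h2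
        (Finset.mem_coe.mpr (Finset.mem_erase.mpr ⟨fun h => hx2.1 h.symm, ha⟩))
        (Finset.mem_coe.mpr (Finset.mem_erase.mpr ⟨fun h => hx2.2 h.symm, hb⟩)) hab)

end NerveChains

/-! ### The subdivision map as a chain map. -/

section Subdivision

variable {X : Type*} [TopologicalSpace X] [Topology.CWComplex (Set.univ : Set X)]

/-- A chain of cells has a greatest member, whose dimension bounds the size of the chain. -/
theorem exists_greatest_of_isChain {s : Finset (Face X)} (hs : s.Nonempty)
    (h : IsChain (· ≤ ·) (s : Set (Face X))) :
    ∃ m ∈ s, (∀ x ∈ s, x ≤ m) ∧ s.card ≤ m.dim + 1 := by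
  classical
  obtain ⟨m, hm, hmax⟩ := s.exists_max_image Face.dim hs
  have hle : ∀ x ∈ s, x ≤ m := fun x hx => by
    rcases h.total hx hm with h1 | h1
    · exact h1
    · rcases h1.eq_or_lt with h2 | h2
      · exact h2.ge
      · exact absurd (hmax x hx) (not_le.mpr (Face.dim_lt_of_lt h2))
  refine ⟨m, hm, hle, ?_⟩
  have hinj : Set.InjOn Face.dim (s : Set (Face X)) := fun x hx y hy hxy => by
    by_contra hne
    rcases h.total hx hy with h1 | h1
    · exact absurd hxy (Face.dim_lt_of_lt (lt_of_le_of_ne h1 hne)).ne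
    · exact absurd hxy.symm (Face.dim_lt_of_lt (lt_of_le_of_ne h1 (Ne.symm hne))).ne
  rw [← Finset.card_image_of_injOn hinj, ← Finset.card_range (m.dim + 1)]
  refine Finset.card_le_card fun d hd => ?_
  obtain ⟨x, hx, rfl⟩ := Finset.mem_image.mp hd
  have := hmax x hx
  exact Finset.mem_range.mpr (by omega)

open Classical in
/-- The full flags of faces of a cell. -/
noncomputable def flags (σ : Face X) : Finset (Finset (Face X)) :=
  σ.below.powerset.filter fun s => s.card = σ.dim + 1 ∧ IsChain (· ≤ ·) (s : Set (Face X))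

theorem mem_flags {σ : Face X} {s : Finset (Face X)} : s ∈ flags σ ↔
    (∀ x ∈ s, x ≤ σ) ∧ s.card = σ.dim + 1 ∧ IsChain (· ≤ ·) (s : Set (Face X)) := by
  simp [flags, Finset.subset_iff, Face.mem_below]

theorem subdivision_gen (σ : Face X) : subdivision X (gen σ) = ∑ s ∈ flags σ, nv s := by
  classical
  simp only [subdivision, Finsupp.linearCombination_single, one_smul]
  rw [flags, Finset.sum_filter]
  refine Finset.sum_congr rfl fun s _ => ?_
  split_ifs with h
  · rw [nv_of_isChain _ h.2]
  · rfl

/-- Dimension increases strictly along a chain, so a chain of `σ.dim + 1` faces must end in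
dimension `σ.dim`, which only `σ` has among its faces. -/
theorem mem_of_mem_flags {σ : Face X} {s : Finset (Face X)} (h : s ∈ flags σ) : σ ∈ s := by
  obtain ⟨h1, h2, h3⟩ := mem_flags.mp h
  obtain ⟨m, hm, -, hcard⟩ := exists_greatest_of_isChain (Finset.card_pos.mp (by omega)) h3
  rcases (h1 m hm).eq_or_lt with h | h
  · exact h ▸ hm
  · have := Face.dim_lt_of_lt h
    omega

theorem subdivision_vertex {v : Face X} (hv : v.dim = 0) : subdivision X (gen v) = nv {v} := by
  rw [subdivision_gen]
  have : flags v = {{v}} := by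
    ext s
    rw [Finset.mem_singleton]
    constructor
    · intro h
      obtain ⟨w, hw⟩ := Finset.card_eq_one.mp ((mem_flags.mp h).2.1.trans (by rw [hv]))
      have := mem_of_mem_flags h
      rw [hw, Finset.mem_singleton] at this
      rw [hw, this]
    · rintro rfl
      exact mem_flags.mpr ⟨by simp, by simp [hv], by simp⟩
  rw [this, Finset.sum_singleton]

/-- Deleting `σ` from a full flag leaves a full flag of its greatest remaining member, a face of
codimension one. -/
theorem subdivision_eq_cone {σ : Face X} (hσ : σ.dim ≠ 0) :
    subdivision X (gen σ) = cone σ (subdivision X (cellularBoundary X (gen σ))) := by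
  classical
  rw [cellularBoundary_gen, ← Finset.sum_filter, map_sum, map_sum, subdivision_gen]
  have hcone : ∀ τ ∈ σ.below.filter (fun τ => τ.dim + 1 = σ.dim),
      cone σ (subdivision X (gen τ)) = ∑ t ∈ flags τ, nv (insert σ t) := fun τ hτ => by
    rw [subdivision_gen, map_sum]
    refine Finset.sum_congr rfl fun t ht => ?_
    obtain ⟨h1, h2, h3⟩ := mem_flags.mp ht
    rw [cone_nv h3 (Finset.card_pos.mp (by omega)), if_neg]
    intro h4
    have h5 := h1 σ h4
    obtain ⟨h6, h7⟩ := Finset.mem_filter.mp hτ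
    rw [(Face.mem_below.mp h6).antisymm h5] at h7
    omega
  rw [Finset.sum_congr rfl hcone, Finset.sum_sigma']
  symm
  refine Finset.sum_bij (fun p _ => insert σ p.2) ?_ ?_ ?_ fun _ _ => rfl
  · rintro ⟨τ, t⟩ h
    simp only [Finset.mem_sigma, Finset.mem_filter, Face.mem_below] at h
    obtain ⟨⟨hτ, hd⟩, ht⟩ := h
    obtain ⟨h1, h2, h3⟩ := mem_flags.mp ht
    have hle : ∀ x ∈ t, x ≤ σ := fun x hx => (h1 x hx).trans hτ
    refine mem_flags.mpr ⟨fun x hx => ?_, ?_, isChain_insert_top h3 hle⟩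
    · rcases Finset.mem_insert.mp hx with rfl | hx
      · exact le_rfl
      · exact hle x hx
    · rw [Finset.card_insert_of_notMem, h2, hd]
      intro h4
      rw [hτ.antisymm (h1 σ h4)] at hd
      omega
  · rintro ⟨τ, t⟩ h ⟨τ', t'⟩ h' heq
    simp only [Finset.mem_sigma, Finset.mem_filter, Face.mem_below] at h h'
    have hnot : ∀ ρ : Face X, ρ ≤ σ → ρ.dim + 1 = σ.dim → ∀ s ∈ flags ρ, σ ∉ s :=
      fun ρ h1 h2 s hs h3 => by
        rw [h1.antisymm ((mem_flags.mp hs).1 σ h3)] at h2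
        omega
    have htt : t = t' := by
      have := congrArg (fun s => Finset.erase s σ) heq
      simpa [Finset.erase_insert, hnot τ h.1.1 h.1.2 t h.2, hnot τ' h'.1.1 h'.1.2 t' h'.2]
        using this
    subst htt
    have : τ = τ' := ((mem_flags.mp h'.2).1 τ (mem_of_mem_flags h.2)).antisymm
      ((mem_flags.mp h.2).1 τ' (mem_of_mem_flags h'.2))
    subst this
    rfl
  · intro s hs
    have hσs := mem_of_mem_flags hs
    obtain ⟨h1, h2, h3⟩ := mem_flags.mp hs
    have hcard : (s.erase σ).card = σ.dim := by
      rw [Finset.card_erase_of_mem hσs, h2, Nat.add_sub_cancel]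
    have hch := isChain_erase h3 σ
    obtain ⟨m, hm, hle, hm2⟩ := exists_greatest_of_isChain (Finset.card_pos.mp (by omega)) hch
    obtain ⟨hmσ, hms⟩ := Finset.mem_erase.mp hm
    have hlt := Face.dim_lt_of_lt (lt_of_le_of_ne (h1 m hms) hmσ)
    have hd : m.dim + 1 = σ.dim := by omega
    refine ⟨⟨m, s.erase σ⟩, ?_, Finset.insert_erase hσs⟩
    simp only [Finset.mem_sigma, Finset.mem_filter, Face.mem_below]
    exact ⟨⟨h1 m hms, hd⟩, mem_flags.mpr ⟨hle, by omega, hch⟩⟩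

theorem subdivision_mem (σ : Face X) : subdivision X (gen σ) ∈
    spanOn {t | (∀ x ∈ t.verts, x ≤ σ) ∧ t.dim = σ.dim} := by
  rw [subdivision_gen]
  refine Submodule.sum_mem _ fun s hs => nv_mem fun t ht => ?_
  obtain ⟨h1, h2, -⟩ := mem_flags.mp hs
  refine ⟨fun x hx => h1 x (ht ▸ hx), ?_⟩
  have h3 := t.card_eq
  rw [ht] at h3
  omega

theorem nerveAugmentation_subdivision (x : Chain (Face X)) :
    nerveAugmentation (Face X) (subdivision X x) = augmentation X x := by
  suffices h : nerveAugmentation (Face X) ∘ₗ subdivision X = augmentation X from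
    congrArg (fun g => g x) h
  refine chain_hom_ext fun σ => ?_
  rw [LinearMap.comp_apply, augmentation_gen]
  split_ifs with h
  · rw [subdivision_vertex h, nv_of_isChain (Finset.singleton_nonempty σ) (by simp),
      nerveAugmentation_gen, if_pos]
    simp [NerveSimplex.dim]
  · have := map_mem_of_mem_spanOn (subdivision_mem σ) (nerveAugmentation (Face X)) (N := ⊥)
      fun t ht => by
        rw [Submodule.mem_bot, nerveAugmentation_gen, if_neg (by rw [ht.2]; exact h)]
    exact this

/-- By induction on dimension, the subdivided boundary of `σ` is a cycle of augmentation zero, so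
the cone over it, which is the subdivision of `σ`, has it as boundary. -/
theorem nerveBoundary_subdivision [T2Space X] (hX : IsRegularCW X)
    (hdd : ∀ x, cellularBoundary X (cellularBoundary X x) = 0) (x : Chain (Face X)) :
    nerveBoundary (Face X) (subdivision X x) = subdivision X (cellularBoundary X x) := by
  classical
  suffices h : ∀ σ : Face X, nerveBoundary (Face X) (subdivision X (gen σ)) =
      subdivision X (cellularBoundary X (gen σ)) from
    eqOn_of_mem_spanOn (mem_spanOn_support x) (f := nerveBoundary (Face X) ∘ₗ subdivision X)
      (g := subdivision X ∘ₗ cellularBoundary X) fun σ _ => h σ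
  intro σ
  induction hd : σ.dim using Nat.strong_induction_on generalizing σ with
  | _ d ih =>
  by_cases h0 : σ.dim = 0
  · rw [eq_zero_of_mem_spanOn_empty (fun τ hτ => by
      have := hτ.2
      omega) (cellularBoundary_mem σ), map_zero, subdivision_vertex h0,
      nerveBoundary_nv (by simp), Finset.sum_singleton, Finset.erase_singleton, nv_empty]
  · have h1 : nerveBoundary (Face X) (subdivision X (cellularBoundary X (gen σ))) =
        subdivision X (cellularBoundary X (cellularBoundary X (gen σ))) :=
      eqOn_of_mem_spanOn (cellularBoundary_mem σ)
        (f := nerveBoundary (Face X) ∘ₗ subdivision X)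
        (g := subdivision X ∘ₗ cellularBoundary X)
        fun τ hτ => ih τ.dim (by have := hτ.2; omega) τ rfl
    rw [hdd, map_zero] at h1
    have h2 := nerveBoundary_cone (τ := σ) (x := subdivision X (cellularBoundary X (gen σ)))
      (map_mem_of_mem_spanOn (cellularBoundary_mem σ) _ fun τ hτ => by
        refine spanOn_mono ?_ (subdivision_mem τ)
        exact fun t ht x hx => (ht.1 x hx).trans hτ.1)
    rw [h1, map_zero, add_zero, nerveAugmentation_subdivision, augmentation_boundary hX, zero_smul,
      add_zero] at h2
    rw [subdivision_eq_cone h0, h2]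

theorem exists_greatest (s : NerveSimplex (Face X)) : ∃ m ∈ s.verts, ∀ x ∈ s.verts, x ≤ m := by
  obtain ⟨m, hm, h, -⟩ := exists_greatest_of_isChain s.nonempty s.chain
  exact ⟨m, hm, h⟩

theorem nerveBoundary_gen_mem {Q : Type*} [PartialOrder Q] (s : NerveSimplex Q) :
    nerveBoundary Q (gen s) ∈ spanOn {t | t.verts ⊆ s.verts ∧ t.dim + 1 = s.dim} := by
  classical
  rw [← nv_verts, nerveBoundary_nv s.chain]
  refine Submodule.sum_mem _ fun x hx => nv_mem fun t ht => ⟨ht ▸ Finset.erase_subset _ _, ?_⟩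
  have h1 := t.card_eq
  have h2 := s.card_eq
  rw [ht, Finset.card_erase_of_mem hx] at h1
  omega

theorem nerveAugmentation_boundary {Q : Type*} [PartialOrder Q] (x : Chain (NerveSimplex Q)) :
    nerveAugmentation Q (nerveBoundary Q x) = 0 := by
  classical
  suffices h : nerveAugmentation Q ∘ₗ nerveBoundary Q = 0 from congrArg (fun g => g x) h
  refine chain_hom_ext fun s => ?_
  rw [LinearMap.comp_apply, LinearMap.zero_apply]
  by_cases h : s.dim = 1
  · rw [← nv_verts, nerveBoundary_nv s.chain, map_sum,
      Finset.sum_congr rfl (g := fun _ => (1 : ZMod 2)), Finset.sum_const, s.card_eq, h]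
    · decide
    · intro x hx
      have hc : (s.verts.erase x).card = 1 := by
        rw [Finset.card_erase_of_mem hx, s.card_eq, h]
      rw [nv_of_isChain (Finset.card_pos.mp (by omega)) (isChain_erase s.chain x),
        nerveAugmentation_gen, if_pos]
      simp [NerveSimplex.dim, hc]
  · have := map_mem_of_mem_spanOn (nerveBoundary_gen_mem s) (nerveAugmentation Q) (N := ⊥)
      fun t ht => by
        rw [Submodule.mem_bot, nerveAugmentation_gen, if_neg (fun h0 => h (by rw [← ht.2, h0]))]
    exact this

end Subdivision

/-! ### Subdivision as a homotopy equivalence, by acyclic carriers. -/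

section Comparison

variable {X : Type*} [TopologicalSpace X] [Topology.CWComplex (Set.univ : Set X)]

theorem augmentation_eq_zero {d : ℕ} (hd : d ≠ 0) {x : Chain (Face X)}
    (hx : x ∈ spanOn {ρ | ρ.dim = d}) : augmentation X x = 0 := by
  have := map_mem_of_mem_spanOn hx (augmentation X) (N := ⊥) fun τ hτ => by
    rw [Submodule.mem_bot, augmentation_gen, if_neg (fun h => hd (by rw [← hτ, h]))]
  exact this

theorem nerveAugmentation_eq_zero {Q : Type*} [PartialOrder Q] {d : ℕ} (hd : d ≠ 0)
    {x : Chain (NerveSimplex Q)} (hx : x ∈ spanOn {s | s.dim = d}) :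
    nerveAugmentation Q x = 0 := by
  have := map_mem_of_mem_spanOn hx (nerveAugmentation Q) (N := ⊥) fun τ hτ => by
    rw [Submodule.mem_bot, nerveAugmentation_gen, if_neg (fun h => hd (by rw [← hτ, h]))]
  exact this

theorem carried_mem {g : Chain (NerveSimplex (Face X)) →ₗ[ZMod 2] Chain (Face X)}
    (hg : ∀ s, ∀ m, (∀ x ∈ s.verts, x ≤ m) → g (gen s) ∈ spanOn {ρ | ρ ≤ m ∧ ρ.dim = s.dim})
    {σ : Face X} {d : ℕ} {x : Chain (NerveSimplex (Face X))}
    (hx : x ∈ spanOn {s | (∀ v ∈ s.verts, v ≤ σ) ∧ s.dim = d}) :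
    g x ∈ spanOn {ρ | ρ ≤ σ ∧ ρ.dim = d} :=
  map_mem_of_mem_spanOn hx g fun s hs => hs.2 ▸ hg s σ hs.1

theorem subdivision_mem_of_mem {σ : Face X} {d : ℕ} {x : Chain (Face X)}
    (hx : x ∈ spanOn {ρ | ρ ≤ σ ∧ ρ.dim = d}) :
    subdivision X x ∈ spanOn {s | (∀ v ∈ s.verts, v ≤ σ) ∧ s.dim = d} :=
  map_mem_of_mem_spanOn hx _ fun ρ hρ => by
    refine spanOn_mono ?_ (subdivision_mem ρ)
    exact fun t ht => ⟨fun v hv => (ht.1 v hv).trans hρ.1, ht.2.trans hρ.2⟩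

variable [T2Space X]

/-- A chain map from the nerve of the face poset to the cellular chains, carried by the closed
cells. -/
theorem exists_carried_map (hX : IsRegularCW X)
    (hdd : ∀ x, cellularBoundary X (cellularBoundary X x) = 0) :
    ∃ g : Chain (NerveSimplex (Face X)) →ₗ[ZMod 2] Chain (Face X),
      (∀ x, cellularBoundary X (g x) = g (nerveBoundary (Face X) x)) ∧
      (∀ x, augmentation X (g x) = nerveAugmentation (Face X) x) ∧
      ∀ s, ∀ m, (∀ x ∈ s.verts, x ≤ m) → g (gen s) ∈ spanOn {ρ | ρ ≤ m ∧ ρ.dim = s.dim} := by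
  obtain ⟨g, hg⟩ := exists_homotopy (B := NerveSimplex (Face X)) NerveSimplex.dim
    (nerveBoundary (Face X)) (cellularBoundary X) Set.univ 0
    (fun s y => (∀ m, (∀ x ∈ s.verts, x ≤ m) → y ∈ spanOn {ρ | ρ ≤ m ∧ ρ.dim = s.dim}) ∧
      (s.dim = 0 → augmentation X y = 1))
    (fun s _ => by
      refine spanOn_mono ?_ (nerveBoundary_gen_mem s)
      exact fun t ht => ⟨trivial, by have := ht.2; omega⟩)
    (fun s _ => nerveBoundary_nerveBoundary _) (fun s _ => by simp)
    (by
      intro s _ h ih hcyc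
      rw [LinearMap.zero_apply, zero_add] at hcyc ⊢
      obtain ⟨m, hm, hmax⟩ := exists_greatest s
      have huniv : ∀ y, ∀ m', (∀ x ∈ s.verts, x ≤ m') → y ∈ spanOn {ρ | ρ ≤ m ∧ ρ.dim = s.dim} →
          y ∈ spanOn {ρ | ρ ≤ m' ∧ ρ.dim = s.dim} := fun y m' hm' hy => by
        refine spanOn_mono ?_ hy
        exact fun ρ hρ => ⟨hρ.1.trans (hm' m hm), hρ.2⟩
      rcases hd : s.dim with _ | d
      · obtain ⟨v, hv, hv0⟩ := exists_vertex_le hX m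
        refine ⟨gen v, ⟨fun m' hm' => gen_mem_spanOn ⟨hv.trans (hm' m hm), hv0⟩, fun _ => ?_⟩, ?_⟩
        · rw [augmentation_gen, if_pos hv0]
        · rw [eq_zero_of_mem_spanOn_empty (fun τ hτ => by
            have := hτ.2
            omega) (cellularBoundary_mem v), eq_zero_of_mem_spanOn_empty (fun τ hτ => by
            have := hτ.2
            omega) (nerveBoundary_gen_mem s), map_zero]
      · have hmem : h (nerveBoundary (Face X) (gen s)) ∈ spanOn {ρ | ρ ≤ m ∧ ρ.dim = d} :=
          map_mem_of_mem_spanOn (nerveBoundary_gen_mem s) h fun t ht => by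
            have h1 := ((ih t trivial (by have := ht.2; omega)).1).1 m fun x hx => hmax x (ht.1 hx)
            have h2 : t.dim = d := by have := ht.2; omega
            rwa [h2] at h1
        -- For an edge of the nerve the filling needs augmentation zero, which follows from the
        -- normalization on vertices carried through the recursion.
        obtain ⟨y, hy, hyx⟩ := exists_boundary_eq hX hdd m hmem hcyc fun hd0 => by
          have h1 : augmentation X (h (nerveBoundary (Face X) (gen s))) =
              nerveAugmentation (Face X) (nerveBoundary (Face X) (gen s)) :=
            eqOn_of_mem_spanOn (nerveBoundary_gen_mem s) (f := augmentation X ∘ₗ h)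
              fun t ht => by
                have h2 : t.dim = 0 := by have := ht.2; omega
                rw [LinearMap.comp_apply, (ih t trivial (by omega)).1.2 h2, nerveAugmentation_gen,
                  if_pos h2]
          rw [h1, nerveAugmentation_boundary]
        refine ⟨y, ⟨fun m' hm' => ?_, fun h0 => by omega⟩, hyx⟩
        have := huniv y m' hm' (hd ▸ hy)
        rwa [hd] at this)
  have hgm : ∀ s : NerveSimplex (Face X), ∀ m, (∀ x ∈ s.verts, x ≤ m) →
      g (gen s) ∈ spanOn {ρ | ρ ≤ m ∧ ρ.dim = s.dim} := fun s => (hg s trivial).1.1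
  refine ⟨g, fun x => ?_, fun x => ?_, hgm⟩
  · refine eqOn_of_mem_spanOn (mem_spanOn_support x) (f := cellularBoundary X ∘ₗ g)
      (g := g ∘ₗ nerveBoundary (Face X)) fun s _ => ?_
    have := (hg s trivial).2
    rw [LinearMap.zero_apply, add_eq_zero_iff_eq_mod_two] at this
    exact this
  · refine eqOn_of_mem_spanOn (mem_spanOn_support x) (f := augmentation X ∘ₗ g) fun s _ => ?_
    rw [LinearMap.comp_apply, nerveAugmentation_gen]
    split_ifs with h
    · exact (hg s trivial).1.2 h
    · obtain ⟨m, -, hmax⟩ := exists_greatest s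
      refine augmentation_eq_zero h (spanOn_mono ?_ (hgm s m hmax))
      exact fun ρ hρ => hρ.2

/-- Both `subdivision X ∘ₗ g` and the identity are carried by the nerve below the greatest vertex of
a simplex, which is contracted by the cone over that vertex. -/
theorem exists_homotopy_nerve (hX : IsRegularCW X)
    (hdd : ∀ x, cellularBoundary X (cellularBoundary X x) = 0)
    {g : Chain (NerveSimplex (Face X)) →ₗ[ZMod 2] Chain (Face X)}
    (hg : ∀ x, cellularBoundary X (g x) = g (nerveBoundary (Face X) x))
    (hga : ∀ x, augmentation X (g x) = nerveAugmentation (Face X) x)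
    (hgm : ∀ s, ∀ m, (∀ x ∈ s.verts, x ≤ m) → g (gen s) ∈ spanOn {ρ | ρ ≤ m ∧ ρ.dim = s.dim}) :
    ∃ h : Chain (NerveSimplex (Face X)) →ₗ[ZMod 2] Chain (NerveSimplex (Face X)),
      (∀ s, h (gen s) ∈ spanOn {t | t.dim = s.dim + 1}) ∧
      ∀ x, nerveBoundary (Face X) (h x) + h (nerveBoundary (Face X) x) =
        subdivision X (g x) + x := by
  obtain ⟨h, hh⟩ := exists_homotopy (B := NerveSimplex (Face X)) NerveSimplex.dim
    (nerveBoundary (Face X)) (nerveBoundary (Face X)) Set.univ (subdivision X ∘ₗ g + LinearMap.id)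
    (fun s y => ∀ m, (∀ x ∈ s.verts, x ≤ m) →
      y ∈ spanOn {t | (∀ x ∈ t.verts, x ≤ m) ∧ t.dim = s.dim + 1})
    (fun s _ => by
      refine spanOn_mono ?_ (nerveBoundary_gen_mem s)
      exact fun t ht => ⟨trivial, by have := ht.2; omega⟩)
    (fun s _ => nerveBoundary_nerveBoundary _)
    (fun s _ => by
      simp only [LinearMap.add_apply, LinearMap.comp_apply, LinearMap.id_apply, map_add]
      rw [nerveBoundary_subdivision hX hdd, hg])
    (by
      intro s _ h ih hcyc
      simp only [LinearMap.add_apply, LinearMap.comp_apply, LinearMap.id_apply] at hcyc ⊢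
      obtain ⟨m, hm, hmax⟩ := exists_greatest s
      have hmem1 : subdivision X (g (gen s)) + gen s ∈
          spanOn {t | (∀ x ∈ t.verts, x ≤ m) ∧ t.dim = s.dim} :=
        Submodule.add_mem _ (subdivision_mem_of_mem (hgm s m hmax)) (gen_mem_spanOn ⟨hmax, rfl⟩)
      have hmem2 : h (nerveBoundary (Face X) (gen s)) ∈
          spanOn {t | (∀ x ∈ t.verts, x ≤ m) ∧ t.dim = s.dim} :=
        map_mem_of_mem_spanOn (nerveBoundary_gen_mem s) h fun t ht => by
          have h1 := (ih t trivial (by have := ht.2; omega)).1 m fun x hx => hmax x (ht.1 hx)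
          rwa [ht.2] at h1
      have hmem := Submodule.add_mem _ hmem1 hmem2
      refine ⟨cone m (subdivision X (g (gen s)) + gen s + h (nerveBoundary (Face X) (gen s))),
        fun m' hm' => ?_, ?_⟩
      · refine spanOn_mono ?_ (cone_mem hmem)
        exact fun t ht => ⟨fun x hx => (ht.1 x hx).trans (hm' m hm), ht.2⟩
      · have h1 := nerveBoundary_cone (τ := m) (spanOn_mono (fun t ht => ht.1) hmem)
        have h2 : nerveAugmentation (Face X)
            (subdivision X (g (gen s)) + gen s + h (nerveBoundary (Face X) (gen s))) = 0 := by
          by_cases hd : s.dim = 0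
          · rw [eq_zero_of_mem_spanOn_empty (fun τ hτ => by
              have := hτ.2
              omega) (nerveBoundary_gen_mem s), map_zero, add_zero, map_add,
              nerveAugmentation_subdivision, hga, ZModModule.add_self]
          · exact nerveAugmentation_eq_zero hd (spanOn_mono (fun t ht => ht.2) hmem)
        rwa [hcyc, map_zero, add_zero, h2, zero_smul, add_zero] at h1)
  refine ⟨h, fun s => ?_, fun x => ?_⟩
  · obtain ⟨m, -, hmax⟩ := exists_greatest s
    refine spanOn_mono ?_ ((hh s trivial).1 m hmax)
    exact fun t ht => ht.2
  · exact eqOn_of_mem_spanOn (mem_spanOn_support x)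
      (f := nerveBoundary (Face X) ∘ₗ h + h ∘ₗ nerveBoundary (Face X))
      (g := subdivision X ∘ₗ g + LinearMap.id) fun s _ => (hh s trivial).2

/-- Both `g ∘ₗ subdivision X` and the identity are carried by closed cells, and these are acyclic by
`exists_boundary_eq`. -/
theorem exists_homotopy_cells (hX : IsRegularCW X)
    (hdd : ∀ x, cellularBoundary X (cellularBoundary X x) = 0)
    {g : Chain (NerveSimplex (Face X)) →ₗ[ZMod 2] Chain (Face X)}
    (hg : ∀ x, cellularBoundary X (g x) = g (nerveBoundary (Face X) x))
    (hga : ∀ x, augmentation X (g x) = nerveAugmentation (Face X) x)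
    (hgm : ∀ s, ∀ m, (∀ x ∈ s.verts, x ≤ m) → g (gen s) ∈ spanOn {ρ | ρ ≤ m ∧ ρ.dim = s.dim}) :
    ∃ h : Chain (Face X) →ₗ[ZMod 2] Chain (Face X),
      (∀ σ, h (gen σ) ∈ spanOn {τ | τ.dim = σ.dim + 1}) ∧
      ∀ x, cellularBoundary X (h x) + h (cellularBoundary X x) = g (subdivision X x) + x := by
  obtain ⟨h, hh⟩ := exists_homotopy (B := Face X) Face.dim
    (cellularBoundary X) (cellularBoundary X) Set.univ (g ∘ₗ subdivision X + LinearMap.id)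
    (fun σ y => y ∈ spanOn {τ | τ ≤ σ ∧ τ.dim = σ.dim + 1})
    (fun s _ => by
      refine spanOn_mono ?_ (cellularBoundary_mem s)
      exact fun t ht => ⟨trivial, by have := ht.2; omega⟩)
    (fun s _ => hdd _)
    (fun s _ => by
      simp only [LinearMap.add_apply, LinearMap.comp_apply, LinearMap.id_apply, map_add]
      rw [hg, nerveBoundary_subdivision hX hdd])
    (by
      intro σ _ h ih hcyc
      simp only [LinearMap.add_apply, LinearMap.comp_apply, LinearMap.id_apply] at hcyc ⊢
      refine exists_boundary_eq hX hdd σ (Submodule.add_mem _ (Submodule.add_mem _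
        (carried_mem hgm (subdivision_mem σ)) (gen_mem_spanOn ⟨le_rfl, rfl⟩)) ?_) hcyc fun hd => ?_
      · refine map_mem_of_mem_spanOn (cellularBoundary_mem σ) h fun τ hτ => ?_
        refine spanOn_mono ?_ (ih τ trivial (by have := hτ.2; omega)).1
        exact fun ρ hρ => ⟨hρ.1.trans hτ.1, hρ.2.trans hτ.2⟩
      · rw [eq_zero_of_mem_spanOn_empty (fun τ hτ => by
          have := hτ.2
          omega) (cellularBoundary_mem σ), map_zero, add_zero, map_add, hga,
          nerveAugmentation_subdivision, ZModModule.add_self])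
  refine ⟨h, fun s => ?_, fun x => ?_⟩
  · refine spanOn_mono ?_ (hh s trivial).1
    exact fun t ht => ht.2
  · exact eqOn_of_mem_spanOn (mem_spanOn_support x)
      (f := cellularBoundary X ∘ₗ h + h ∘ₗ cellularBoundary X)
      (g := g ∘ₗ subdivision X + LinearMap.id) fun s _ => (hh s trivial).2

end Comparison

/-! ### Sums over the cosimplicial degree and their bigrading. -/

section Total

variable {A B C : ℕ → Type*}

theorem incl_gen (n : ℕ) (a : A n) : incl n (gen a) = (gen ⟨n, a⟩ : Chain (Σ m, A m)) :=
  mapGen_gen _ _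

theorem total_gen (i : ℕ) (f : ∀ n, Chain (A n) →ₗ[ZMod 2] Chain (B (n + i))) (n : ℕ) (a : A n) :
    total i f (gen ⟨n, a⟩) = incl (n + i) (f n (gen a)) := by
  simp [total]

theorem total_incl (i : ℕ) (f : ∀ n, Chain (A n) →ₗ[ZMod 2] Chain (B (n + i))) (n : ℕ)
    (x : Chain (A n)) : total i f (incl n x) = incl (n + i) (f n x) :=
  eqOn_of_mem_spanOn (mem_spanOn_support x) (f := total i f ∘ₗ incl n) (g := incl (n + i) ∘ₗ f n)
    fun a _ => by rw [LinearMap.comp_apply, incl_gen, total_gen]; rfl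

theorem total_zero_incl (f : ∀ n, Chain (A n) →ₗ[ZMod 2] Chain (B n)) (n : ℕ)
    (x : Chain (A n)) : total 0 f (incl n x) = incl n (f n x) := total_incl 0 f n x

theorem total_hom_ext {M : Type*} [AddCommGroup M] [Module (ZMod 2) M]
    (u v : Chain (Σ n, A n) →ₗ[ZMod 2] M) (h : ∀ n x, u (incl n x) = v (incl n x))
    (x : Chain (Σ n, A n)) : u x = v x := by
  rw [chain_hom_ext (f := u) (g := v) fun b => by rw [← incl_gen, h]]

/-- Extensionality for linear statements on bigraded pieces. -/
theorem bigrading_map_mem {dim : ∀ n, A n → ℕ} {M : Type*} [AddCommGroup M] [Module (ZMod 2) M]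
    {p q : ℤ} {x : Chain (Σ n, A n)} (hx : x ∈ bigrading dim p q)
    (f : Chain (Σ n, A n) →ₗ[ZMod 2] M) {N : Submodule (ZMod 2) M}
    (h : ∀ n (a : A n), -(n : ℤ) = p → (dim n a : ℤ) = q → f (gen ⟨n, a⟩) ∈ N) : f x ∈ N :=
  map_mem_of_mem_spanOn hx f fun b hb => h b.1 b.2 hb.1 hb.2

theorem total_mem_bigrading {dim : ∀ n, A n → ℕ} {dim' : ∀ n, B n → ℕ} {i : ℕ} {k : ℤ}
    {f : ∀ n, Chain (A n) →ₗ[ZMod 2] Chain (B (n + i))}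
    (hf : ∀ n a, f n (gen a) ∈ spanOn {b | (dim' (n + i) b : ℤ) = dim n a + k}) {p q : ℤ}
    {x : Chain (Σ n, A n)} (hx : x ∈ bigrading dim p q) :
    total i f x ∈ bigrading dim' (p - i) (q + k) :=
  bigrading_map_mem hx _ fun n a hp hq => by
    rw [total_gen]
    refine map_mem_of_mem_spanOn (hf n a) _ fun b hb => ?_
    rw [incl_gen]
    refine gen_mem_spanOn ⟨?_, ?_⟩
    · simp only
      push_cast
      omega
    · have h1 : (dim' (n + i) b : ℤ) = dim n a + k := hb
      simp only
      omega

theorem isInternal_bigrading (dim : ∀ n, A n → ℕ) :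
    DirectSum.IsInternal (fun pq : ℤ × ℤ => bigrading dim pq.1 pq.2) := by
  classical
  rw [DirectSum.isInternal_submodule_iff_iSupIndep_and_iSup_eq_top]
  constructor
  · refine (iSupIndep_def).mpr fun pq => ?_
    rw [Submodule.disjoint_def]
    intro x hx hx'
    have h1 : (⨆ j, ⨆ (_ : j ≠ pq), bigrading dim j.1 j.2) ≤
        spanOn {x : Σ n, A n | ¬ (-(x.1 : ℤ) = pq.1 ∧ (dim x.1 x.2 : ℤ) = pq.2)} := by
      refine iSup_le fun j => iSup_le fun hj => ?_
      refine Finsupp.supported_mono ?_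
      rintro a ⟨h1, h2⟩ ⟨h3, h4⟩
      exact hj (Prod.ext (h1.symm.trans h3) (h2.symm.trans h4))
    have h2 := h1 hx'
    ext a
    by_contra ha
    have ha' := Finsupp.mem_support_iff.mpr ha
    exact (Finsupp.mem_supported _ _).mp h2 ha' ((Finsupp.mem_supported _ _).mp hx ha')
  · rw [eq_top_iff]
    intro x _
    refine map_mem_of_mem_spanOn (mem_spanOn_support x) LinearMap.id fun a _ => ?_
    exact Submodule.mem_iSup_of_mem (-(a.1 : ℤ), (dim a.1 a.2 : ℤ)) (gen_mem_spanOn ⟨rfl, rfl⟩)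

end Total

/-! ### The leading quasi-isomorphism given by subdivision. -/

section LeadingTerm

/-- For a cycle `x` with `f x = D' w'`, the homotopy `k` shows that `x` differs from `D (g w')` by a
boundary; for a cycle `x'` of the target, `h` joins it to `f (g x')`. -/
theorem IsLeadingQuasiIso.of_homotopy {M M' : Type*} [AddCommGroup M] [Module (ZMod 2) M]
    [AddCommGroup M'] [Module (ZMod 2) M'] {gr : ℤ → ℤ → Submodule (ZMod 2) M}
    {D : M →ₗ[ZMod 2] M} {gr' : ℤ → ℤ → Submodule (ZMod 2) M'} {D' : M' →ₗ[ZMod 2] M'}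
    {f : M →ₗ[ZMod 2] M'} {g : M' →ₗ[ZMod 2] M} {k : M →ₗ[ZMod 2] M} {h : M' →ₗ[ZMod 2] M'}
    (hg : ∀ p q x, x ∈ gr' p q → g x ∈ gr p q) (hk : ∀ p q x, x ∈ gr p q → k x ∈ gr p (q + 1))
    (hh : ∀ p q x, x ∈ gr' p q → h x ∈ gr' p (q + 1)) (hDg : D ∘ₗ g = g ∘ₗ D')
    (hDk : D ∘ₗ k + k ∘ₗ D = g ∘ₗ f + LinearMap.id)
    (hDh : D' ∘ₗ h + h ∘ₗ D' = f ∘ₗ g + LinearMap.id) : IsLeadingQuasiIso gr D gr' D' f := by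
  have hDg' : ∀ x, D (g x) = g (D' x) := fun x => congrArg (fun u => u x) hDg
  have hDk' : ∀ x, D (k x) + k (D x) = g (f x) + x := fun x => congrArg (fun u => u x) hDk
  have hDh' : ∀ x, D' (h x) + h (D' x) = f (g x) + x := fun x => congrArg (fun u => u x) hDh
  constructor
  · intro p q x hx hx0 w' hw' hxw
    refine ⟨g w' + k x, Submodule.add_mem _ (hg _ _ _ hw') (hk _ _ _ hx), ?_⟩
    have h1 := hDk' x
    rw [hx0, map_zero, add_zero, hxw, ← hDg'] at h1
    rw [map_add, h1, ← add_assoc, ZModModule.add_self, zero_add]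
  · intro p q x' hx' hx0
    refine ⟨g x', hg _ _ _ hx', by rw [hDg', hx0, map_zero], h x', hh _ _ _ hx', ?_⟩
    have h1 := hDh' x'
    rw [hx0, map_zero, add_zero] at h1
    rw [h1, ← add_assoc, ZModModule.add_self, zero_add]

variable {A B C : ℕ → Type*}

/-- The direct sum of a family of maps. -/
noncomputable abbrev dsum (f : ∀ n, Chain (A n) →ₗ[ZMod 2] Chain (B n)) :
    Chain (Σ n, A n) →ₗ[ZMod 2] Chain (Σ n, B n) := total 0 f

theorem dsum_comp (g : ∀ n, Chain (B n) →ₗ[ZMod 2] Chain (C n))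
    (f : ∀ n, Chain (A n) →ₗ[ZMod 2] Chain (B n)) :
    dsum g ∘ₗ dsum f = dsum fun n => g n ∘ₗ f n :=
  LinearMap.ext <| total_hom_ext _ _ fun n x => by
    rw [LinearMap.comp_apply, total_zero_incl, total_zero_incl, total_zero_incl,
      LinearMap.comp_apply]

theorem dsum_add (f g : ∀ n, Chain (A n) →ₗ[ZMod 2] Chain (B n)) :
    dsum f + dsum g = dsum fun n => f n + g n :=
  LinearMap.ext <| total_hom_ext _ _ fun n x => by
    rw [LinearMap.add_apply, total_zero_incl, total_zero_incl, total_zero_incl,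
      LinearMap.add_apply, map_add]

theorem dsum_id : (dsum fun n => (LinearMap.id : Chain (A n) →ₗ[ZMod 2] Chain (A n))) =
    LinearMap.id :=
  LinearMap.ext <| total_hom_ext _ _ fun n x => by
    rw [total_zero_incl, LinearMap.id_apply, LinearMap.id_apply]

theorem dsum_mem_bigrading {dim : ∀ n, A n → ℕ} {dim' : ∀ n, B n → ℕ} {k : ℕ}
    {f : ∀ n, Chain (A n) →ₗ[ZMod 2] Chain (B n)}
    (hf : ∀ n a, f n (gen a) ∈ spanOn {b | dim' n b = dim n a + k}) {p q : ℤ}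
    {x : Chain (Σ n, A n)} (hx : x ∈ bigrading dim p q) :
    dsum f x ∈ bigrading dim' p (q + k) := by
  have := total_mem_bigrading (dim' := dim') (f := f) (i := 0) (k := (k : ℤ)) (fun n a => by
    refine spanOn_mono ?_ (hf n a)
    exact fun b hb => by
      have h1 : dim' n b = dim n a + k := hb
      simp [h1]) hx
  simpa using this

variable {X : ℕ → Type*} [∀ n, TopologicalSpace (X n)] [∀ n, T2Space (X n)]
  [∀ n, Topology.CWComplex (Set.univ : Set (X n))]

/-- Subdivision is a quasi-isomorphism, for the vertical differentials. -/
theorem isLeadingQuasiIso_subdivision (hX : ∀ n, IsRegularCW (X n))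
    (hdd : ∀ n x, cellularBoundary (X n) (cellularBoundary (X n) x) = 0) :
    IsLeadingQuasiIso (cellGrading X) (dsum fun n => cellularBoundary (X n)) (nerveGrading X)
      (dsum fun n => nerveBoundary (Face (X n))) (dsum fun n => subdivision (X n)) := by
  choose g hg hga hgm using fun n => exists_carried_map (hX n) (hdd n)
  choose h hh hhe using fun n => exists_homotopy_nerve (hX n) (hdd n) (hg n) (hga n) (hgm n)
  choose k hk hke using fun n => exists_homotopy_cells (hX n) (hdd n) (hg n) (hga n) (hgm n)
  refine IsLeadingQuasiIso.of_homotopy (g := dsum g) (k := dsum k) (h := dsum h) ?_ ?_ ?_ ?_ ?_ ?_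
  · intro p q x hx
    have := dsum_mem_bigrading (dim' := fun _ σ => σ.dim) (k := 0) (f := g) (fun n s => by
      obtain ⟨m, -, hm⟩ := exists_greatest s
      refine spanOn_mono ?_ (hgm n s m hm)
      exact fun ρ hρ => hρ.2) hx
    rwa [Nat.cast_zero, add_zero] at this
  · intro p q x hx
    exact dsum_mem_bigrading (dim' := fun _ σ => σ.dim) (k := 1) (f := k) hk hx
  · intro p q x hx
    exact dsum_mem_bigrading (dim' := fun _ s => s.dim) (k := 1) (f := h) hh hx
  · rw [dsum_comp, dsum_comp]
    congr 1
    funext n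
    exact LinearMap.ext (hg n)
  · rw [dsum_comp, dsum_comp, dsum_comp, dsum_add, ← dsum_id, dsum_add]
    congr 1
    funext n
    exact LinearMap.ext (hke n)
  · rw [dsum_comp, dsum_comp, dsum_comp, dsum_add, ← dsum_id, dsum_add]
    congr 1
    funext n
    exact LinearMap.ext (hhe n)

end LeadingTerm

/-! ### Labelled chains and the inductive step for labelled morphisms. -/

section Labels

variable {B B' B'' : Type*}

/-- The free module on `B` inside the one on labelled elements. -/
noncomputable abbrev lab (e : ℕ → ℕ) : Chain B →ₗ[ZMod 2] Chain ((ℕ → ℕ) × B) :=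
  mapGen fun b => (e, b)

/-- Precomposition of the labels with a map. -/
noncomputable abbrev shift (e : ℕ → ℕ) : Chain ((ℕ → ℕ) × B) →ₗ[ZMod 2] Chain ((ℕ → ℕ) × B) :=
  mapGen fun p => (p.1 ∘ e, p.2)

/-- The equivariant extension of a map to the labelled elements. -/
noncomputable def labExt (s : Chain B →ₗ[ZMod 2] Chain ((ℕ → ℕ) × B')) :
    Chain ((ℕ → ℕ) × B) →ₗ[ZMod 2] Chain ((ℕ → ℕ) × B') :=
  Finsupp.linearCombination (ZMod 2) fun p => shift p.1 (s (gen p.2))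

/-- Forgetting the labels. -/
noncomputable abbrev forget : Chain ((ℕ → ℕ) × B) →ₗ[ZMod 2] Chain B := mapGen Prod.snd

theorem labExt_gen (s : Chain B →ₗ[ZMod 2] Chain ((ℕ → ℕ) × B')) (e : ℕ → ℕ) (b : B) :
    labExt s (gen (e, b)) = shift e (s (gen b)) := by
  simp [labExt]

theorem labExt_zero : labExt (0 : Chain B →ₗ[ZMod 2] Chain ((ℕ → ℕ) × B')) = 0 :=
  chain_hom_ext fun p => by simp [labExt]

theorem shift_shift (e f : ℕ → ℕ) (x : Chain ((ℕ → ℕ) × B)) :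
    shift e (shift f x) = shift (f ∘ e) x :=
  eqOn_of_mem_spanOn (mem_spanOn_support x) (f := shift e ∘ₗ shift f) fun p _ => by
    rw [LinearMap.comp_apply, mapGen_gen, mapGen_gen, mapGen_gen]
    rfl

theorem shift_id (x : Chain ((ℕ → ℕ) × B)) : shift id x = x :=
  eqOn_of_mem_spanOn (mem_spanOn_support x) (g := LinearMap.id) fun p _ => by
    rw [mapGen_gen]
    rfl

theorem shift_lab (e f : ℕ → ℕ) (x : Chain B) : shift e (lab f x) = lab (f ∘ e) x :=
  eqOn_of_mem_spanOn (mem_spanOn_support x) (f := shift e ∘ₗ lab f) fun p _ => by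
    rw [LinearMap.comp_apply, mapGen_gen, mapGen_gen, mapGen_gen]

theorem labExt_lab (s : Chain B →ₗ[ZMod 2] Chain ((ℕ → ℕ) × B')) (e : ℕ → ℕ) (x : Chain B) :
    labExt s (lab e x) = shift e (s x) :=
  eqOn_of_mem_spanOn (mem_spanOn_support x) (f := labExt s ∘ₗ lab e) (g := shift e ∘ₗ s)
    fun b _ => by rw [LinearMap.comp_apply, mapGen_gen, labExt_gen, LinearMap.comp_apply]

theorem labExt_lab_id (s : Chain B →ₗ[ZMod 2] Chain ((ℕ → ℕ) × B')) (x : Chain B) :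
    labExt s (lab id x) = s x := by rw [labExt_lab, shift_id]

theorem labExt_shift (s : Chain B →ₗ[ZMod 2] Chain ((ℕ → ℕ) × B')) (e : ℕ → ℕ)
    (x : Chain ((ℕ → ℕ) × B)) : labExt s (shift e x) = shift e (labExt s x) :=
  eqOn_of_mem_spanOn (mem_spanOn_support x) (f := labExt s ∘ₗ shift e) (g := shift e ∘ₗ labExt s)
    fun p _ => by
      rw [LinearMap.comp_apply, LinearMap.comp_apply, mapGen_gen, labExt_gen, labExt_gen,
        shift_shift]

theorem forget_lab (e : ℕ → ℕ) (x : Chain B) : forget (lab e x) = x :=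
  eqOn_of_mem_spanOn (mem_spanOn_support x) (f := forget ∘ₗ lab e) (g := LinearMap.id) fun b _ => by
    rw [LinearMap.comp_apply, mapGen_gen, mapGen_gen]
    rfl

theorem forget_shift (e : ℕ → ℕ) (x : Chain ((ℕ → ℕ) × B)) : forget (shift e x) = forget x :=
  eqOn_of_mem_spanOn (mem_spanOn_support x) (f := forget ∘ₗ shift e) (g := forget) fun b _ => by
    rw [LinearMap.comp_apply, mapGen_gen, mapGen_gen, mapGen_gen]

theorem forget_labExt (s : Chain B →ₗ[ZMod 2] Chain ((ℕ → ℕ) × B')) (x : Chain ((ℕ → ℕ) × B)) :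
    forget (labExt s x) = forget (s (forget x)) :=
  eqOn_of_mem_spanOn (mem_spanOn_support x) (f := forget ∘ₗ labExt s)
    (g := forget ∘ₗ s ∘ₗ forget) fun p _ => by
      rw [LinearMap.comp_apply, LinearMap.comp_apply, LinearMap.comp_apply, mapGen_gen, labExt_gen,
        forget_shift]

/-- An equivariant map is determined by its values on elements with trivial label. -/
theorem eq_zero_of_equivariant {ψ : Chain ((ℕ → ℕ) × B) →ₗ[ZMod 2] Chain ((ℕ → ℕ) × B')}
    (hψ : ∀ e x, ψ (shift e x) = shift e (ψ x)) (h0 : ∀ b, ψ (lab id (gen b)) = 0) : ψ = 0 := by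
  refine chain_hom_ext fun p => ?_
  have h1 : gen p = shift p.1 (lab id (gen p.2)) := by
    rw [shift_lab, mapGen_gen]
    rfl
  rw [h1, hψ, h0, map_zero, LinearMap.zero_apply]

/-- Both factors commute with `shift`, so quadratic relations need only be checked on elements with
trivial label. -/
theorem sum_comp_labExt_eq_zero (s : ℕ → Chain B →ₗ[ZMod 2] Chain ((ℕ → ℕ) × B'))
    (t : ℕ → Chain B' →ₗ[ZMod 2] Chain ((ℕ → ℕ) × B'')) {m : ℕ}
    (h : ∀ b, conv (fun i => labExt (t i)) (fun j => s j (gen b)) m = 0) :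
    ∑ ij ∈ Finset.HasAntidiagonal.antidiagonal m, labExt (t ij.1) ∘ₗ labExt (s ij.2) = 0 := by
  refine eq_zero_of_equivariant (fun e x => ?_) fun b => ?_
  · simp only [LinearMap.sum_apply, LinearMap.comp_apply, labExt_shift, map_sum]
  · simp only [LinearMap.sum_apply, LinearMap.comp_apply, labExt_lab_id]
    exact h b

theorem conv_update_map {M M' : Type*} [AddCommGroup M] [Module (ZMod 2) M]
    [AddCommGroup M'] [Module (ZMod 2) M'] (S S' : ℕ → M →ₗ[ZMod 2] M') (x : ℕ → M) {m : ℕ}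
    (h : ∀ i ≤ m, S i = S' i) : conv S x m = conv S' x m :=
  Finset.sum_congr rfl fun ij hij => by
    rw [h _ (by rw [Finset.HasAntidiagonal.mem_antidiagonal] at hij; omega)]

/-- One step of the construction of a morphism of labelled multicomplexes. -/
theorem exists_sliced_step {l : ℕ} {d : ℕ → Chain B →ₗ[ZMod 2] Chain ((ℕ → ℕ) × B)}
    {d' : ℕ → Chain B' →ₗ[ZMod 2] Chain ((ℕ → ℕ) × B')} {bd : Chain B →ₗ[ZMod 2] Chain B}
    (rk : B → ℕ) (Φ : B → Chain ((ℕ → ℕ) × B') → Prop)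
    (hd0 : ∀ x, d 0 x = lab id (bd x)) (hbd : ∀ b, bd (gen b) ∈ spanOn {b' | rk b' < rk b})
    (hbd2 : ∀ x, bd (bd x) = 0)
    (hd : ∀ m ≤ l, ∀ b, conv (fun i => labExt (d i)) (fun j => d j (gen b)) m = 0)
    (hd' : ∀ m ≤ l, ∀ b, conv (fun i => labExt (d' i)) (fun j => d' j (gen b)) m = 0)
    {s : ℕ → Chain B →ₗ[ZMod 2] Chain ((ℕ → ℕ) × B')} (hsl : s l = 0) (hl : 0 < l)
    (hs : ∀ m < l, ∀ b, conv (fun i => labExt (s i)) (fun j => d j (gen b)) m =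
      conv (fun i => labExt (d' i)) (fun j => s j (gen b)) m)
    (hfill : ∀ b, ∀ h : Chain B →ₗ[ZMod 2] Chain ((ℕ → ℕ) × B'),
      (∀ b', rk b' < rk b → Φ b' (h (gen b'))) → ∀ z,
      z = conv (fun i => labExt (s i)) (fun j => d j (gen b)) l +
        conv (fun i => labExt (d' i)) (fun j => s j (gen b)) l + h (bd (gen b)) →
      labExt (d' 0) z = 0 → ∃ y, Φ b y ∧ labExt (d' 0) y = z) :
    ∃ h : Chain B →ₗ[ZMod 2] Chain ((ℕ → ℕ) × B'), (∀ b, Φ b (h (gen b))) ∧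
      ∀ m ≤ l, ∀ b, conv (fun i => labExt (Function.update s l h i)) (fun j => d j (gen b)) m =
        conv (fun i => labExt (d' i)) (fun j => Function.update s l h j (gen b)) m := by
  -- The obstruction: what the equation of order `l` lacks while component `l` is zero.
  let φ : Chain B →ₗ[ZMod 2] Chain ((ℕ → ℕ) × B') :=
    (∑ ij ∈ Finset.HasAntidiagonal.antidiagonal l, labExt (s ij.1) ∘ₗ d ij.2) +
      ∑ ij ∈ Finset.HasAntidiagonal.antidiagonal l, labExt (d' ij.1) ∘ₗ s ij.2
  have hφ : ∀ b, φ (gen b) = conv (fun i => labExt (s i)) (fun j => d j (gen b)) l +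
      conv (fun i => labExt (d' i)) (fun j => s j (gen b)) l := fun b => by
    simp only [φ, LinearMap.add_apply, LinearMap.sum_apply, LinearMap.comp_apply]
    rfl
  -- The defect of commutation of the equivariant extensions; it vanishes below order `l`.
  let ψ : ℕ → Chain ((ℕ → ℕ) × B) →ₗ[ZMod 2] Chain ((ℕ → ℕ) × B') := fun m =>
    (∑ ij ∈ Finset.HasAntidiagonal.antidiagonal m, labExt (s ij.1) ∘ₗ labExt (d ij.2)) +
      ∑ ij ∈ Finset.HasAntidiagonal.antidiagonal m, labExt (d' ij.1) ∘ₗ labExt (s ij.2)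
  have hψ0 : ∀ m < l, ψ m = 0 := fun m hm => by
    refine eq_zero_of_equivariant (fun e x => ?_) fun b => ?_
    · simp only [ψ, LinearMap.add_apply, LinearMap.sum_apply, LinearMap.comp_apply, labExt_shift,
        map_sum, map_add]
    · simp only [ψ, LinearMap.add_apply, LinearMap.sum_apply, LinearMap.comp_apply, labExt_lab_id]
      rw [add_eq_zero_iff_eq_mod_two]
      exact hs m hm b
  have hψl : ∀ x, ψ l (lab id x) = φ x := fun x => by
    simp only [ψ, φ, LinearMap.add_apply, LinearMap.sum_apply, LinearMap.comp_apply, labExt_lab_id]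
  -- Convolve `ψ` with `d` at order `l`. As `ψ` vanishes below `l`, the result is `φ (bd (gen b))`.
  -- Expanding `ψ` instead, the part with `d` twice vanishes, and the rest may be completed by the
  -- vanishing part with `d'` twice; since the equations below `l` hold, only `labExt (d' 0)` of the
  -- obstruction is left.
  have hcomm : ∀ b, labExt (d' 0) (φ (gen b)) = φ (bd (gen b)) := fun b => by
    have h1 : conv ψ (fun j => d j (gen b)) l = φ (bd (gen b)) := by
      have h2 := conv_eq_add_range ψ (fun j => d j (gen b)) l
      rw [Finset.sum_eq_zero fun i hi => by
        rw [hψ0 i (Finset.mem_range.mp hi), LinearMap.zero_apply], add_zero, hd0, hψl] at h2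
      exact h2
    have h3 : conv ψ (fun j => d j (gen b)) l =
        conv (fun i => labExt (s i)) (conv (fun i => labExt (d i)) fun j => d j (gen b)) l +
        conv (fun i => labExt (d' i)) (conv (fun i => labExt (s i)) fun j => d j (gen b)) l := by
      rw [conv_conv, conv_conv, ← Finset.sum_add_distrib]
      rfl
    have h4 : conv (fun i => labExt (s i)) (conv (fun i => labExt (d i)) fun j => d j (gen b)) l =
        0 := by
      refine Finset.sum_eq_zero fun ij hij => ?_
      rw [Finset.HasAntidiagonal.mem_antidiagonal] at hij
      rw [hd _ (by omega), map_zero]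
    have h5 : conv (fun i => labExt (d' i)) (conv (fun i => labExt (d' i))
        fun j => s j (gen b)) l = 0 := by
      rw [conv_conv]
      refine Finset.sum_eq_zero fun ij hij => ?_
      rw [Finset.HasAntidiagonal.mem_antidiagonal] at hij
      rw [sum_comp_labExt_eq_zero d' d' (hd' _ (by omega)), LinearMap.zero_apply]
    have h6 : conv (fun i => labExt (d' i)) (fun m =>
        conv (fun i => labExt (s i)) (fun j => d j (gen b)) m +
        conv (fun i => labExt (d' i)) (fun j => s j (gen b)) m) l =
        labExt (d' 0) (φ (gen b)) := by
      have h2 := conv_eq_head_add (fun i => labExt (d' i)) (fun m =>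
        conv (fun i => labExt (s i)) (fun j => d j (gen b)) m +
        conv (fun i => labExt (d' i)) (fun j => s j (gen b)) m) l
      rw [Finset.sum_eq_zero fun i hi => by
        rw [Finset.mem_range] at hi
        rw [add_eq_zero_iff_eq_mod_two.mpr (hs _ (by omega) b), map_zero], add_zero, ← hφ] at h2
      exact h2
    rw [← h6, ← h1, h3, h4, zero_add]
    have h7 : conv (fun i => labExt (d' i)) (fun m =>
        conv (fun i => labExt (s i)) (fun j => d j (gen b)) m +
        conv (fun i => labExt (d' i)) (fun j => s j (gen b)) m) l =
        conv (fun i => labExt (d' i)) (conv (fun i => labExt (s i)) fun j => d j (gen b)) l +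
        conv (fun i => labExt (d' i)) (conv (fun i => labExt (d' i)) fun j => s j (gen b)) l := by
      simp only [conv, map_add, Finset.sum_add_distrib]
    rw [h7, h5, add_zero]
  obtain ⟨h, hh⟩ := exists_homotopy rk bd (labExt (d' 0)) Set.univ φ Φ
    (fun b _ => by
      refine spanOn_mono ?_ (hbd b)
      exact fun b' hb' => ⟨trivial, hb'⟩)
    (fun b _ => hbd2 _) (fun b _ => hcomm b)
    (fun b _ h ih hcyc => hfill b h (fun b' hb' => (ih b' trivial hb').1) _ (by rw [hφ]) hcyc)
  refine ⟨h, fun b => (hh b trivial).1, fun m hm b => ?_⟩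
  rcases hm.eq_or_lt with rfl | hm
  · have h1 : conv (fun i => labExt (Function.update s m h i)) (fun j => d j (gen b)) m =
        h (bd (gen b)) + conv (fun i => labExt (s i)) (fun j => d j (gen b)) m := by
      rw [conv_eq_add_range, conv_eq_add_range, Function.update_self, hsl, labExt_zero,
        LinearMap.zero_apply, zero_add, hd0, labExt_lab_id]
      congr 1
      refine Finset.sum_congr rfl fun i hi => ?_
      rw [Finset.mem_range] at hi
      rw [Function.update_of_ne (by omega)]
    have h2 : conv (fun i => labExt (d' i)) (fun j => Function.update s m h j (gen b)) m =
        labExt (d' 0) (h (gen b)) + conv (fun i => labExt (d' i)) (fun j => s j (gen b)) m := by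
      rw [conv_eq_head_add, conv_eq_head_add, Function.update_self, hsl, LinearMap.zero_apply,
        map_zero, zero_add]
      congr 1
      refine Finset.sum_congr rfl fun i hi => ?_
      rw [Finset.mem_range] at hi
      rw [Function.update_of_ne (by omega)]
    have h3 := (hh b trivial).2
    rw [hφ] at h3
    rw [← add_eq_zero_iff_eq_mod_two, h1, h2, add_add_add_comm, add_comm (h _), h3,
      ZModModule.add_self]
  · rw [conv_update_map _ (fun i => labExt (s i)) _ fun i hi => by
      rw [Function.update_of_ne (by omega)], hs m hm b]
    exact conv_congr _ fun j hj => by rw [Function.update_of_ne (by omega)]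

end Labels

/-! ### The induction over the order. -/

section Construction

variable {B B' : Type*}

/-- The inductive construction of a morphism of labelled multicomplexes, subject to carriers. -/
theorem exists_sliced_morphism {r : ℕ} {d : ℕ → Chain B →ₗ[ZMod 2] Chain ((ℕ → ℕ) × B)}
    {d' : ℕ → Chain B' →ₗ[ZMod 2] Chain ((ℕ → ℕ) × B')} {bd : Chain B →ₗ[ZMod 2] Chain B}
    (rk : B → ℕ) (Car : ℕ → B → Set ((ℕ → ℕ) × B'))
    (hd0 : ∀ x, d 0 x = lab id (bd x)) (hbd : ∀ b, bd (gen b) ∈ spanOn {b' | rk b' < rk b})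
    (hbd2 : ∀ x, bd (bd x) = 0)
    (hd : ∀ m ≤ r, ∀ b, conv (fun i => labExt (d i)) (fun j => d j (gen b)) m = 0)
    (hd' : ∀ m, ∀ b, conv (fun i => labExt (d' i)) (fun j => d' j (gen b)) m = 0)
    {s0 : Chain B →ₗ[ZMod 2] Chain ((ℕ → ℕ) × B')}
    (h0 : ∀ b, labExt s0 (d 0 (gen b)) = labExt (d' 0) (s0 (gen b)))
    (hs0 : ∀ b, s0 (gen b) ∈ spanOn (Car 0 b))
    (hfill : ∀ l < r, ∀ s : ℕ → Chain B →ₗ[ZMod 2] Chain ((ℕ → ℕ) × B'), s 0 = s0 →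
      s (l + 1) = 0 → (∀ i ≤ l, ∀ b, s i (gen b) ∈ spanOn (Car i b)) → ∀ b,
      ∀ h : Chain B →ₗ[ZMod 2] Chain ((ℕ → ℕ) × B'),
      (∀ b', rk b' < rk b → h (gen b') ∈ spanOn (Car (l + 1) b')) → ∀ z,
      z = conv (fun i => labExt (s i)) (fun j => d j (gen b)) (l + 1) +
        conv (fun i => labExt (d' i)) (fun j => s j (gen b)) (l + 1) + h (bd (gen b)) →
      labExt (d' 0) z = 0 → ∃ y, y ∈ spanOn (Car (l + 1) b) ∧ labExt (d' 0) y = z) :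
    ∃ s : ℕ → Chain B →ₗ[ZMod 2] Chain ((ℕ → ℕ) × B'), s 0 = s0 ∧
      (∀ i ≤ r, ∀ b, s i (gen b) ∈ spanOn (Car i b)) ∧
      ∀ m ≤ r, ∀ b, conv (fun i => labExt (s i)) (fun j => d j (gen b)) m =
        conv (fun i => labExt (d' i)) (fun j => s j (gen b)) m := by
  suffices H : ∀ t ≤ r, ∃ s : ℕ → Chain B →ₗ[ZMod 2] Chain ((ℕ → ℕ) × B'), s 0 = s0 ∧
      (∀ i ≤ t, ∀ b, s i (gen b) ∈ spanOn (Car i b)) ∧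
      ∀ m ≤ t, ∀ b, conv (fun i => labExt (s i)) (fun j => d j (gen b)) m =
        conv (fun i => labExt (d' i)) (fun j => s j (gen b)) m from H r le_rfl
  intro t
  induction t with
  | zero =>
    refine fun _ => ⟨fun _ => s0, rfl, fun i hi b => ?_, fun m hm b => ?_⟩
    · rw [Nat.le_zero.mp hi]
      exact hs0 b
    · rw [Nat.le_zero.mp hm]
      simpa [conv] using h0 b
  | succ t ih =>
    intro ht
    obtain ⟨s, hs, hcar, heq⟩ := ih (by omega)
    -- Component `t + 1` must be zero for the obstruction to involve only the components already
    -- found.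
    set s1 := Function.update s (t + 1) 0 with hs1
    have hs1' : ∀ i ≤ t, s1 i = s i := fun i hi => by rw [hs1, Function.update_of_ne (by omega)]
    have hs1t : s1 (t + 1) = 0 := by rw [hs1, Function.update_self]
    have hcar1 : ∀ i ≤ t, ∀ b, s1 i (gen b) ∈ spanOn (Car i b) := fun i hi b => by
      rw [hs1' i hi]
      exact hcar i hi b
    obtain ⟨h, hh, hheq⟩ := exists_sliced_step (l := t + 1) rk
      (fun b y => y ∈ spanOn (Car (t + 1) b)) hd0 hbd hbd2 (fun m hm => hd m (hm.trans ht))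
      (fun m _ => hd' m) hs1t (Nat.succ_pos t)
      (fun m hm b => by
        rw [conv_update_map _ (fun i => labExt (s i)) _ fun i hi => by rw [hs1' i (by omega)],
          heq m (by omega) b]
        exact conv_congr _ fun j hj => by rw [hs1' j (by omega)])
      (fun b h hh z hz hz0 => hfill t (by omega) s1 ((hs1' 0 (by omega)).trans hs) hs1t hcar1
        b h hh z hz hz0)
    refine ⟨Function.update s1 (t + 1) h, ?_, fun i hi b => ?_, hheq⟩
    · rw [Function.update_of_ne (by omega), hs1' 0 (by omega), hs]
    · rcases hi.eq_or_lt with rfl | hi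
      · rw [Function.update_self]
        exact hh b
      · rw [Function.update_of_ne (by omega)]
        exact hcar1 i (by omega) b

end Construction

/-! ### Multisets as strictly increasing maps of the natural numbers. -/

section MultisetLabels

/-- The map `d_K`, for a multiset `K`, on all natural numbers. -/
def multiLabel {n l : ℕ} (K : Sym (Fin (n + 2)) l) : ℕ → ℕ :=
  deltaList (((K : Multiset (Fin (n + 2))).sort).map Fin.val)

/-- In a sorted list the smallest index acts last. Every entry at most `x` then raises the value by
one, and the larger entries have no effect. -/
theorem deltaList_of_sorted {L : List ℕ} (hL : L.Pairwise (· ≤ ·)) (x : ℕ) :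
    deltaList L x = x + L.countP (· ≤ x) := by
  induction L with
  | nil => rfl
  | cons a L ih =>
    obtain ⟨h1, h2⟩ := List.pairwise_cons.mp hL
    have h3 : deltaList (a :: L) x = delta a (deltaList L x) := rfl
    rw [h3, ih h2, List.countP_cons]
    by_cases hx : a ≤ x
    · rw [delta, if_neg (by omega), if_pos (by simpa using hx), add_assoc]
    · have h4 : L.countP (· ≤ x) = 0 := List.countP_eq_zero.mpr fun b hb => by
        have := h1 b hb
        simp only [decide_eq_true_eq]
        omega
      rw [h4, delta, if_pos (by omega), if_neg (by simpa using hx)]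

theorem multiLabel_apply {n l : ℕ} (K : Sym (Fin (n + 2)) l) (x : ℕ) :
    multiLabel K x = x + (K : Multiset (Fin (n + 2))).countP (fun k : Fin (n + 2) => (k : ℕ) ≤ x) := by
  have h1 : (((K : Multiset (Fin (n + 2))).sort).map Fin.val).Pairwise (· ≤ ·) :=
    List.Pairwise.map _ (fun _ _ h => h) (Multiset.pairwise_sort _ _)
  rw [multiLabel, deltaList_of_sorted h1, List.countP_map]
  congr 1
  conv_rhs => rw [← Multiset.sort_eq (K : Multiset (Fin (n + 2))) (· ≤ ·)]
  rw [Multiset.coe_countP]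
  rfl

/-- Beyond `n` every element of the multiset counts, and the label is translation by `l`. Identities
between labels on `[n]` therefore extend to all natural numbers. -/
theorem multiLabel_of_le {n l : ℕ} (K : Sym (Fin (n + 2)) l) {x : ℕ} (hx : n + 1 ≤ x) :
    multiLabel K x = x + l := by
  rw [multiLabel_apply]
  congr 1
  have h1 : Multiset.card (K : Multiset (Fin (n + 2))) = l := K.2
  conv_rhs => rw [← h1]
  exact Multiset.countP_eq_card.mpr fun k _ => by
    have := k.2
    omega

theorem multiLabel_strictMono {n l : ℕ} (K : Sym (Fin (n + 2)) l) : StrictMono (multiLabel K) :=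
  deltaList_strictMono _

theorem multiLabel_injective {n l : ℕ} :
    Function.Injective (multiLabel : Sym (Fin (n + 2)) l → ℕ → ℕ) := by
  intro K K' h
  have h1 : ∀ x, (K : Multiset (Fin (n + 2))).countP (fun k : Fin (n + 2) => (k : ℕ) ≤ x) =
      (K' : Multiset (Fin (n + 2))).countP (fun k : Fin (n + 2) => (k : ℕ) ≤ x) := fun x => by
    have := congrFun h x
    rw [multiLabel_apply, multiLabel_apply] at this
    omega
  have h2 : ∀ x, (K : Multiset (Fin (n + 2))).countP (fun k : Fin (n + 2) => (k : ℕ) < x) =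
      (K' : Multiset (Fin (n + 2))).countP (fun k : Fin (n + 2) => (k : ℕ) < x) := fun x => by
    rcases x with _ | x
    · simp
    · simpa only [Nat.lt_succ_iff] using h1 x
  have h3 : ∀ (M : Multiset (Fin (n + 2))) (a : Fin (n + 2)),
      M.countP (fun k : Fin (n + 2) => (k : ℕ) ≤ a) = M.countP (fun k : Fin (n + 2) => (k : ℕ) < a) + M.count a := by
    intro M a
    induction M using Multiset.induction_on with
    | empty => simp
    | cons b M ih =>
      rw [Multiset.countP_cons, Multiset.countP_cons, Multiset.count_cons, ih]
      have h4 : a = b ↔ (a : ℕ) = b := Fin.ext_iff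
      split_ifs <;> omega
  refine Subtype.ext (Multiset.ext.mpr fun a => ?_)
  have h4 := h3 K a
  have h5 := h3 K' a
  rw [h1, h2] at h4
  exact Nat.add_left_cancel (h4.symm.trans h5)

/-- The multiplicity of `k` is the increment of `x ↦ f x - x` on reaching `k`; this function is
monotone and constant from `n + 1` on. -/
theorem exists_multiLabel_eq {n l : ℕ} {f : ℕ → ℕ} (hf : StrictMono f)
    (hfn : ∀ x, n + 1 ≤ x → f x = x + l) : ∃ K : Sym (Fin (n + 2)) l, multiLabel K = f := by
  -- Shifted by one, with `g 0 = 0`, so that the multiplicity of 0 is an increment as well.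
  let g : ℕ → ℕ := fun m => Nat.casesOn m 0 fun x => f x - x
  have hg : Monotone g := monotone_nat_of_le_succ fun m => by
    rcases m with _ | m
    · exact Nat.zero_le _
    · have h1 : f m < f (m + 1) := hf (Nat.lt_succ_self m)
      change f m - m ≤ f (m + 1) - (m + 1)
      omega
  let M : Multiset (Fin (n + 2)) := ∑ k : Fin (n + 2), Multiset.replicate (g (k + 1) - g k) k
  have hcount : ∀ x, M.countP (fun k : Fin (n + 2) => (k : ℕ) ≤ x) = f x - x := fun x => by
    have h1 : M.countP (fun k : Fin (n + 2) => (k : ℕ) ≤ x) =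
        ∑ k : Fin (n + 2), if (k : ℕ) ≤ x then g (k + 1) - g k else 0 := by
      rw [← Multiset.coe_countPAddMonoidHom, map_sum]
      refine Finset.sum_congr rfl fun k _ => ?_
      rw [Multiset.coe_countPAddMonoidHom]
      split_ifs with h
      · rw [Multiset.countP_eq_card.mpr, Multiset.card_replicate]
        intro a ha
        rwa [Multiset.eq_of_mem_replicate ha]
      · rw [Multiset.countP_eq_zero]
        intro a ha
        rwa [Multiset.eq_of_mem_replicate ha]
    rw [h1, Fin.sum_univ_eq_sum_range (fun k => if k ≤ x then g (k + 1) - g k else 0) (n + 2),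
      ← Finset.sum_filter]
    by_cases hx : x ≤ n + 1
    · have h2 : (Finset.range (n + 2)).filter (· ≤ x) = Finset.range (x + 1) := by
        ext k
        simp only [Finset.mem_filter, Finset.mem_range]
        omega
      rw [h2, Finset.sum_range_tsub hg]
      rfl
    · have h2 : (Finset.range (n + 2)).filter (· ≤ x) = Finset.range (n + 2) := by
        ext k
        simp only [Finset.mem_filter, Finset.mem_range]
        omega
      rw [h2, Finset.sum_range_tsub hg, hfn x (by omega)]
      change f (n + 1) - (n + 1) - 0 = _
      rw [hfn (n + 1) le_rfl]
      omega
  have hcard : Multiset.card M = l := by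
    have h1 := hcount (n + 1)
    rw [hfn _ le_rfl, Multiset.countP_eq_card.mpr fun k _ => by have := k.2; omega] at h1
    omega
  let K : Sym (Fin (n + 2)) l := ⟨M, hcard⟩
  refine ⟨K, funext fun x => ?_⟩
  have h1 := hf.le_apply (x := x)
  rw [multiLabel_apply K]
  have h2 := hcount x
  change x + M.countP (fun k : Fin (n + 2) => (k : ℕ) ≤ x) = f x
  omega

theorem isShiftUnion_iff {n i j l : ℕ} {I : Sym (Fin (n + j + 2)) i} {J : Sym (Fin (n + 2)) j}
    {K : Sym (Fin (n + 2)) l} (h : i + j = l) :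
    IsShiftUnion I J K ↔ multiLabel I ∘ multiLabel J = multiLabel K := by
  constructor
  · rintro ⟨-, h2⟩
    funext x
    by_cases hx : x < n + 1
    · exact h2 ⟨x, hx⟩
    · rw [Function.comp_apply, multiLabel_of_le J (by omega), multiLabel_of_le I (by omega),
        multiLabel_of_le K (by omega)]
      omega
  · exact fun h2 => ⟨h, fun x => congrFun h2 x⟩

/-- The composite is again strictly increasing and eventually a translation, so each pair `(I, J)`
contributes to the sliced sum of exactly one `K`. -/
theorem exists_unique_shiftUnion {n i j l : ℕ} (I : Sym (Fin (n + j + 2)) i)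
    (J : Sym (Fin (n + 2)) j) (h : i + j = l) :
    ∃ K : Sym (Fin (n + 2)) l, IsShiftUnion I J K ∧ multiLabel I ∘ multiLabel J = multiLabel K ∧
      ∀ K', IsShiftUnion I J K' → K' = K := by
  obtain ⟨K, hK⟩ := exists_multiLabel_eq (n := n) (l := l)
    ((multiLabel_strictMono I).comp (multiLabel_strictMono J)) fun x hx => by
      rw [Function.comp_apply, multiLabel_of_le J hx, multiLabel_of_le I (by omega)]
      omega
  refine ⟨K, (isShiftUnion_iff h).mpr hK.symm, hK.symm, fun K' hK' => ?_⟩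
  exact multiLabel_injective (((isShiftUnion_iff h).mp hK').symm.trans hK.symm)

theorem multiLabel_nil {n : ℕ} : multiLabel (Sym.nil : Sym (Fin (n + 2)) 0) = id := by
  funext x
  rw [multiLabel_apply]
  exact Nat.add_zero x

theorem multiLabel_oneEquiv {n : ℕ} (a : Fin (n + 2)) :
    multiLabel (Sym.oneEquiv a) = delta a := by
  funext x
  rw [multiLabel_apply]
  have : ((Sym.oneEquiv a : Sym (Fin (n + 2)) 1) : Multiset (Fin (n + 2))) = {a} := rfl
  rw [this, Multiset.countP_eq_card_filter, Multiset.filter_singleton, delta]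
  split_ifs <;> simp <;> omega

end MultisetLabels

/-! ### The labelled multicomplex of cells and the labelled bicomplex of nerves. -/

section LabelledOperators

variable {X : ℕ → Type*} [∀ n, TopologicalSpace (X n)]
  [∀ n, Topology.CWComplex (Set.univ : Set (X n))]

/-- The maps `D_I` with `|I| = i`, with the multisets as labels. -/
noncomputable def labDiff (D : MultisetMaps X) (i : ℕ) :
    Chain (Σ n, Face (X n)) →ₗ[ZMod 2] Chain ((ℕ → ℕ) × Σ n, Face (X n)) :=
  Finsupp.linearCombination (ZMod 2) fun b => ∑ I : Sym (Fin (b.1 + 2)) i,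
    lab (multiLabel I) (incl (b.1 + i) (D b.1 i I (gen b.2)))

theorem labDiff_gen (D : MultisetMaps X) (i n : ℕ) (σ : Face (X n)) :
    labDiff D i (gen ⟨n, σ⟩) = ∑ I : Sym (Fin (n + 2)) i,
      lab (multiLabel I) (incl (n + i) (D n i I (gen σ))) := by
  simp [labDiff]

theorem labDiff_incl (D : MultisetMaps X) (i n : ℕ) (x : Chain (Face (X n))) :
    labDiff D i (incl n x) = ∑ I : Sym (Fin (n + 2)) i,
      lab (multiLabel I) (incl (n + i) (D n i I x)) := by
  have := eqOn_of_mem_spanOn (mem_spanOn_support x) (f := labDiff D i ∘ₗ incl (A := fun n => Face (X n)) n)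
    (g := ∑ I : Sym (Fin (n + 2)) i, lab (multiLabel I) ∘ₗ incl (n + i) ∘ₗ D n i I) fun σ _ => by
      rw [LinearMap.comp_apply, incl_gen, labDiff_gen, LinearMap.sum_apply]
      rfl
  rw [LinearMap.comp_apply, LinearMap.sum_apply] at this
  exact this

theorem forget_labDiff (D : MultisetMaps X) (i : ℕ) (x : Chain (Σ n, Face (X n))) :
    forget (labDiff D i x) = sumDiff D i x := by
  refine total_hom_ext (forget ∘ₗ labDiff D i) (sumDiff D i) (fun n y => ?_) x
  rw [LinearMap.comp_apply, labDiff_incl, map_sum, sumDiff, total_incl, LinearMap.sum_apply,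
    map_sum]
  exact Finset.sum_congr rfl fun I _ => forget_lab _ _

/-- The sliced equations say that the labelled operators form a multicomplex. -/
theorem conv_labDiff_eq_zero {D : MultisetMaps X} {m : ℕ}
    (hD : ∀ (n : ℕ) (K : Sym (Fin (n + 2)) m) (x : Chain (Face (X n))), slicedSum D K x = 0)
    (b : Σ n, Face (X n)) :
    conv (fun i => labExt (labDiff D i)) (fun j => labDiff D j (gen b)) m = 0 := by
  classical
  obtain ⟨n, σ⟩ := b
  -- Labels of composites multiply, so each term carries the label of its shift union; sorting by
  -- `K` yields the sliced sums.
  have h1 : conv (fun i => labExt (labDiff D i)) (fun j => labDiff D j (gen ⟨n, σ⟩)) m =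
      ∑ ij ∈ Finset.HasAntidiagonal.antidiagonal m, ∑ J : Sym (Fin (n + 2)) ij.2,
        ∑ I : Sym (Fin (n + ij.2 + 2)) ij.1, ∑ K : Sym (Fin (n + 2)) m,
          lab (multiLabel K) (if IsShiftUnion I J K then
            incl (n + ij.2 + ij.1) (D (n + ij.2) ij.1 I (D n ij.2 J (gen σ))) else 0) := by
    refine Finset.sum_congr rfl fun ij hij => ?_
    rw [Finset.HasAntidiagonal.mem_antidiagonal] at hij
    dsimp only
    rw [labDiff_gen, map_sum]
    refine Finset.sum_congr rfl fun J _ => ?_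
    rw [labExt_lab, labDiff_incl, map_sum]
    refine Finset.sum_congr rfl fun I _ => ?_
    obtain ⟨K, hK, hlab, huniq⟩ := exists_unique_shiftUnion I J hij
    rw [shift_lab, hlab, Finset.sum_eq_single K, if_pos hK]
    · intro K' _ hne
      rw [if_neg fun h => hne (huniq K' h), map_zero]
    · exact fun h => absurd (Finset.mem_univ K) h
  rw [h1]
  have h2 : ∀ K : Sym (Fin (n + 2)) m, lab (multiLabel K) (slicedSum D K (gen σ)) =
      ∑ ij ∈ Finset.HasAntidiagonal.antidiagonal m, ∑ J : Sym (Fin (n + 2)) ij.2,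
        ∑ I : Sym (Fin (n + ij.2 + 2)) ij.1,
          lab (multiLabel K) (if IsShiftUnion I J K then
            incl (n + ij.2 + ij.1) (D (n + ij.2) ij.1 I (D n ij.2 J (gen σ))) else 0) := fun K => by
    rw [slicedSum, map_sum]
    refine Finset.sum_congr rfl fun ij _ => ?_
    rw [map_sum]
    refine Finset.sum_congr rfl fun J _ => ?_
    rw [map_sum]
  have h3 : ∑ K : Sym (Fin (n + 2)) m, lab (multiLabel K) (slicedSum D K (gen σ)) = 0 :=
    Finset.sum_eq_zero fun K _ => by rw [hD, map_zero]
  rw [← h3, Finset.sum_congr rfl fun K _ => h2 K]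
  conv_rhs => rw [Finset.sum_comm]
  refine Finset.sum_congr rfl fun ij _ => ?_
  conv_rhs => rw [Finset.sum_comm]
  refine Finset.sum_congr rfl fun J _ => ?_
  rw [Finset.sum_comm]

theorem val_succAboveOrderEmb {n : ℕ} (a : Fin (n + 2)) (x : Fin (n + 1)) :
    ((Fin.succAboveOrderEmb a x : Fin (n + 2)) : ℕ) = delta a x := by
  rw [Fin.succAboveOrderEmb_apply, Fin.succAbove, delta]
  simp only [Fin.lt_def, Fin.val_castSucc]
  split_ifs <;> simp

/-- The differentials of the bicomplex of nerves, with the cofaces as labels. -/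
noncomputable def labNerve (P : SemicosimplicialFaces X) : ℕ →
    Chain (Σ n, NerveSimplex (Face (X n))) →ₗ[ZMod 2]
      Chain ((ℕ → ℕ) × Σ n, NerveSimplex (Face (X n)))
  | 0 => lab id ∘ₗ dsum fun n => nerveBoundary (Face (X n))
  | 1 => Finsupp.linearCombination (ZMod 2) fun b => ∑ a : Fin (b.1 + 2),
      lab (delta a) (incl (b.1 + 1) (nerveMap (P.map (Fin.succAboveOrderEmb a)) (gen b.2)))
  | _ + 2 => 0

variable (P : SemicosimplicialFaces X)

theorem labNerve_zero_incl (n : ℕ) (x : Chain (NerveSimplex (Face (X n)))) :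
    labNerve P 0 (incl n x) = lab id (incl n (nerveBoundary (Face (X n)) x)) := by
  rw [labNerve, LinearMap.comp_apply, total_zero_incl]

theorem labNerve_one_gen (n : ℕ) (s : NerveSimplex (Face (X n))) :
    labNerve P 1 (gen ⟨n, s⟩) = ∑ a : Fin (n + 2), lab (delta a)
      (incl (n + 1) (nerveMap (P.map (Fin.succAboveOrderEmb a)) (gen s))) := by
  simp [labNerve]

theorem labNerve_one_incl (n : ℕ) (x : Chain (NerveSimplex (Face (X n)))) :
    labNerve P 1 (incl n x) = ∑ a : Fin (n + 2), lab (delta a)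
      (incl (n + 1) (nerveMap (P.map (Fin.succAboveOrderEmb a)) x)) := by
  have := eqOn_of_mem_spanOn (mem_spanOn_support x) (f := labNerve P 1 ∘ₗ incl (A := fun n => NerveSimplex (Face (X n))) n)
    (g := ∑ a : Fin (n + 2), lab (delta a) ∘ₗ incl (n + 1) ∘ₗ
      nerveMap (P.map (Fin.succAboveOrderEmb a))) fun s _ => by
      rw [LinearMap.comp_apply, incl_gen, labNerve_one_gen, LinearMap.sum_apply]
      rfl
  rw [LinearMap.comp_apply, LinearMap.sum_apply] at this
  exact this

theorem labNerve_of_two_le {i : ℕ} (h : 2 ≤ i) : labNerve P i = 0 := by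
  obtain ⟨j, rfl⟩ : ∃ j, i = j + 2 := ⟨i - 2, by omega⟩
  rfl

theorem forget_labNerve (i : ℕ) (x : Chain (Σ n, NerveSimplex (Face (X n)))) :
    forget (labNerve P i x) = nerveDiff P i x := by
  rcases i with _ | _ | i
  · exact forget_lab _ _
  · refine total_hom_ext (forget ∘ₗ labNerve P 1) (nerveDiff P 1) (fun n y => ?_) x
    rw [LinearMap.comp_apply, labNerve_one_incl, map_sum, nerveDiff, total_incl,
      LinearMap.sum_apply, map_sum]
    exact Finset.sum_congr rfl fun I _ => forget_lab _ _
  · exact map_zero _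

theorem delta_delta {a b : ℕ} (h : b ≤ a) (x : ℕ) : delta b (delta a x) = delta (a + 1) (delta b x) := by
  unfold delta
  split_ifs <;> omega

/-- The cosimplicial identity pairs the composites of two cofaces. Paired terms have equal labels as
well as equal chains, so they cancel before the labels are forgotten. -/
theorem labNerve_one_one (n : ℕ) (x : Chain (NerveSimplex (Face (X n)))) :
    labExt (labNerve P 1) (labNerve P 1 (incl n x)) = 0 := by
  let T : (Σ _ : Fin (n + 2), Fin (n + 1 + 2)) → Chain ((ℕ → ℕ) × Σ n, NerveSimplex (Face (X n))) :=
    fun p => lab (delta p.2 ∘ delta p.1) (incl (n + 1 + 1) (nerveMap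
      (P.map ((Fin.succAboveOrderEmb p.1).trans (Fin.succAboveOrderEmb p.2))) x))
  have h1 : labExt (labNerve P 1) (labNerve P 1 (incl n x)) =
      ∑ a : Fin (n + 2), ∑ b : Fin (n + 1 + 2), T ⟨a, b⟩ := by
    rw [labNerve_one_incl, map_sum]
    refine Finset.sum_congr rfl fun a _ => ?_
    rw [labExt_lab, labNerve_one_incl, map_sum]
    refine Finset.sum_congr rfl fun b _ => ?_
    rw [shift_lab, ← LinearMap.comp_apply (nerveMap _), ← nerveMap_comp, ← P.map_comp]
  have hT : ∀ p q : Σ _ : Fin (n + 2), Fin (n + 1 + 2),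
      (∀ y, delta p.2 (delta p.1 y) = delta q.2 (delta q.1 y)) → T p = T q := fun p q h => by
    have h2 : (delta p.2 ∘ delta p.1 : ℕ → ℕ) = delta q.2 ∘ delta q.1 := funext h
    have h3 : (Fin.succAboveOrderEmb p.1).trans (Fin.succAboveOrderEmb p.2) =
        (Fin.succAboveOrderEmb q.1).trans (Fin.succAboveOrderEmb q.2) := by
      refine RelEmbedding.ext fun y => Fin.ext ?_
      change ((Fin.succAboveOrderEmb p.2 (Fin.succAboveOrderEmb p.1 y) : Fin (n + 1 + 2)) : ℕ) =
        (Fin.succAboveOrderEmb q.2 (Fin.succAboveOrderEmb q.1 y) : Fin (n + 1 + 2))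
      rw [val_succAboveOrderEmb, val_succAboveOrderEmb, val_succAboveOrderEmb,
        val_succAboveOrderEmb, h]
    simp only [T, h2, h3]
  -- The pairing exchanges `(a, b)` with `b ≤ a` and `(b, a + 1)`; it has no fixed points.
  let ι : (Σ _ : Fin (n + 2), Fin (n + 1 + 2)) → Σ _ : Fin (n + 2), Fin (n + 1 + 2) := fun p =>
    if h : (p.2 : ℕ) ≤ p.1 then ⟨⟨p.2, by omega⟩, ⟨p.1 + 1, by omega⟩⟩
    else ⟨⟨p.2 - 1, by omega⟩, ⟨p.1, by omega⟩⟩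
  have hι : ∀ p, ((p.2 : ℕ) ≤ p.1 ∧ ((ι p).1 : ℕ) = p.2 ∧ ((ι p).2 : ℕ) = p.1 + 1) ∨
      ((p.1 : ℕ) < p.2 ∧ ((ι p).1 : ℕ) = p.2 - 1 ∧ ((ι p).2 : ℕ) = p.1) := fun p => by
    by_cases h : (p.2 : ℕ) ≤ p.1
    · simp [ι, h]
    · have h1 : ι p = ⟨⟨p.2 - 1, by omega⟩, ⟨p.1, by omega⟩⟩ := dif_neg h
      rw [h1]
      exact Or.inr ⟨by omega, rfl, rfl⟩
  have hext : ∀ p q : Σ _ : Fin (n + 2), Fin (n + 1 + 2), (p.1 : ℕ) = q.1 → (p.2 : ℕ) = q.2 →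
      p = q := by
    rintro ⟨a, b⟩ ⟨c, d⟩ h1 h2
    rw [Fin.ext (a := a) (b := c) h1, Fin.ext (a := b) (b := d) h2]
  rw [h1, Finset.sum_sigma']
  refine Finset.sum_involution (fun p _ => ι p) ?_ ?_ (fun _ _ => Finset.mem_sigma.mpr
      ⟨Finset.mem_univ _, Finset.mem_univ _⟩) ?_
  · intro p _
    rw [hT (ι p) p, ZModModule.add_self]
    intro y
    rcases hι p with ⟨h, h2, h3⟩ | ⟨h, h2, h3⟩
    · rw [h2, h3]
      exact (delta_delta h y).symm
    · rw [h2, h3, delta_delta (by omega), Nat.sub_add_cancel (by omega)]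
  · intro p _ _ h
    have h4 : ((ι p).2 : ℕ) = p.2 :=
      congrArg (fun p : Σ _ : Fin (n + 2), Fin (n + 1 + 2) => (p.2 : ℕ)) h
    rcases hι p with ⟨h, h2, h3⟩ | ⟨h, h2, h3⟩ <;> omega
  · intro p _
    refine hext _ _ ?_ ?_ <;> rcases hι p with ⟨h, h2, h3⟩ | ⟨h, h2, h3⟩ <;>
      rcases hι (ι p) with ⟨h', h2', h3'⟩ | ⟨h', h2', h3'⟩ <;> omega

/-- The labelled bicomplex equations. -/
theorem conv_labNerve_eq_zero (m : ℕ) (b : Σ n, NerveSimplex (Face (X n))) :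
    conv (fun i => labExt (labNerve P i)) (fun j => labNerve P j (gen b)) m = 0 := by
  obtain ⟨n, s⟩ := b
  rw [← incl_gen]
  have hbig : ∀ i j, 2 ≤ i ∨ 2 ≤ j → labExt (labNerve P i) (labNerve P j (incl n (gen s))) = 0 := by
    rintro i j (h | h)
    · rw [labNerve_of_two_le P h, labExt_zero, LinearMap.zero_apply]
    · rw [labNerve_of_two_le P h, LinearMap.zero_apply, map_zero]
  have h00 : labExt (labNerve P 0) (labNerve P 0 (incl n (gen s))) = 0 := by
    rw [labNerve_zero_incl, labExt_lab_id, labNerve_zero_incl, nerveBoundary_nerveBoundary, map_zero,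
      map_zero]
  have h01 : labExt (labNerve P 0) (labNerve P 1 (incl n (gen s))) =
      labExt (labNerve P 1) (labNerve P 0 (incl n (gen s))) := by
    rw [labNerve_zero_incl, labExt_lab_id, labNerve_one_incl, labNerve_one_incl, map_sum]
    refine Finset.sum_congr rfl fun a _ => ?_
    rw [labExt_lab, labNerve_zero_incl, shift_lab, nerveBoundary_nerveMap]
    rfl
  rcases m with _ | _ | _ | m
  · simpa [conv] using h00
  · have : Finset.HasAntidiagonal.antidiagonal 1 = {((0 : ℕ), 1), (1, 0)} := rfl
    rw [conv, this, Finset.sum_pair (by simp), h01, ZModModule.add_self]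
  · refine Finset.sum_eq_zero fun ij hij => ?_
    rw [Finset.HasAntidiagonal.mem_antidiagonal] at hij
    by_cases h : 2 ≤ ij.1 ∨ 2 ≤ ij.2
    · exact hbig _ _ h
    · obtain ⟨i, j⟩ := ij
      obtain rfl : i = 1 := by simp only at h hij; omega
      obtain rfl : j = 1 := by simp only at h hij; omega
      exact labNerve_one_one P n _
  · refine Finset.sum_eq_zero fun ij hij => ?_
    rw [Finset.HasAntidiagonal.mem_antidiagonal] at hij
    exact hbig _ _ (by omega)

end LabelledOperators

/-! ### Carriers for labelled chains, and fillings by cones. -/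

section Carriers

variable {X : ℕ → Type*} [∀ n, TopologicalSpace (X n)]
  [∀ n, Topology.CWComplex (Set.univ : Set (X n))] (P : SemicosimplicialFaces X)

/-- The label `e` represents the injection `φ`. -/
def Represents {n m : ℕ} (e : ℕ → ℕ) (φ : Fin (n + 1) ↪o Fin (m + 1)) : Prop :=
  ∀ x : Fin (n + 1), (φ x : ℕ) = e x

theorem Represents.eq {n m : ℕ} {e : ℕ → ℕ} {φ ψ : Fin (n + 1) ↪o Fin (m + 1)}
    (h : Represents e φ) (h' : Represents e ψ) : φ = ψ :=
  RelEmbedding.ext fun x => Fin.ext ((h x).trans (h' x).symm)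

theorem Represents.trans {n m l : ℕ} {e f : ℕ → ℕ} {φ : Fin (n + 1) ↪o Fin (m + 1)}
    {ψ : Fin (m + 1) ↪o Fin (l + 1)} (h : Represents e φ) (h' : Represents f ψ) :
    Represents (f ∘ e) (φ.trans ψ) := fun x => (h' (φ x)).trans (congrArg f (h x))

theorem represents_id (n : ℕ) :
    Represents id (RelEmbedding.refl (· ≤ · : Fin (n + 1) → Fin (n + 1) → Prop)) := fun _ => rfl

/-- The labelled cells below the images of `σ` in cosimplicial degree `n + j`, in dimension
`dim σ + j - 1`. -/
def cellCarrier (j : ℕ) (b : Σ n, Face (X n)) : Set ((ℕ → ℕ) × Σ n, Face (X n)) :=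
  {p | p.2.1 = b.1 + j ∧ p.2.2.dim + 1 = b.2.dim + j ∧
    ∃ φ : Fin (b.1 + 1) ↪o Fin (p.2.1 + 1), Represents p.1 φ ∧ p.2.2 ≤ P.map φ b.2}

/-- The labelled simplices of dimension `d` below the images of `σ` in cosimplicial degree
`n + l`. -/
def nerveCarrier (l d : ℕ) (b : Σ n, Face (X n)) :
    Set ((ℕ → ℕ) × Σ n, NerveSimplex (Face (X n))) :=
  {p | p.2.1 = b.1 + l ∧ p.2.2.dim = d ∧
    ∃ φ : Fin (b.1 + 1) ↪o Fin (p.2.1 + 1), Represents p.1 φ ∧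
      ∀ x ∈ p.2.2.verts, x ≤ P.map φ b.2}

theorem shift_mem {B : Type*} {S T : Set ((ℕ → ℕ) × B)} {e : ℕ → ℕ} {x : Chain ((ℕ → ℕ) × B)}
    (hx : x ∈ spanOn S) (h : ∀ p ∈ S, (p.1 ∘ e, p.2) ∈ T) : shift e x ∈ spanOn T :=
  map_mem_of_mem_spanOn hx _ fun p hp => by
    rw [mapGen_gen]
    exact gen_mem_spanOn (h p hp)

theorem lab_incl_mem {A : ℕ → Type*} {S : Set ((ℕ → ℕ) × Σ n, A n)} {e : ℕ → ℕ} {n : ℕ}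
    {T : Set (A n)} {x : Chain (A n)} (hx : x ∈ spanOn T) (h : ∀ a ∈ T, (e, ⟨n, a⟩) ∈ S) :
    lab e (incl n x) ∈ spanOn S :=
  map_mem_of_mem_spanOn hx (lab e ∘ₗ incl n) fun a ha => by
    rw [LinearMap.comp_apply, incl_gen, mapGen_gen]
    exact gen_mem_spanOn (h a ha)

theorem labDiff_mem {D : MultisetMaps X} {j : ℕ}
    (hdeg : ∀ (n : ℕ) (I : Sym (Fin (n + 2)) j) (σ : Face (X n)),
      ∀ τ ∈ (D n j I (Finsupp.single σ 1)).support, τ.dim + 1 = σ.dim + j)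
    (hsupp : ∀ (n : ℕ) (I : Sym (Fin (n + 2)) j) (σ : Face (X n)),
      ∀ τ ∈ (D n j I (Finsupp.single σ 1)).support, τ ≤ P.map (dMulti I) σ)
    (b : Σ n, Face (X n)) : labDiff D j (gen b) ∈ spanOn (cellCarrier P j b) := by
  obtain ⟨n, σ⟩ := b
  rw [labDiff_gen]
  refine Submodule.sum_mem _ fun I _ => lab_incl_mem (mem_spanOn_support _) fun τ hτ => ?_
  exact ⟨rfl, hdeg n I σ τ hτ, dMulti I, fun _ => rfl, hsupp n I σ τ hτ⟩

/-- Carriers compose: a cell below the image of `b` under one injection has its own image below the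
image of `b` under the composite, by monotonicity and functoriality of `P`. -/
theorem labExt_mem {s : Chain (Σ n, Face (X n)) →ₗ[ZMod 2]
      Chain ((ℕ → ℕ) × Σ n, NerveSimplex (Face (X n)))} {i j d : ℕ} {b : Σ n, Face (X n)}
    (hs : ∀ c, s (gen c) ∈ spanOn (nerveCarrier P i (c.2.dim + i) c)) {x}
    (hx : x ∈ spanOn (cellCarrier P j b)) (hd : b.2.dim + (i + j) = d + 1) :
    labExt s x ∈ spanOn (nerveCarrier P (i + j) d b) := by
  refine map_mem_of_mem_spanOn hx _ ?_
  rintro ⟨e, c⟩ ⟨h1, h2, φ, h3, h4⟩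
  rw [labExt_gen]
  refine shift_mem (hs c) ?_
  rintro ⟨f, m, t⟩ ⟨h5, h6, ψ, h7, h8⟩
  refine ⟨?_, ?_, φ.trans ψ, h3.trans h7, fun x hx => (h8 x hx).trans ?_⟩
  · simp only at h1 h5 ⊢
    omega
  · simp only at h2 h6 ⊢
    omega
  · rw [P.map_comp]
    exact (P.map ψ).monotone h4

theorem labExt_labNerve_one_mem {l d : ℕ} {b : Σ n, Face (X n)} {x}
    (hx : x ∈ spanOn (nerveCarrier P l d b)) :
    labExt (labNerve P 1) x ∈ spanOn (nerveCarrier P (l + 1) d b) := by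
  refine map_mem_of_mem_spanOn hx _ ?_
  rintro ⟨e, m, t⟩ ⟨h1, h2, φ, h3, h4⟩
  rw [labExt_gen, labNerve_one_gen, map_sum]
  refine Submodule.sum_mem _ fun a _ => ?_
  rw [shift_lab]
  refine lab_incl_mem (nerveMap_gen_mem _ t) fun u hu => ?_
  refine ⟨congrArg (· + 1) h1, hu.2.trans h2, φ.trans (Fin.succAboveOrderEmb a),
    h3.trans (val_succAboveOrderEmb a), fun y hy => ?_⟩
  obtain ⟨x, hx, rfl⟩ := hu.1 y hy
  rw [P.map_comp]
  exact (P.map _).monotone (h4 x hx)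

open Classical in
/-- The cones with apex the images of `σ`. -/
noncomputable def labCone (b : Σ n, Face (X n)) :
    Chain ((ℕ → ℕ) × Σ n, NerveSimplex (Face (X n))) →ₗ[ZMod 2]
      Chain ((ℕ → ℕ) × Σ n, NerveSimplex (Face (X n))) :=
  Finsupp.linearCombination (ZMod 2) fun p =>
    if h : ∃ φ : Fin (b.1 + 1) ↪o Fin (p.2.1 + 1), Represents p.1 φ then
      lab p.1 (incl p.2.1 (cone (P.map h.choose b.2) (gen p.2.2))) else 0

open Classical in
/-- The images of `σ` as vertices. -/
noncomputable def labApex (b : Σ n, Face (X n)) :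
    Chain ((ℕ → ℕ) × ℕ) →ₗ[ZMod 2] Chain ((ℕ → ℕ) × Σ n, NerveSimplex (Face (X n))) :=
  Finsupp.linearCombination (ZMod 2) fun p =>
    if h : ∃ φ : Fin (b.1 + 1) ↪o Fin (p.2 + 1), Represents p.1 φ then
      lab p.1 (incl p.2 (nv {P.map h.choose b.2})) else 0

variable (X) in
/-- The augmentation of the labelled simplices, one for each label and cosimplicial degree. -/
noncomputable def labAug : Chain ((ℕ → ℕ) × Σ n, NerveSimplex (Face (X n))) →ₗ[ZMod 2]
    Chain ((ℕ → ℕ) × ℕ) :=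
  Finsupp.linearCombination (ZMod 2) fun p =>
    nerveAugmentation (Face (X p.2.1)) (gen p.2.2) • gen (p.1, p.2.1)

theorem labAug_lab_incl (e : ℕ → ℕ) (n : ℕ) (x : Chain (NerveSimplex (Face (X n)))) :
    labAug X (lab e (incl n x)) = nerveAugmentation (Face (X n)) x • gen (e, n) :=
  eqOn_of_mem_spanOn (mem_spanOn_support x)
    (f := labAug X ∘ₗ lab e ∘ₗ incl (A := fun n => NerveSimplex (Face (X n))) n)
    (g := (nerveAugmentation (Face (X n))).smulRight (gen (e, n))) fun s _ => by
      rw [LinearMap.comp_apply, LinearMap.comp_apply, incl_gen, mapGen_gen]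
      simp [labAug]

variable {P}

theorem labCone_lab_incl {b : Σ n, Face (X n)} {e : ℕ → ℕ} {m : ℕ}
    {φ : Fin (b.1 + 1) ↪o Fin (m + 1)} (h : Represents e φ) (x : Chain (NerveSimplex (Face (X m)))) :
    labCone P b (lab e (incl m x)) = lab e (incl m (cone (P.map φ b.2) x)) :=
  eqOn_of_mem_spanOn (mem_spanOn_support x)
    (f := labCone P b ∘ₗ lab e ∘ₗ incl (A := fun n => NerveSimplex (Face (X n))) m)
    (g := lab e ∘ₗ incl (A := fun n => NerveSimplex (Face (X n))) m ∘ₗ cone (P.map φ b.2))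
    fun s _ => by
      have h1 : ∃ φ : Fin (b.1 + 1) ↪o Fin (m + 1), Represents e φ := ⟨φ, h⟩
      rw [LinearMap.comp_apply, LinearMap.comp_apply, incl_gen, mapGen_gen, labCone,
        Finsupp.linearCombination_single, one_smul, dif_pos h1, h1.choose_spec.eq h]
      rfl

theorem labApex_gen {b : Σ n, Face (X n)} {e : ℕ → ℕ} {m : ℕ}
    {φ : Fin (b.1 + 1) ↪o Fin (m + 1)} (h : Represents e φ) :
    labApex P b (gen (e, m)) = lab e (incl m (nv {P.map φ b.2})) := by
  have h1 : ∃ φ : Fin (b.1 + 1) ↪o Fin (m + 1), Represents e φ := ⟨φ, h⟩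
  rw [labApex, Finsupp.linearCombination_single, one_smul, dif_pos h1, h1.choose_spec.eq h]

theorem labExt_labNerve_zero (e : ℕ → ℕ) (m : ℕ) (x : Chain (NerveSimplex (Face (X m)))) :
    labExt (labNerve P 0) (lab e (incl m x)) =
      lab e (incl m (nerveBoundary (Face (X m)) x)) := by
  rw [labExt_lab, labNerve_zero_incl, shift_lab]
  rfl

theorem labCone_mem {l d : ℕ} {b : Σ n, Face (X n)} {x}
    (hx : x ∈ spanOn (nerveCarrier P l d b)) :
    labCone P b x ∈ spanOn (nerveCarrier P l (d + 1) b) := by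
  refine map_mem_of_mem_spanOn hx _ ?_
  rintro ⟨e, m, t⟩ ⟨h1, h2, φ, h3, h4⟩
  have h5 : gen (e, (⟨m, t⟩ : Σ n, NerveSimplex (Face (X n)))) = lab e (incl m (gen t)) := by
    rw [incl_gen, mapGen_gen]
  rw [h5, labCone_lab_incl h3]
  refine lab_incl_mem (cone_gen_mem h4) fun u hu => ⟨h1, hu.2.trans (congrArg (· + 1) h2), φ, h3,
    hu.1⟩

/-- A separate cone formula for each label and cosimplicial degree. The error is governed by
`labAug`, which records one augmentation for each of them. -/
theorem labExt_labCone {l d : ℕ} {b : Σ n, Face (X n)} {x}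
    (hx : x ∈ spanOn (nerveCarrier P l d b)) :
    labExt (labNerve P 0) (labCone P b x) + labCone P b (labExt (labNerve P 0) x) =
      x + labApex P b (labAug X x) := by
  refine eqOn_of_mem_spanOn hx
    (f := labExt (labNerve P 0) ∘ₗ labCone P b + labCone P b ∘ₗ labExt (labNerve P 0))
    (g := LinearMap.id + labApex P b ∘ₗ labAug X) ?_
  rintro ⟨e, m, t⟩ ⟨h1, h2, φ, h3, h4⟩
  have h5 : gen (e, (⟨m, t⟩ : Σ n, NerveSimplex (Face (X n)))) = lab e (incl m (gen t)) := by
    rw [incl_gen, mapGen_gen]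
  simp only [LinearMap.add_apply, LinearMap.comp_apply, LinearMap.id_apply]
  rw [h5, labCone_lab_incl h3, labExt_labNerve_zero, labExt_labNerve_zero, labCone_lab_incl h3,
    labAug_lab_incl, map_smul, labApex_gen h3, ← map_add, ← map_add,
    nerveBoundary_cone (gen_mem_spanOn h4), map_add, map_add, map_smul, map_smul]

/-- Cycles on a carrier are boundaries there. -/
theorem exists_fill {l d : ℕ} {b : Σ n, Face (X n)} {x}
    (hx : x ∈ spanOn (nerveCarrier P l d b)) (hx0 : labExt (labNerve P 0) x = 0)
    (haug : d = 0 → labAug X x = 0) :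
    ∃ y, y ∈ spanOn (nerveCarrier P l (d + 1) b) ∧ labExt (labNerve P 0) y = x := by
  have h1 : labAug X x = 0 := by
    by_cases hd : d = 0
    · exact haug hd
    · refine map_mem_of_mem_spanOn hx (labAug X) (N := ⊥) ?_
      rintro ⟨e, m, t⟩ ⟨-, h2, -⟩
      rw [Submodule.mem_bot, labAug, Finsupp.linearCombination_single, one_smul,
        nerveAugmentation_gen, if_neg (fun h => hd (h2.symm.trans h)), zero_smul]
  have h2 := labExt_labCone hx
  rw [hx0, map_zero, h1, map_zero, add_zero, add_zero] at h2
  exact ⟨_, labCone_mem hx, h2⟩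

theorem nerveAugmentation_nerveMap {Q R : Type*} [PartialOrder Q] [PartialOrder R] (f : Q →o R)
    (x : Chain (NerveSimplex Q)) :
    nerveAugmentation R (nerveMap f x) = nerveAugmentation Q x := by
  classical
  refine eqOn_of_mem_spanOn (mem_spanOn_support x) (f := nerveAugmentation R ∘ₗ nerveMap f)
    fun s _ => ?_
  rw [LinearMap.comp_apply, nerveAugmentation_gen]
  split_ifs with h
  · obtain ⟨v, hv⟩ := Finset.card_eq_one.mp (s.card_eq.trans (by rw [h]))
    rw [← nv_verts, hv, nerveMap_nv f (by simp), Finset.image_singleton,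
      if_pos (by rw [Finset.card_singleton, Finset.card_singleton]),
      nv_of_isChain (Finset.singleton_nonempty _) (by simp), nerveAugmentation_gen, if_pos]
    simp [NerveSimplex.dim]
  · refine nerveAugmentation_eq_zero h (spanOn_mono ?_ (nerveMap_gen_mem f s))
    exact fun t ht => ht.2

end Carriers

/-! ### Construction of the labelled morphism, and removal of the labels. -/

section Morphism

variable {X : ℕ → Type*} [∀ n, TopologicalSpace (X n)]
  [∀ n, Topology.CWComplex (Set.univ : Set (X n))] {D : MultisetMaps X}

theorem sum_sym_zero {n : ℕ} {M : Type*} [AddCommMonoid M] (f : Sym (Fin (n + 2)) 0 → M) :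
    ∑ I, f I = f Sym.nil := by
  rw [Fintype.sum_unique]
  exact congrArg f (Subsingleton.elim _ _)

theorem labDiff_zero (hempty : ∀ n : ℕ, D n 0 Sym.nil = cellularBoundary (X n))
    (x : Chain (Σ n, Face (X n))) :
    labDiff D 0 x = lab id (dsum (fun n => cellularBoundary (X n)) x) :=
  total_hom_ext (labDiff D 0) (lab id ∘ₗ dsum fun n => cellularBoundary (X n)) (fun n y => by
    rw [labDiff_incl, sum_sym_zero, multiLabel_nil, hempty, LinearMap.comp_apply, total_zero_incl]
    rfl) x

theorem sumDiff_zero (hempty : ∀ n : ℕ, D n 0 Sym.nil = cellularBoundary (X n)) :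
    sumDiff D 0 = dsum fun n => cellularBoundary (X n) :=
  LinearMap.ext fun x => by rw [← forget_labDiff, labDiff_zero hempty, forget_lab]

theorem incl_injective {A : ℕ → Type*} (n : ℕ) : Function.Injective (incl (A := A) n) :=
  mapGen_injective sigma_mk_injective

/-- No geometry is needed: this is the sliced equation for the empty multiset. -/
theorem cellularBoundary_cellularBoundary
    (hempty : ∀ n : ℕ, D n 0 Sym.nil = cellularBoundary (X n))
    (hD : ∀ (n : ℕ) (K : Sym (Fin (n + 2)) 0) (x : Chain (Face (X n))), slicedSum D K x = 0)
    (n : ℕ) (x : Chain (Face (X n))) : cellularBoundary (X n) (cellularBoundary (X n) x) = 0 := by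
  refine eqOn_of_mem_spanOn (mem_spanOn_support x)
    (f := cellularBoundary (X n) ∘ₗ cellularBoundary (X n)) (g := 0) fun σ _ => ?_
  have h1 : labExt (labDiff D 0) (labDiff D 0 (gen ⟨n, σ⟩)) = 0 := by
    simpa [conv] using conv_labDiff_eq_zero hD ⟨n, σ⟩
  rw [labDiff_zero hempty, labExt_lab_id, labDiff_zero hempty, ← incl_gen, total_zero_incl,
    total_zero_incl] at h1
  have h2 := congrArg forget h1
  rw [forget_lab, map_zero] at h2
  exact incl_injective n (h2.trans (map_zero _).symm)

theorem conv_one {M M' : Type*} [AddCommGroup M] [Module (ZMod 2) M] [AddCommGroup M']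
    [Module (ZMod 2) M'] (S : ℕ → M →ₗ[ZMod 2] M') (x : ℕ → M) :
    conv S x 1 = S 0 (x 1) + S 1 (x 0) := by
  have : Finset.HasAntidiagonal.antidiagonal 1 = {((0 : ℕ), 1), (1, 0)} := rfl
  rw [conv, this, Finset.sum_pair (by simp)]

variable (P : SemicosimplicialFaces X)

/-- The subdivision map, with trivial labels. -/
noncomputable abbrev labSubdivision : Chain (Σ n, Face (X n)) →ₗ[ZMod 2]
    Chain ((ℕ → ℕ) × Σ n, NerveSimplex (Face (X n))) :=
  lab id ∘ₗ dsum fun n => subdivision (X n)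

theorem labSubdivision_incl (n : ℕ) (x : Chain (Face (X n))) :
    labSubdivision (incl n x) = lab id (incl n (subdivision (X n) x)) := by
  rw [LinearMap.comp_apply, total_zero_incl]

theorem labSubdivision_mem (b : Σ n, Face (X n)) :
    labSubdivision (gen b) ∈ spanOn (nerveCarrier P 0 b.2.dim b) := by
  obtain ⟨n, σ⟩ := b
  rw [← incl_gen, labSubdivision_incl]
  refine lab_incl_mem (subdivision_mem σ) fun t ht => ⟨rfl, ht.2, _, represents_id n, ?_⟩
  rw [P.map_id]
  exact ht.1

/-- Compared label by label: the coface labelled `a` preserves the augmentation on the nerves, and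
`D_{a}` does so on cells by `haug`. -/
theorem labAug_labSubdivision (haug : ∀ (n : ℕ) (a : Fin (n + 2)),
      augmentation (X (n + 1)) ∘ₗ D n 1 (Sym.oneEquiv a) = augmentation (X n))
    (n : ℕ) (x : Chain (Face (X n))) :
    labAug X (labExt labSubdivision (labDiff D 1 (incl n x))) =
      labAug X (labExt (labNerve P 1) (labSubdivision (incl n x))) := by
  rw [labSubdivision_incl, labExt_lab_id, labNerve_one_incl, labDiff_incl, ← Sym.oneEquiv.sum_comp,
    map_sum, map_sum, map_sum]
  refine Finset.sum_congr rfl fun a _ => ?_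
  rw [labAug_lab_incl, nerveAugmentation_nerveMap, nerveAugmentation_subdivision,
    labExt_lab, labSubdivision_incl, shift_lab, multiLabel_oneEquiv]
  refine (labAug_lab_incl _ _ _).trans ?_
  rw [nerveAugmentation_subdivision, ← LinearMap.comp_apply, haug]
  rfl

theorem nerveCarrier_mono {n : ℕ} {σ τ : Face (X n)} (h : τ ≤ σ) (l d : ℕ) :
    nerveCarrier P l d ⟨n, τ⟩ ⊆ nerveCarrier P l d ⟨n, σ⟩ := by
  rintro p ⟨h1, h2, φ, h3, h4⟩
  exact ⟨h1, h2, φ, h3, fun x hx => (h4 x hx).trans ((P.map φ).monotone h)⟩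

variable {P}

/-- Three contributions: composites of known components with cell operators, by composition of
carriers; the cofaces applied to component `l`, as the vertical term is zero and there are no higher
operators; and earlier values on the faces of the cell. -/
theorem obstruction_mem {l : ℕ}
    (hDm : ∀ j ≤ l + 1, ∀ b, labDiff D j (gen b) ∈ spanOn (cellCarrier P j b))
    {s : ℕ → Chain (Σ n, Face (X n)) →ₗ[ZMod 2]
      Chain ((ℕ → ℕ) × Σ n, NerveSimplex (Face (X n)))} (hsl : s (l + 1) = 0)
    (hs : ∀ i ≤ l, ∀ b, s i (gen b) ∈ spanOn (nerveCarrier P i (b.2.dim + i) b))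
    (b : Σ n, Face (X n)) {h : Chain (Σ n, Face (X n)) →ₗ[ZMod 2]
      Chain ((ℕ → ℕ) × Σ n, NerveSimplex (Face (X n)))}
    (hh : ∀ b' : Σ n, Face (X n), b'.2.dim < b.2.dim →
      h (gen b') ∈ spanOn (nerveCarrier P (l + 1) (b'.2.dim + (l + 1)) b')) :
    conv (fun i => labExt (s i)) (fun j => labDiff D j (gen b)) (l + 1) +
      conv (fun i => labExt (labNerve P i)) (fun j => s j (gen b)) (l + 1) +
      h (dsum (fun n => cellularBoundary (X n)) (gen b)) ∈
        spanOn (nerveCarrier P (l + 1) (b.2.dim + l) b) := by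
  refine Submodule.add_mem _ (Submodule.add_mem _ ?_ ?_) ?_
  · refine Submodule.sum_mem _ fun ij hij => ?_
    rw [Finset.HasAntidiagonal.mem_antidiagonal] at hij
    by_cases hi : ij.1 ≤ l
    · have := labExt_mem P (d := b.2.dim + l) (hs ij.1 hi) (hDm ij.2 (by omega) b) (by omega)
      rwa [hij] at this
    · obtain hi' : ij.1 = l + 1 := by omega
      simp only [hi', hsl, labExt_zero, LinearMap.zero_apply]
      exact Submodule.zero_mem _
  · refine Submodule.sum_mem _ fun ij hij => ?_
    rw [Finset.HasAntidiagonal.mem_antidiagonal] at hij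
    obtain ⟨i, j⟩ := ij
    simp only at hij ⊢
    rcases i with _ | _ | i
    · obtain rfl : j = l + 1 := by omega
      rw [hsl, LinearMap.zero_apply, map_zero]
      exact Submodule.zero_mem _
    · obtain rfl : j = l := by omega
      exact labExt_labNerve_one_mem P (hs j le_rfl b)
    · rw [labNerve_of_two_le P (by omega), labExt_zero]
      exact Submodule.zero_mem _
  · obtain ⟨n, σ⟩ := b
    rw [← incl_gen, total_zero_incl]
    refine map_mem_of_mem_spanOn (cellularBoundary_mem σ)
      (h ∘ₗ incl (A := fun n => Face (X n)) n) fun τ hτ => ?_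
    rw [LinearMap.comp_apply, incl_gen]
    have h1 := hτ.2
    have h2 := hh ⟨n, τ⟩ (by simp only; omega)
    have h3 : τ.dim + (l + 1) = σ.dim + l := by omega
    simp only [h3] at h2
    exact spanOn_mono (nerveCarrier_mono P hτ.1 _ _) h2

variable (P) in
theorem exists_labelled_morphism [∀ n, T2Space (X n)] (hX : ∀ n, IsRegularCW (X n)) {r : ℕ}
    (hDm : ∀ j ≤ r, ∀ b, labDiff D j (gen b) ∈ spanOn (cellCarrier P j b))
    (hempty : ∀ n : ℕ, D n 0 Sym.nil = cellularBoundary (X n))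
    (haug : 1 ≤ r → ∀ (n : ℕ) (a : Fin (n + 2)),
      augmentation (X (n + 1)) ∘ₗ D n 1 (Sym.oneEquiv a) = augmentation (X n))
    (hD : ∀ l ≤ r, ∀ (n : ℕ) (K : Sym (Fin (n + 2)) l) (x : Chain (Face (X n))),
      slicedSum D K x = 0) :
    ∃ s : ℕ → Chain (Σ n, Face (X n)) →ₗ[ZMod 2] Chain ((ℕ → ℕ) × Σ n, NerveSimplex (Face (X n))),
      s 0 = labSubdivision ∧
      (∀ i ≤ r, ∀ b, s i (gen b) ∈ spanOn (nerveCarrier P i (b.2.dim + i) b)) ∧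
      ∀ m ≤ r, ∀ b, conv (fun i => labExt (s i)) (fun j => labDiff D j (gen b)) m =
        conv (fun i => labExt (labNerve P i)) (fun j => s j (gen b)) m := by
  have hdd := cellularBoundary_cellularBoundary hempty (hD 0 (Nat.zero_le r))
  refine exists_sliced_morphism (bd := dsum fun n => cellularBoundary (X n)) (fun b => b.2.dim)
    (fun l b => nerveCarrier P l (b.2.dim + l) b) (labDiff_zero hempty) ?_
    (total_hom_ext ((dsum fun n => cellularBoundary (X n)) ∘ₗ dsum fun n => cellularBoundary (X n))
      0 fun n x => by
        rw [LinearMap.comp_apply, total_zero_incl, total_zero_incl, hdd, map_zero,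
          LinearMap.zero_apply])
    (fun m hm => conv_labDiff_eq_zero (hD m hm)) (conv_labNerve_eq_zero P) ?_
    (labSubdivision_mem P) ?_
  · rintro ⟨n, σ⟩
    rw [← incl_gen, total_zero_incl]
    refine map_mem_of_mem_spanOn (cellularBoundary_mem σ) _ fun τ hτ => ?_
    rw [incl_gen]
    refine gen_mem_spanOn ?_
    have := hτ.2
    change τ.dim < σ.dim
    omega
  · rintro ⟨n, σ⟩
    rw [← incl_gen, labDiff_zero hempty, labExt_lab_id, total_zero_incl, labSubdivision_incl,
      labSubdivision_incl, labExt_lab_id, labNerve_zero_incl, nerveBoundary_subdivision (hX n) (hdd n)]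
  · rintro l hl s hs0 hsl hs b h hh z rfl hz
    refine exists_fill (obstruction_mem (fun j hj => hDm j (by omega)) hsl hs b hh) hz
      fun hd => ?_
    obtain ⟨n, σ⟩ := b
    -- An obstruction of dimension 0 occurs only for a vertex and the component of order one; there
    -- it is `sd D_1 v + d sd v`, whose augmentations cancel.
    have hσl : σ.dim + l = 0 := hd
    obtain rfl : l = 0 := by omega
    have hbd : cellularBoundary (X n) (gen σ) = 0 :=
      eq_zero_of_mem_spanOn_empty (fun τ hτ => by
        have := hτ.2
        omega) (cellularBoundary_mem σ)
    simp only [zero_add] at hsl ⊢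
    rw [conv_one, conv_one, hsl, labExt_zero, hs0, LinearMap.zero_apply, LinearMap.zero_apply,
      map_zero, add_zero, zero_add, ← incl_gen, total_zero_incl, hbd, map_zero, map_zero, add_zero,
      map_add, labAug_labSubdivision P (haug hl), ZModModule.add_self]

theorem bidegree_sumDiff {r : ℕ} (hdeg : ∀ i ≤ r, ∀ (n : ℕ) (I : Sym (Fin (n + 2)) i)
      (σ : Face (X n)), ∀ τ ∈ (D n i I (gen σ)).support, τ.dim + 1 = σ.dim + i)
    {i : ℕ} (hi : i ≤ r) {p q : ℤ} {x : Chain (Σ n, Face (X n))} (hx : x ∈ cellGrading X p q) :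
    sumDiff D i x ∈ cellGrading X (p - i) (q + i - 1) := by
  rw [add_sub_assoc]
  refine total_mem_bigrading (fun n σ => ?_) hx
  rw [LinearMap.sum_apply]
  refine Submodule.sum_mem _ fun I _ => ?_
  refine spanOn_mono ?_ (mem_spanOn_support _)
  intro τ hτ
  have h1 := hdeg i hi n I σ τ hτ
  change (τ.dim : ℤ) = σ.dim + (i - 1)
  omega

/-- Forgetting labels turns equivariant extensions into plain composites, so labelled relations
imply the unlabelled ones. -/
theorem equation_of_labelled {B B' B'' : Type*} {S : ℕ → Chain B' →ₗ[ZMod 2] Chain ((ℕ → ℕ) × B'')}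
    {d : ℕ → Chain B →ₗ[ZMod 2] Chain ((ℕ → ℕ) × B')} (m : ℕ) (b : B) :
    forget (conv (fun i => labExt (S i)) (fun j => d j (gen b)) m) =
      (∑ ij ∈ Finset.HasAntidiagonal.antidiagonal m,
        (forget ∘ₗ S ij.1) ∘ₗ (forget ∘ₗ d ij.2)) (gen b) := by
  rw [conv, map_sum, LinearMap.sum_apply]
  exact Finset.sum_congr rfl fun ij _ => forget_labExt _ _

theorem isTruncatedMulticomplex_sumDiff {r : ℕ} (hdeg : ∀ i ≤ r, ∀ (n : ℕ)
      (I : Sym (Fin (n + 2)) i) (σ : Face (X n)),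
      ∀ τ ∈ (D n i I (gen σ)).support, τ.dim + 1 = σ.dim + i)
    (hD : ∀ l ≤ r, ∀ (n : ℕ) (K : Sym (Fin (n + 2)) l) (x : Chain (Face (X n))),
      slicedSum D K x = 0) : IsTruncatedMulticomplex r (cellGrading X) (sumDiff D) where
  internal := isInternal_bigrading _
  bidegree i hi p q x hx := bidegree_sumDiff hdeg hi hx
  equation l hl := chain_hom_ext fun b => by
    have h1 := equation_of_labelled (S := labDiff D) (d := labDiff D) l b
    rw [conv_labDiff_eq_zero (hD l hl), map_zero] at h1
    simp only [show ∀ i, forget ∘ₗ labDiff D i = sumDiff D i from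
      fun i => LinearMap.ext (forget_labDiff D i)] at h1
    exact h1.symm

variable (P) in
theorem isTruncatedMulticomplex_nerveDiff (r : ℕ) :
    IsTruncatedMulticomplex r (nerveGrading X) (nerveDiff P) where
  internal := isInternal_bigrading _
  bidegree i _ p q x hx := by
    rw [add_sub_assoc]
    rcases i with _ | _ | i
    · refine total_mem_bigrading (dim' := fun n (s : NerveSimplex (Face (X n))) => s.dim) (i := 0)
        (f := fun n => nerveBoundary (Face (X n)))
        (fun n s => spanOn_mono ?_ (nerveBoundary_gen_mem s)) hx
      intro t ht
      have h1 := ht.2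
      change (t.dim : ℤ) = s.dim + (((0 : ℕ) : ℤ) - 1)
      omega
    · refine total_mem_bigrading (dim' := fun n (s : NerveSimplex (Face (X n))) => s.dim) (i := 1)
        (f := fun n => ∑ a : Fin (n + 2), nerveMap (P.map (Fin.succAboveOrderEmb a)))
        (fun n s => ?_) hx
      rw [LinearMap.sum_apply]
      refine Submodule.sum_mem _ fun a _ => spanOn_mono ?_ (nerveMap_gen_mem _ s)
      intro t ht
      have h1 := ht.2
      change (t.dim : ℤ) = s.dim + (((0 + 1 : ℕ) : ℤ) - 1)
      omega
    · exact Submodule.zero_mem _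
  equation l _ := chain_hom_ext fun b => by
    have h1 := equation_of_labelled (S := labNerve P) (d := labNerve P) l b
    rw [conv_labNerve_eq_zero, map_zero] at h1
    simp only [show ∀ i, forget ∘ₗ labNerve P i = nerveDiff P i from
      fun i => LinearMap.ext (forget_labNerve P i)] at h1
    exact h1.symm

theorem isTruncatedMorphism_forget {r : ℕ}
    {s : ℕ → Chain (Σ n, Face (X n)) →ₗ[ZMod 2]
      Chain ((ℕ → ℕ) × Σ n, NerveSimplex (Face (X n)))}
    (hs : ∀ i ≤ r, ∀ b, s i (gen b) ∈ spanOn (nerveCarrier P i (b.2.dim + i) b))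
    (heq : ∀ m ≤ r, ∀ b, conv (fun i => labExt (s i)) (fun j => labDiff D j (gen b)) m =
        conv (fun i => labExt (labNerve P i)) (fun j => s j (gen b)) m) :
    IsTruncatedMorphism r (cellGrading X) (sumDiff D) (nerveGrading X) (nerveDiff P)
      fun i => forget ∘ₗ s i where
  bidegree i hi p q x hx := bigrading_map_mem hx _ fun n σ hp hq =>
    map_mem_of_mem_spanOn (hs i hi ⟨n, σ⟩) forget fun c hc => by
      rw [mapGen_gen]
      refine gen_mem_spanOn ⟨?_, ?_⟩
      · have h1 : c.2.1 = n + i := hc.1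
        rw [h1]
        push_cast
        omega
      · have h1 : c.2.2.dim = σ.dim + i := hc.2.1
        change (c.2.2.dim : ℤ) = q + i
        rw [h1]
        push_cast
        omega
  equation l hl := chain_hom_ext fun b => by
    have h1 := equation_of_labelled (S := s) (d := labDiff D) l b
    rw [heq l hl, equation_of_labelled] at h1
    simp only [show ∀ i, forget ∘ₗ labDiff D i = sumDiff D i from
      fun i => LinearMap.ext (forget_labDiff D i), show ∀ i, forget ∘ₗ labNerve P i = nerveDiff P i
      from fun i => LinearMap.ext (forget_labNerve P i)] at h1
    exact h1.symm

end Morphism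
end BarycentricDeformation

theorem mainTheorem2 (r : ℕ) {X : ℕ → Type*} [∀ n, TopologicalSpace (X n)] [∀ n, T2Space (X n)]
    [∀ n, Topology.CWComplex (Set.univ : Set (X n))] (hX : ∀ n, IsRegularCW (X n))
    (P : SemicosimplicialFaces X) (D : MultisetMaps X)
    -- `D_I` maps `C_n(d)` to `C_{n+i}(d+i-1)`
    (hdeg : ∀ i ≤ r, ∀ (n : ℕ) (I : Sym (Fin (n + 2)) i) (σ : Face (X n)),
      ∀ τ ∈ (D n i I (Finsupp.single σ 1)).support, τ.dim + 1 = σ.dim + i)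
    -- `D_∅` is the cellular differential
    (hempty : ∀ n : ℕ, D n 0 Sym.nil = cellularBoundary (X n))
    -- each `D_{a}` preserves the augmentation
    (haug : 1 ≤ r → ∀ (n : ℕ) (a : Fin (n + 2)),
      augmentation (X (n + 1)) ∘ₗ D n 1 (Sym.oneEquiv a) = augmentation (X n))
    -- the sliced multicomplex equations
    (hsliced : ∀ l ≤ r, ∀ (n : ℕ) (K : Sym (Fin (n + 2)) l) (x : Face (X n) →₀ ZMod 2),
      slicedSum D K x = 0)
    -- `D_I σ` is a sum of cells below `d_I σ`
    (hsupp : ∀ i ≤ r, ∀ (n : ℕ) (I : Sym (Fin (n + 2)) i) (σ : Face (X n)),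
      ∀ τ ∈ (D n i I (Finsupp.single σ 1)).support, τ ≤ P.map (dMulti I) σ) :
    IsTruncatedMulticomplex r (cellGrading X) (sumDiff D) ∧
    IsTruncatedMulticomplex r (nerveGrading X) (nerveDiff P) ∧
    ∃ sd : ℕ → (((Σ n, Face (X n)) →₀ ZMod 2) →ₗ[ZMod 2]
        ((Σ n, NerveSimplex (Face (X n))) →₀ ZMod 2)),
      IsTruncatedMorphism r (cellGrading X) (sumDiff D) (nerveGrading X) (nerveDiff P) sd ∧
      sd 0 = total 0 (fun n => subdivision (X n)) ∧
      ∀ s : ℕ, 1 ≤ s → s ≤ r → ∀ p q : ℤ,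
        boundaries (cellGrading X) (sumDiff D) s p q ≤ cycles (cellGrading X) (sumDiff D) s p q ∧
        boundaries (nerveGrading X) (nerveDiff P) s p q ≤
          cycles (nerveGrading X) (nerveDiff P) s p q ∧
        ∃ e : Page (cellGrading X) (sumDiff D) s p q ≃ₗ[ZMod 2]
            Page (nerveGrading X) (nerveDiff P) s p q,
          ∀ x : cycles (cellGrading X) (sumDiff D) s p q,
            ∃ h : sd 0 x ∈ cycles (nerveGrading X) (nerveDiff P) s p q,
              e (Submodule.Quotient.mk x) = Submodule.Quotient.mk ⟨sd 0 x, h⟩ := by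
  have hDm : ∀ j ≤ r, ∀ b, labDiff D j (gen b) ∈ spanOn (cellCarrier P j b) := fun j hj b =>
    labDiff_mem P (hdeg j hj) (hsupp j hj) b
  obtain ⟨s, hs0, hs, heq⟩ := exists_labelled_morphism P hX hDm hempty haug hsliced
  have hM := isTruncatedMulticomplex_sumDiff hdeg hsliced
  have hM' := isTruncatedMulticomplex_nerveDiff P r
  have hf := isTruncatedMorphism_forget hs heq
  have hsd : forget ∘ₗ s 0 = dsum fun n => subdivision (X n) :=
    LinearMap.ext fun x => by rw [hs0, LinearMap.comp_apply, LinearMap.comp_apply, forget_lab]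
  have h0 := isLeadingQuasiIso_subdivision hX
    (cellularBoundary_cellularBoundary hempty (hsliced 0 (Nat.zero_le r)))
  rw [← sumDiff_zero hempty, ← hsd] at h0
  refine ⟨hM, hM', fun i => forget ∘ₗ s i, hf, hsd, fun t ht htr p q => ?_⟩
  -- The inclusion is first established in the bicomplex; for the cells it is then deduced together
  -- with the isomorphism.
  have hBZ := boundaries_le_cycles_of_bicomplex (p := p) (q := q) hM' (fun i hi => by
    obtain ⟨j, rfl⟩ : ∃ j, i = j + 2 := ⟨i - 2, by omega⟩
    rfl) ht htr
  obtain ⟨h1, h2⟩ := IsLeadingQuasiIso.page_equiv (D' := nerveDiff P)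
    (f := fun i => forget ∘ₗ s i) h0 hM hM' hf ht htr hBZ
  exact ⟨h1, hBZ, h2⟩
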